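/- Let $K$ be an algebraically closed field with $\operatorname{char} K\neq 2$ and let $n\geq 1$. Let $\Lambda=P(\mathbb{L}_n)$ be the preprojective algebra of type $\mathbb{L}_n$ over $K$: the quotient of the path algebra of the quiver with vertices $1,\dots,n$, a loop $\epsilon$ at the vertex $1$ and arrows $a_i\colon i\to i+1$, $\bar a_i\colon i+1\to i$ for $1\leq i\leq n-1$, by the two-sided ideal generated by the elements $\sum_{i(a)=i}a\bar a$, one for each vertex $i$, where the sum runs over the arrows $a$ with origin $i$, and $\bar\epsilon=\epsilon$, $\bar{\bar a}_i=a_i$. Let $\Lambda^e=\Lambda\otimes_K\Lambda^{op}$, and for $i\geq 0$ let $HH^i(\Lambda)=\operatorname{Ext}^i_{\Lambda^e}(\Lambda,\Lambda)$ and $HH_i(\Lambda)=\operatorname{Tor}_i^{\Lambda^e}(\Lambda,\Lambda)$ be the Hochschild cohomology and homology spaces of $\Lambda$. Then $$\dim_K HH^0(\Lambda)=\dim_K HH_0(\Lambda)=2n,\qquad \dim_K HH^i(\Lambda)=\dim_K HH_i(\Lambda)=n\quad\text{for all } i>0.$$ -/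

import Mathlib

open CategoryTheory
open scoped TensorProduct

universe u

noncomputable section

/-! ### Path algebras and preprojective algebras -/

/-- A quiver with vertex set `V` and arrow set `A`, in which every arrow `a : i → j` comes with an
opposite arrow `bar a : j → i`; it is the quiver attached to a nonoriented graph, where the loops
of the graph are the arrows with `bar a = a`. -/
structure SymQuiver (V A : Type) where
  src : A → V
  tgt : A → V
  bar : A → A
  bar_bar : ∀ a, bar (bar a) = a
  src_bar : ∀ a, src (bar a) = tgt a

namespace SymQuiver

variable {V A : Type} (Q : SymQuiver V A) (K : Type u) [Field K]

/-- The vertex `i`, as a generator of the free algebra on vertices and arrows. -/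
def freeVertex (i : V) : FreeAlgebra K (V ⊕ A) := FreeAlgebra.ι K (Sum.inl i)

/-- The arrow `a`, as a generator of the free algebra on vertices and arrows. -/
def freeArrow (a : A) : FreeAlgebra K (V ⊕ A) := FreeAlgebra.ι K (Sum.inr a)

/-- The defining relations of the path algebra of a finite quiver: the vertices are orthogonal
idempotents with sum `1`, and `e_{i(a)} a = a = a e_{t(a)}` for every arrow `a`. Paths are
written from left to right: `a b` is nonzero only if `a` ends where `b` starts. -/
inductive PathRel [Fintype V] : FreeAlgebra K (V ⊕ A) → FreeAlgebra K (V ⊕ A) → Prop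
  | idem (i : V) : PathRel (freeVertex K i * freeVertex K i) (freeVertex K i)
  | orth (i j : V) (h : i ≠ j) : PathRel (freeVertex K i * freeVertex K j) 0
  | sum_one : PathRel (∑ i : V, freeVertex K i) 1
  | src_mul (a : A) : PathRel (freeVertex K (Q.src a) * freeArrow K a) (freeArrow K a)
  | mul_tgt (a : A) : PathRel (freeArrow K a * freeVertex K (Q.tgt a)) (freeArrow K a)

/-- The path algebra `K Q` of a finite quiver. -/
abbrev PathAlgebra [Fintype V] : Type u := RingQuot (Q.PathRel K)

/-- An arrow, as an element of the path algebra. -/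
def arrow [Fintype V] (a : A) : Q.PathAlgebra K :=
  RingQuot.mkAlgHom K (Q.PathRel K) (freeArrow K a)

open Classical in
/-- The preprojective relations: one relation `∑_{i(a) = i} a ā = 0` for each vertex `i`. -/
inductive PreprojRel [Fintype V] [Fintype A] : Q.PathAlgebra K → Q.PathAlgebra K → Prop
  | vertex (i : V) :
      PreprojRel (∑ a : A with Q.src a = i, Q.arrow K a * Q.arrow K (Q.bar a)) 0

/-- The preprojective algebra: the path algebra modulo the preprojective relations. -/
abbrev Preprojective [Fintype V] [Fintype A] : Type u := RingQuot (Q.PreprojRel K)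

end SymQuiver

/-- The arrows of the quiver of the graph `𝕃_n`: the loop `ε`, and `a_i`, `ā_i` for `n - 1` values
of `i` (counted from `0`). -/
inductive LArrow (n : ℕ) : Type
  | loop : LArrow n
  | up (i : Fin (n - 1)) : LArrow n
  | down (i : Fin (n - 1)) : LArrow n
  deriving DecidableEq, Fintype

/-- The quiver of the graph `𝕃_n`, `n ≥ 1`: vertices `0, …, n - 1`, a loop `ε` at `0`, and arrows
`a_i : i → i + 1`, `ā_i : i + 1 → i` for `0 ≤ i < n - 1`. -/
def LQuiver (n : ℕ) [NeZero n] : SymQuiver (Fin n) (LArrow n) where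
  src
    | .loop => 0
    | .up i => ⟨i, by omega⟩
    | .down i => ⟨i + 1, by omega⟩
  tgt
    | .loop => 0
    | .up i => ⟨i + 1, by omega⟩
    | .down i => ⟨i, by omega⟩
  bar
    | .loop => .loop
    | .up i => .down i
    | .down i => .up i
  bar_bar a := by cases a <;> rfl
  src_bar a := by cases a <;> rfl

/-- The preprojective algebra `P(𝕃_n)`. -/
abbrev PL (K : Type u) [Field K] (n : ℕ) [NeZero n] : Type u := (LQuiver n).Preprojective K

/-! ### Hochschild cohomology and homology -/

section Hochschild

variable (K : Type u) [Field K] (L : Type u) [Ring L] [Algebra K L]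

/-- The enveloping algebra `L ⊗ Lᵒᵖ`. -/
abbrev EnvAlg : Type u := L ⊗[K] Lᵐᵒᵖ

/-- `L` as a left module over its enveloping algebra: `(a ⊗ bᵒ) m = a m b`. -/
def envSelf : ModuleCat.{u} (EnvAlg K L) :=
  @ModuleCat.of (EnvAlg K L) _ L _ TensorProduct.Algebra.module

/-- Hochschild cohomology `HH^i(L) = Ext^i_{L ⊗ Lᵒᵖ}(L, L)`. -/
def HHcoh (i : ℕ) : ModuleCat.{u} K :=
  ((Ext K (ModuleCat.{u} (EnvAlg K L)) i).obj (Opposite.op (envSelf K L))).obj (envSelf K L)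

open scoped ModuleCat

/-- The subspace of `L ⊗ N` by which one divides to get `L ⊗_{L ⊗ Lᵒᵖ} N`: it is spanned by the
elements `m x ⊗ v - m ⊗ x v`, with `x = a ⊗ bᵒ`, where `L` is a right module over `L ⊗ Lᵒᵖ` by
`m (a ⊗ bᵒ) = b m a`. -/
def balancing (N : ModuleCat.{u} (EnvAlg K L)) : Submodule K (L ⊗[K] N) :=
  Submodule.span K {z | ∃ (a b m : L) (v : N),
    z = (b * m * a) ⊗ₜ[K] v - m ⊗ₜ[K] ((a ⊗ₜ[K] MulOpposite.op b : EnvAlg K L) • v)}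

/-- The map `L ⊗ N → L ⊗ N'` induced by a morphism `N → N'`. -/
def lTensorHom {N N' : ModuleCat.{u} (EnvAlg K L)} (f : N ⟶ N') : L ⊗[K] N →ₗ[K] L ⊗[K] N' :=
  (f.hom.restrictScalars K).lTensor L

lemma balancing_le_comap {N N' : ModuleCat.{u} (EnvAlg K L)} (f : N ⟶ N') :
    balancing K L N ≤ (balancing K L N').comap (lTensorHom K L f) := by
  refine Submodule.span_le.2 ?_
  rintro _ ⟨a, b, m, v, rfl⟩
  refine Submodule.subset_span ⟨a, b, m, f.hom v, ?_⟩
  simp [lTensorHom]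

/-- The functor `L ⊗_{L ⊗ Lᵒᵖ} -` from left `L ⊗ Lᵒᵖ`-modules to vector spaces. -/
def envTensor : ModuleCat.{u} (EnvAlg K L) ⥤ ModuleCat.{u} K where
  obj N := ModuleCat.of K ((L ⊗[K] N) ⧸ balancing K L N)
  map {N N'} f := ModuleCat.ofHom
    ((balancing K L N).mapQ (balancing K L N') (lTensorHom K L f) (balancing_le_comap K L f))
  map_id N := by
    ext x
    simp [lTensorHom]
  map_comp f g := by
    ext x
    simp [lTensorHom]

instance : (envTensor K L).Additive where
  map_add {N N' f g} := by
    refine ModuleCat.hom_ext (Submodule.linearMap_qext _ (LinearMap.ext fun y => ?_))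
    change (balancing K L N').mkQ (lTensorHom K L (f + g) y) =
      (balancing K L N').mkQ (lTensorHom K L f y) + (balancing K L N').mkQ (lTensorHom K L g y)
    rw [← map_add]
    simp [lTensorHom, LinearMap.restrictScalars_add, LinearMap.lTensor_add]

/-- Hochschild homology `HH_i(L) = Tor_i^{L ⊗ Lᵒᵖ}(L, L)`. -/
def HHhom (i : ℕ) : ModuleCat.{u} K :=
  ((envTensor K L).leftDerived i).obj (envSelf K L)

end Hochschild

end

/-! Write Λ for the algebra, with vertices numbered from 0. After the arrows a_i are rescaled by
signs, the relation at a vertex says that its two closed paths of length two agree; at the last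
vertex there is only one such path, and it vanishes. So between two vertices i and j there is at
most one nonzero path of each length d. The lengths that occur are those of the parity of i + j from
|i - j| to 2n - 2 - i - j and those of the other parity from i + j + 1 to 2n - 1 - |i - j|; this is
`Valid`. Rewriting with the relations shows that these paths span (`LGenerators.path_mul_arr`), and
a regular representation built on formal symbols shows that they are independent. From then on the
algebra is known only through `PathBasis`: nonzero paths multiply by adding lengths.

The reflection d ↦ 2n - 1 - d exchanges the two families of lengths. Hence the sum of the
coefficients of the closed paths of length 2n - 1 is a symmetrizing trace. It identifies Hom(N, Λ)
with the dual of Λ ⊗ N over the enveloping algebra, naturally in N, so that homology and cohomology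
have the same dimensions.

For a sign s there is a complex of projective bimodules P₀ ← P₁ ← P₂ ← P₀, where P₀ = P₂ is the sum
of the Λe_i ⊗ e_iΛ and P₁ has one summand for each arrow. The maps are a ⊗ e - s e ⊗ a, the
derivative of the relations, and a signed Casimir element made of dual bases. An arrow commutes with
this Casimir element up to the factor -s, so the complex continues with -s in place of s; starting
from s = 1 this is a resolution of Λ of period 6. Exactness is a dimension count: the compositions
vanish, each differential has a lower bound on its rank (`finrank_le_diff₁`, `finrank_le_diff₂`,
`finrank_le_diff₃`), and the dimensions of the terms balance. The balance comes from the identity (2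
- A) C = 2 between the adjacency matrix A of the graph and the Cartan matrix C
(`LArrow.sum_mult_tgt`).

It remains to find the ranks of the three differentials on cochains with values in Λ, for both
signs. The kernel of the first is the centre, of dimension 2n, if s = 1; if s = -1, the loop forces
c = -c on the even coefficients and only the n longest closed paths survive, as 2 ≠ 0. The second is
adjoint, under the trace, to the first one for -s. The third is 0 for s = 1, and for s = -1 it is
essentially C, which is invertible as 2 ≠ 0. -/

noncomputable section

/-! ### Dimensions of derived functors -/

section Homology

open Limits

variable {K : Type u} [Field K]

/-- The dimension of the homology of a short complex of finite dimensional vector spaces. -/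
lemma finrank_homology_add (S : ShortComplex (ModuleCat.{u} K)) [Module.Finite K S.X₂] :
    Module.finrank K S.homology + Module.finrank K (LinearMap.range S.f.hom) +
      Module.finrank K (LinearMap.range S.g.hom) = Module.finrank K S.X₂ := by
  have h1 : Module.finrank K S.homology =
      Module.finrank K (LinearMap.ker S.g.hom ⧸ LinearMap.range S.moduleCatToCycles) :=
    S.moduleCatHomologyIso.toLinearEquiv.finrank_eq
  have h2 := Submodule.finrank_quotient_add_finrank (LinearMap.range S.moduleCatToCycles)
  have h3 := S.g.hom.finrank_range_add_finrank_ker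
  have h4 : Module.finrank K (LinearMap.range S.moduleCatToCycles) =
      Module.finrank K (LinearMap.range S.f.hom) := by
    have : LinearMap.range S.f.hom =
        (LinearMap.range S.moduleCatToCycles).map (LinearMap.ker S.g.hom).subtype := by
      rw [← LinearMap.range_comp]
      rfl
    rw [this, Submodule.finrank_map_subtype_eq]
  omega

variable {R : Type u} [Ring R] {M : ModuleCat.{u} R}

/-- A sequence of modules with its differentials and augmentation, exact everywhere. -/
structure ExactResolution (M : ModuleCat.{u} R) where
  X : ℕ → ModuleCat.{u} R
  d : ∀ n, X (n + 1) ⟶ X n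
  π : X 0 ⟶ M
  projective : ∀ n, Projective (X n)
  exact : ∀ n, LinearMap.range (d (n + 1)).hom = LinearMap.ker (d n).hom
  exact_zero : LinearMap.range (d 0).hom = LinearMap.ker π.hom
  surjective : Function.Surjective π.hom

namespace ExactResolution

variable (P : ExactResolution M)

lemma d_comp_d (n : ℕ) : P.d (n + 1) ≫ P.d n = 0 := by
  ext x
  exact (P.exact n).le ⟨x, rfl⟩

lemma d_comp_π : P.d 0 ≫ P.π = 0 := by
  ext x
  exact P.exact_zero.le ⟨x, rfl⟩

/-- The underlying chain complex. -/
def complex : ChainComplex (ModuleCat.{u} R) ℕ := ChainComplex.of P.X P.d P.d_comp_d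

lemma complex_d (n : ℕ) : P.complex.d (n + 1) n = P.d n := ChainComplex.of_d _ _ _

/-- The augmentation as a morphism of complexes. -/
def augmentation : P.complex ⟶ (ChainComplex.single₀ _).obj M :=
  (P.complex.toSingle₀Equiv M).symm ⟨P.π, by rw [P.complex_d 0]; exact P.d_comp_π⟩

lemma quasiIso_augmentation : QuasiIso P.augmentation where
  quasiIsoAt m := by
    cases m with
    | zero =>
      rw [ChainComplex.quasiIsoAt₀_iff, ShortComplex.quasiIso_iff_of_zeros' _ rfl rfl rfl]
      constructor
      · rw [ShortComplex.moduleCat_exact_iff_range_eq_ker]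
        change LinearMap.range (P.complex.d 1 0).hom = LinearMap.ker (P.augmentation.f 0).hom
        have h : P.augmentation.f 0 = P.π := by simp [augmentation]; rfl
        rw [P.complex_d 0, h]
        exact P.exact_zero
      · rw [ModuleCat.epi_iff_surjective]
        change Function.Surjective (P.augmentation.f 0).hom
        have h : P.augmentation.f 0 = P.π := by simp [augmentation]; rfl
        rw [h]
        exact P.surjective
    | succ m =>
      rw [quasiIsoAt_iff_exactAt' (hL := ChainComplex.exactAt_succ_single_obj ..),
        HomologicalComplex.exactAt_iff' _ (m + 2) (m + 1) m (by simp) (by simp),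
        ShortComplex.moduleCat_exact_iff_range_eq_ker]
      change LinearMap.range (P.complex.d (m + 2) (m + 1)).hom =
        LinearMap.ker (P.complex.d (m + 1) m).hom
      rw [P.complex_d, P.complex_d]
      exact P.exact m

/-- The projective resolution given by an exact sequence. -/
def toProjectiveResolution : ProjectiveResolution M where
  complex := P.complex
  projective := P.projective
  π := P.augmentation
  quasiIso := P.quasiIso_augmentation

end ExactResolution

end Homology

/-! ### Hochschild dimensions from ranks of differentials. -/

section HochschildDim

open scoped ModuleCat

variable (K : Type u) [Field K] (L : Type u) [Ring L] [Algebra K L]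

/-- Precomposition with a morphism, on morphisms to the bimodule `L`. -/
def precompSelf {N N' : ModuleCat.{u} (EnvAlg K L)} (f : N ⟶ N') :
    (N' ⟶ envSelf K L) →ₗ[K] (N ⟶ envSelf K L) :=
  Linear.leftComp K (envSelf K L) f

variable {K L} (P : ExactResolution (envSelf K L))

/-- In degree 0 nothing enters the cochain complex Hom(P, L), so a single rank has to be subtracted.
This formula and the three after it are written additively to avoid subtraction of natural numbers.
-/
lemma finrank_HHcoh_zero [Module.Finite K (P.X 0 ⟶ envSelf K L)] :
    Module.finrank K (HHcoh K L 0) + Module.finrank K (LinearMap.range (precompSelf K L (P.d 0))) =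
      Module.finrank K (P.X 0 ⟶ envSelf K L) := by
  have e : HHcoh K L 0 ≅ _ := P.toProjectiveResolution.isoExt (R := K) 0 (envSelf K L)
  have he := e.toLinearEquiv.finrank_eq
  let C := P.complex.linearYonedaObj K (envSelf K L)
  have h0 := (C.homologyIsoSc' 0 0 1 (by simp) (by simp)).toLinearEquiv.finrank_eq
  have : Module.Finite K (C.sc' 0 0 1).X₂ := ‹_›
  have h := finrank_homology_add (C.sc' 0 0 1)
  -- The predecessor of 0 is by convention 0 itself, and the map from degree 0 to degree 0 is not a
  -- differential of the complex, hence zero.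
  have hf : (C.sc' 0 0 1).f = 0 := C.shape _ _ (by simp)
  have hg : (C.sc' 0 0 1).g.hom = precompSelf K L (P.d 0) := by
    change (C.d 0 1).hom = _
    rw [ChainComplex.linearYonedaObj_d, P.complex_d 0]
    rfl
  rw [hf, hg, ← h0] at h
  have h' : Module.finrank K (LinearMap.range (ModuleCat.Hom.hom
      (0 : (C.sc' 0 0 1).X₁ ⟶ (C.sc' 0 0 1).X₂))) = 0 := by
    rw [ModuleCat.hom_zero, LinearMap.range_zero, finrank_bot]
  rw [h', add_zero] at h
  rw [he]
  exact h

lemma finrank_HHcoh_succ (i : ℕ) [Module.Finite K (P.X (i + 1) ⟶ envSelf K L)] :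
    Module.finrank K (HHcoh K L (i + 1)) +
      Module.finrank K (LinearMap.range (precompSelf K L (P.d i))) +
      Module.finrank K (LinearMap.range (precompSelf K L (P.d (i + 1)))) =
      Module.finrank K (P.X (i + 1) ⟶ envSelf K L) := by
  have e : HHcoh K L (i + 1) ≅ _ :=
    P.toProjectiveResolution.isoExt (R := K) (i + 1) (envSelf K L)
  have he := e.toLinearEquiv.finrank_eq
  let C := P.complex.linearYonedaObj K (envSelf K L)
  have h0 := (C.homologyIsoSc' i (i + 1) (i + 2) (by simp) (by simp)).toLinearEquiv.finrank_eq
  have : Module.Finite K (C.sc' i (i + 1) (i + 2)).X₂ := ‹_›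
  have h := finrank_homology_add (C.sc' i (i + 1) (i + 2))
  have hf : (C.sc' i (i + 1) (i + 2)).f.hom = precompSelf K L (P.d i) := by
    change (C.d i (i + 1)).hom = _
    rw [ChainComplex.linearYonedaObj_d, P.complex_d i]
    rfl
  have hg : (C.sc' i (i + 1) (i + 2)).g.hom = precompSelf K L (P.d (i + 1)) := by
    change (C.d (i + 1) (i + 2)).hom = _
    rw [ChainComplex.linearYonedaObj_d, P.complex_d (i + 1)]
    rfl
  rw [hf, hg, ← h0] at h
  rw [he]
  exact h

lemma finrank_HHhom_zero [Module.Finite K ((envTensor K L).obj (P.X 0))] :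
    Module.finrank K (HHhom K L 0) +
      Module.finrank K (LinearMap.range ((envTensor K L).map (P.d 0)).hom) =
      Module.finrank K ((envTensor K L).obj (P.X 0)) := by
  have e : HHhom K L 0 ≅ _ := P.toProjectiveResolution.isoLeftDerivedObj (envTensor K L) 0
  have he := e.toLinearEquiv.finrank_eq
  let C := ((envTensor K L).mapHomologicalComplex (ComplexShape.down ℕ)).obj P.complex
  have h0 := (C.homologyIsoSc' 1 0 0 (by simp) (by simp)).toLinearEquiv.finrank_eq
  have : Module.Finite K (C.sc' 1 0 0).X₂ := ‹_›
  have h := finrank_homology_add (C.sc' 1 0 0)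
  -- Dually, the successor of 0 in a chain complex is 0 itself, with zero map.
  have hg : (C.sc' 1 0 0).g = 0 := C.shape _ _ (by simp)
  have hf : (C.sc' 1 0 0).f.hom = ((envTensor K L).map (P.d 0)).hom := by
    change ((envTensor K L).map (P.complex.d 1 0)).hom = _
    rw [P.complex_d 0]
    rfl
  rw [hf, hg, ← h0] at h
  have h' : Module.finrank K (LinearMap.range (ModuleCat.Hom.hom
      (0 : (C.sc' 1 0 0).X₂ ⟶ (C.sc' 1 0 0).X₃))) = 0 := by
    rw [ModuleCat.hom_zero, LinearMap.range_zero, finrank_bot]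
  rw [h', add_zero] at h
  rw [he]
  exact h

lemma finrank_HHhom_succ (i : ℕ) [Module.Finite K ((envTensor K L).obj (P.X (i + 1)))] :
    Module.finrank K (HHhom K L (i + 1)) +
      Module.finrank K (LinearMap.range ((envTensor K L).map (P.d (i + 1))).hom) +
      Module.finrank K (LinearMap.range ((envTensor K L).map (P.d i)).hom) =
      Module.finrank K ((envTensor K L).obj (P.X (i + 1))) := by
  have e : HHhom K L (i + 1) ≅ _ :=
    P.toProjectiveResolution.isoLeftDerivedObj (envTensor K L) (i + 1)
  have he := e.toLinearEquiv.finrank_eq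
  let C := ((envTensor K L).mapHomologicalComplex (ComplexShape.down ℕ)).obj P.complex
  have h0 := (C.homologyIsoSc' (i + 2) (i + 1) i (by simp) (by simp)).toLinearEquiv.finrank_eq
  have : Module.Finite K (C.sc' (i + 2) (i + 1) i).X₂ := ‹_›
  have h := finrank_homology_add (C.sc' (i + 2) (i + 1) i)
  have hf : (C.sc' (i + 2) (i + 1) i).f.hom = ((envTensor K L).map (P.d (i + 1))).hom := by
    change ((envTensor K L).map (P.complex.d (i + 2) (i + 1))).hom = _
    rw [P.complex_d (i + 1)]
    rfl
  have hg : (C.sc' (i + 2) (i + 1) i).g.hom = ((envTensor K L).map (P.d i)).hom := by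
    change ((envTensor K L).map (P.complex.d (i + 1) i)).hom = _
    rw [P.complex_d i]
    rfl
  rw [hf, hg, ← h0] at h
  rw [he]
  exact h

open TensorProduct.Algebra in
lemma envAlg_tmul_smul (a b x : L) :
    let _ : Module (EnvAlg K L) L := TensorProduct.Algebra.module
    (a ⊗ₜ[K] MulOpposite.op b : EnvAlg K L) • x = a * x * b := by
  let _ : Module (EnvAlg K L) L := TensorProduct.Algebra.module
  change (a ⊗ₜ[K] MulOpposite.op b : EnvAlg K L) • x = a * x * b
  rw [TensorProduct.Algebra.smul_def]
  simp [mul_assoc]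

/-- The bimodule `L` is `L` as a vector space. -/
def envSelfEquiv : envSelf K L ≃ₗ[K] L :=
  { (AddEquiv.refl L : envSelf K L ≃+ L) with
    map_smul' := fun c x => by
      refine (envAlg_tmul_smul (algebraMap K L c) 1 x).trans ?_
      rw [mul_one, Algebra.smul_def]
      rfl }

lemma envSelfEquiv_smul (a b : L) (x : envSelf K L) :
    envSelfEquiv ((a ⊗ₜ[K] MulOpposite.op b : EnvAlg K L) • x) = a * envSelfEquiv x * b :=
  envAlg_tmul_smul a b x

/-- A symmetrizing form: a trace whose bilinear form is nondegenerate. -/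
structure SymmForm (K : Type u) [Field K] (L : Type u) [Ring L] [Algebra K L] where
  τ : L →ₗ[K] K
  symm : ∀ x y, τ (x * y) = τ (y * x)
  nondegenerate : ∀ x, (∀ y, τ (y * x) = 0) → x = 0

/-! ### Duality between homology and cohomology of a symmetric algebra. -/

namespace SymmForm

variable (F : SymmForm K L)

/-- The bilinear form `(x, m) ↦ τ (m x)`. -/
def form : L →ₗ[K] Module.Dual K L := (LinearMap.mul K L).flip.compr₂ F.τ

lemma form_apply (x m : L) : F.form x m = F.τ (m * x) := rfl

lemma form_bijective [Module.Finite K L] : Function.Bijective F.form := by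
  have hi : Function.Injective F.form := by
    rw [injective_iff_map_eq_zero]
    intro x hx
    exact F.nondegenerate x fun y => LinearMap.congr_fun hx y
  exact ⟨hi, (LinearMap.injective_iff_surjective_of_finrank_eq_finrank
    Subspace.dual_finrank_eq.symm).1 hi⟩

/-- The functional on `L ⊗ N` given by a morphism `f : N → L`. -/
def toDualAux (N : ModuleCat.{u} (EnvAlg K L)) (f : N ⟶ envSelf K L) : L ⊗[K] N →ₗ[K] K :=
  TensorProduct.lift
    (F.form.comp (envSelfEquiv.toLinearMap.comp (f.hom.restrictScalars K))).flip

lemma toDualAux_tmul (N : ModuleCat.{u} (EnvAlg K L)) (f : N ⟶ envSelf K L) (m : L) (v : N) :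
    F.toDualAux N f (m ⊗ₜ v) = F.τ (m * envSelfEquiv (f.hom v)) := rfl

lemma balancing_le_ker_toDualAux (N : ModuleCat.{u} (EnvAlg K L)) (f : N ⟶ envSelf K L) :
    balancing K L N ≤ LinearMap.ker (F.toDualAux N f) := by
  refine Submodule.span_le.2 ?_
  rintro _ ⟨a, b, m, v, rfl⟩
  simp only [SetLike.mem_coe, LinearMap.mem_ker, map_sub, toDualAux_tmul, map_smul,
    envSelfEquiv_smul, sub_eq_zero]
  rw [mul_assoc, mul_assoc, F.symm, mul_assoc, mul_assoc]

/-- Morphisms `N → L` are functionals on `L ⊗_{L ⊗ Lᵒᵖ} N`. -/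
def toDual (N : ModuleCat.{u} (EnvAlg K L)) :
    (N ⟶ envSelf K L) →ₗ[K] Module.Dual K ((envTensor K L).obj N) where
  toFun f := (balancing K L N).liftQ (F.toDualAux N f) (F.balancing_le_ker_toDualAux N f)
  map_add' f g := by
    refine Submodule.linearMap_qext _ (TensorProduct.ext' fun m v => ?_)
    change F.toDualAux N (f + g) (m ⊗ₜ v) = F.toDualAux N f (m ⊗ₜ v) + F.toDualAux N g (m ⊗ₜ v)
    simp [toDualAux_tmul, mul_add]
  map_smul' c f := by
    refine Submodule.linearMap_qext _ (TensorProduct.ext' fun m v => ?_)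
    change F.toDualAux N (c • f) (m ⊗ₜ v) = c * F.toDualAux N f (m ⊗ₜ v)
    simp [toDualAux_tmul]

lemma toDual_mk (N : ModuleCat.{u} (EnvAlg K L)) (f : N ⟶ envSelf K L) (m : L) (v : N) :
    F.toDual N f ((balancing K L N).mkQ (m ⊗ₜ v)) = F.τ (m * envSelfEquiv (f.hom v)) := rfl

lemma toDual_injective (N : ModuleCat.{u} (EnvAlg K L)) : Function.Injective (F.toDual N) := by
  rw [injective_iff_map_eq_zero]
  intro f hf
  ext v
  refine envSelfEquiv.injective (F.nondegenerate _ fun m => ?_)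
  rw [← F.toDual_mk N f m v, hf]
  rfl

/-- For fixed v the functional m ↦ φ(m ⊗ v) is represented, through the form, by a unique element g
v of L. That φ kills the balancing relations, together with the symmetry of the trace, makes g a
bimodule map. -/
lemma toDual_surjective [Module.Finite K L] (N : ModuleCat.{u} (EnvAlg K L)) :
    Function.Surjective (F.toDual N) := by
  intro φ
  let e := LinearEquiv.ofBijective F.form F.form_bijective
  let ψ : N →ₗ[K] Module.Dual K L :=
    (TensorProduct.curry (φ.comp (balancing K L N).mkQ)).flip
  have hψ (v : N) (m : L) : ψ v m = φ ((balancing K L N).mkQ (m ⊗ₜ v)) := rfl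
  let g : N →ₗ[K] L := e.symm.toLinearMap.comp ψ
  have hg (v : N) (m : L) : F.τ (m * g v) = ψ v m := by
    rw [← F.form_apply]
    exact LinearMap.congr_fun (e.apply_symm_apply (ψ v)) m
  have huniq (x y : L) (h : ∀ m, F.τ (m * x) = F.τ (m * y)) : x = y :=
    F.form_bijective.1 (LinearMap.ext h)
  have hlin (r : EnvAlg K L) (v : N) :
      envSelfEquiv.symm (g (r • v)) = r • (envSelfEquiv.symm (g v) : envSelf K L) := by
    induction r using TensorProduct.induction_on with
    | zero =>
      have h0 (w : N) : (0 : EnvAlg K L) • w = 0 :=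
        zero_smul (EnvAlg K L) w
      have h1 (w : envSelf K L) : (0 : EnvAlg K L) • w = 0 :=
        zero_smul (EnvAlg K L) w
      refine Eq.trans ?_ (h1 _).symm
      rw [show _ = (0 : N) from h0 v, map_zero, map_zero]
    | add r s hr hs => simp only [add_smul, map_add, hr, hs]
    | tmul a b =>
      obtain ⟨b, rfl⟩ := MulOpposite.op_surjective b
      rw [LinearEquiv.symm_apply_eq, envSelfEquiv_smul, LinearEquiv.apply_symm_apply]
      refine huniq _ _ fun m => ?_
      have h1 : (balancing K L N).mkQ ((b * m * a) ⊗ₜ[K] v) = (balancing K L N).mkQ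
          (m ⊗ₜ[K] ((a ⊗ₜ[K] MulOpposite.op b : EnvAlg K L) • v)) := by
        rw [← sub_eq_zero, ← map_sub]
        exact (Submodule.Quotient.mk_eq_zero _).2 (Submodule.subset_span ⟨a, b, m, v, rfl⟩)
      rw [hg, hψ, ← h1, ← hψ, ← hg, mul_assoc b, mul_assoc b, F.symm, mul_assoc, mul_assoc,
        mul_assoc]
  let f : N →ₗ[EnvAlg K L] envSelf K L :=
    { toFun := fun v => envSelfEquiv.symm (g v)
      map_add' := by simp
      map_smul' := hlin }
  refine ⟨@ModuleCat.ofHom (EnvAlg K L) _ N (envSelf K L) _ _ _ _ f, ?_⟩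
  refine Submodule.linearMap_qext _ (TensorProduct.ext' fun m v => ?_)
  exact hg v m

/-- The isomorphism `Hom(N, L) ≃ Dual (L ⊗_{L ⊗ Lᵒᵖ} N)` for a symmetric algebra `L`. -/
def dualEquiv [Module.Finite K L] (N : ModuleCat.{u} (EnvAlg K L)) :
    (N ⟶ envSelf K L) ≃ₗ[K] Module.Dual K ((envTensor K L).obj N) :=
  LinearEquiv.ofBijective (F.toDual N) ⟨F.toDual_injective N, F.toDual_surjective N⟩

lemma finrank_envTensor_obj (F : SymmForm K L) [Module.Finite K L]
    (N : ModuleCat.{u} (EnvAlg K L)) :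
    Module.finrank K ((envTensor K L).obj N) = Module.finrank K (N ⟶ envSelf K L) := by
  rw [(F.dualEquiv N).finrank_eq, Subspace.dual_finrank_eq]

lemma dualEquiv_comp_precompSelf [Module.Finite K L] {N N' : ModuleCat.{u} (EnvAlg K L)}
    (f : N ⟶ N') :
    (F.dualEquiv N).toLinearMap ∘ₗ precompSelf K L f =
      ((envTensor K L).map f).hom.dualMap ∘ₗ (F.dualEquiv N').toLinearMap := by
  refine LinearMap.ext fun g => Submodule.linearMap_qext _ (TensorProduct.ext' fun m v => ?_)
  rfl

/-- By naturality of the duality, precomposition with f is the transpose of the map which f induces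
on tensor products, and transposes have equal rank. Thus homology needs no calculation of its own.
-/
lemma finrank_range_envTensor_map [Module.Finite K L] {N N' : ModuleCat.{u} (EnvAlg K L)}
    (F : SymmForm K L) (f : N ⟶ N') :
    Module.finrank K (LinearMap.range ((envTensor K L).map f).hom) =
      Module.finrank K (LinearMap.range (precompSelf K L f)) := by
  have h1 : LinearMap.range ((envTensor K L).map f).hom.dualMap =
      (LinearMap.range (precompSelf K L f)).map (F.dualEquiv N).toLinearMap := by
    rw [← LinearMap.range_comp, F.dualEquiv_comp_precompSelf f,
      LinearMap.range_comp_of_range_eq_top]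
    exact (F.dualEquiv N').range
  rw [← LinearMap.finrank_range_dualMap_eq_finrank_range, h1]
  exact LinearEquiv.finrank_map_eq _ _

end SymmForm

end HochschildDim

/-! ### A monomial basis of the preprojective algebra of type `𝕃_n` -/

/-- `Valid n i j d`: there is a nonzero path of length `d` from `i` to `j` in `P(𝕃_n)`. -/
def Valid (n i j d : ℕ) : Prop :=
  (d % 2 = (i + j) % 2 ∧ i ≤ j + d ∧ j ≤ i + d ∧ i + j + d + 2 ≤ 2 * n) ∨
    (d % 2 ≠ (i + j) % 2 ∧ i + j + 1 ≤ d ∧ d + i + 1 ≤ 2 * n + j ∧ d + j + 1 ≤ 2 * n + i)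

instance (n i j d : ℕ) : Decidable (Valid n i j d) := by unfold Valid; infer_instance

/-! ### Signs of arrows and arithmetic of the admissible lengths. -/

namespace LArrow

variable {n : ℕ} [NeZero n]

/-- The source of an arrow. -/
abbrev src (a : LArrow n) : Fin n := (LQuiver n).src a

/-- The target of an arrow. -/
abbrev tgt (a : LArrow n) : Fin n := (LQuiver n).tgt a

/-- The opposite arrow. -/
abbrev bar (a : LArrow n) : LArrow n := (LQuiver n).bar a

@[simp] lemma src_loop : ((loop : LArrow n).src : ℕ) = 0 := rfl
@[simp] lemma src_up (i : Fin (n - 1)) : ((up i : LArrow n).src : ℕ) = i := rfl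
@[simp] lemma src_down (i : Fin (n - 1)) : ((down i : LArrow n).src : ℕ) = i + 1 := rfl
@[simp] lemma tgt_loop : ((loop : LArrow n).tgt : ℕ) = 0 := rfl
@[simp] lemma tgt_up (i : Fin (n - 1)) : ((up i : LArrow n).tgt : ℕ) = i + 1 := rfl
@[simp] lemma tgt_down (i : Fin (n - 1)) : ((down i : LArrow n).tgt : ℕ) = i := rfl
@[simp] lemma bar_loop : (loop : LArrow n).bar = loop := rfl
@[simp] lemma bar_up (i : Fin (n - 1)) : (up i : LArrow n).bar = down i := rfl
@[simp] lemma bar_down (i : Fin (n - 1)) : (down i : LArrow n).bar = up i := rfl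
lemma src_bar (a : LArrow n) : a.bar.src = a.tgt := (LQuiver n).src_bar a
lemma bar_bar (a : LArrow n) : a.bar.bar = a := (LQuiver n).bar_bar a
lemma tgt_bar (a : LArrow n) : a.bar.tgt = a.src := by rw [← src_bar, bar_bar]

/-- The sign of an arrow in the relation at its source. -/
def sgn : LArrow n → ℤˣ
  | loop => 1
  | up _ => -1
  | down _ => 1

/-- The sign by which the arrow `a_i` is rescaled. -/
def scale : LArrow n → ℤˣ
  | loop => 1
  | up i => (-1) ^ ((i : ℕ) + 1)
  | down _ => 1

/-- The factor (-1) ^ src is common to all terms of the relation at a vertex. Up to this factor,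
rescaling turns the sum of the a ā into the sum with signs `sgn`, that is, into a difference of two
closed paths. -/
lemma scale_mul_scale_bar (a : LArrow n) : a.scale * a.bar.scale = (-1) ^ (a.src : ℕ) * a.sgn := by
  rcases a with _ | i | i <;> simp [scale, sgn, pow_succ]

/-- The arrow that leaves a vertex in the direction of the loop. -/
def left (j : Fin n) : LArrow n :=
  if h : (j : ℕ) = 0 then loop else down ⟨j - 1, by omega⟩

lemma src_left (j : Fin n) : (left j).src = j := by
  ext; unfold left; split <;> simp <;> omega

lemma tgt_left (j : Fin n) : ((left j).tgt : ℕ) = j - 1 := by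
  unfold left; split <;> simp <;> omega

lemma sgn_left (j : Fin n) : (left j).sgn = 1 := by
  unfold left; split <;> rfl

lemma filter_src (j : Fin n) : (Finset.univ.filter fun a : LArrow n => a.src = j) =
    if h : (j : ℕ) < n - 1 then {left j, up ⟨j, h⟩} else {left j} := by
  ext a
  split
  all_goals
    unfold left
    split <;> rcases a with _ | i | i <;>
      simp [Fin.ext_iff] <;> omega

lemma eq_left_or_up (a : LArrow n) :
    a = left a.src ∨ ∃ h : (a.src : ℕ) < n - 1, a = up ⟨a.src, h⟩ := by
  have : a ∈ (Finset.univ.filter fun b : LArrow n => b.src = a.src) := by simp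
  rw [filter_src] at this
  split at this
  · rename_i h
    rcases Finset.mem_insert.1 this with h' | h'
    · exact Or.inl h'
    · exact Or.inr ⟨h, Finset.mem_singleton.1 h'⟩
  · exact Or.inl (Finset.mem_singleton.1 this)

lemma eq_bar_left_or_down (a : LArrow n) :
    a = (left a.tgt).bar ∨ ∃ h : (a.tgt : ℕ) < n - 1, a = down ⟨a.tgt, h⟩ := by
  rcases eq_left_or_up a.bar with h | ⟨h, h'⟩
  · left
    rw [← src_bar, ← h, bar_bar]
  · right
    have h1 : a = down ⟨a.bar.src, h⟩ := by rw [← bar_up, ← h', bar_bar]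
    simp only [src_bar] at h h1
    exact ⟨h, h1⟩

lemma left_ne_up (j : Fin n) (i : Fin (n - 1)) : left j ≠ up i := by
  unfold left; split <;> simp

lemma sum_src {M : Type*} [AddCommMonoid M] (j : Fin n) (f : LArrow n → M) :
    (∑ a : LArrow n with a.src = j, f a) =
      f (left j) + if h : (j : ℕ) < n - 1 then f (up ⟨j, h⟩) else 0 := by
  rw [filter_src]
  split
  · rw [Finset.sum_pair (left_ne_up _ _)]
  · simp

lemma valid_tgt_of_valid {i : Fin n} {d : ℕ} (a : LArrow n) (h : Valid n i a.src d)
    (h' : Valid n i a.src (d + 2)) : Valid n i a.tgt (d + 1) := by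
  have := i.2
  have hn := NeZero.pos n
  rcases a with _ | k | k <;> simp [Valid] at * <;> omega

/-- At the last vertex the relation consists of one term, so a path ending there must not survive a
detour of length two. This ensures it: for each parity only one length is admissible from i to the
last vertex. -/
lemma lt_of_valid {i j : Fin n} {d : ℕ} (h : Valid n i j d) (h' : Valid n i j (d + 2)) :
    (j : ℕ) < n - 1 := by
  have := i.2
  have := j.2
  simp [Valid] at * ; omega

/-- Every admissible path of positive length has an admissible initial segment, so induction on
length reaches all basis paths. -/
lemma exists_tgt_of_valid {i j : Fin n} {d : ℕ} (h : Valid n i j (d + 1)) :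
    ∃ a : LArrow n, a.tgt = j ∧ Valid n i a.src d := by
  have hi := i.2
  have hj := j.2
  by_cases h1 : Valid n i (j + 1) d
  · have hj' : (j : ℕ) < n - 1 := by simp [Valid] at *; omega
    exact ⟨down ⟨j, hj'⟩, by ext; simp, by simpa using h1⟩
  · refine ⟨(left j).bar, by rw [tgt_bar, src_left], ?_⟩
    rw [src_bar, tgt_left]
    simp [Valid] at *; omega

/-- If j can be entered in both ways, then j was already reached two steps before the end. The two
routes therefore differ by an application of the relation at j. -/
lemma exists_succ_of_valid_of_valid {i j : Fin n} {d : ℕ} (h : Valid n i (left j).tgt d)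
    (h' : Valid n i (j + 1) d) : ∃ e, d = e + 1 ∧ Valid n i j e := by
  have hi := i.2
  have hj := j.2
  rw [tgt_left] at h
  have : d ≠ 0 := by rintro rfl; simp [Valid] at *; omega
  obtain ⟨e, rfl⟩ := Nat.exists_eq_succ_of_ne_zero this
  refine ⟨e, rfl, ?_⟩
  simp [Valid] at *; omega

set_option maxRecDepth 2000 in
lemma exists_succ_of_not_valid {i : Fin n} {d : ℕ} (a : LArrow n) (h : Valid n i a.src d)
    (h' : ¬ Valid n i a.tgt (d + 1)) : ∃ e, d = e + 1 ∧ Valid n i a.tgt e := by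
  have hi := i.2
  have hn := NeZero.pos n
  have : d ≠ 0 := by
    rintro rfl
    rcases a with _ | k | k <;> simp [Valid] at * <;> omega
  obtain ⟨e, rfl⟩ := Nat.exists_eq_succ_of_ne_zero this
  refine ⟨e, rfl, ?_⟩
  rcases a with _ | k | k <;> simp [Valid] at * <;> omega

/-- Used in the contrapositive: if j cannot be reached with length d + 1, then one of the two ways
of entering j passes through a path that is already zero. -/
lemma valid_of_valid_of_valid {i j : Fin n} {d : ℕ} (h : Valid n i (left j).tgt d)
    (h' : Valid n i (j + 1) d) : Valid n i j (d + 1) := by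
  have hi := i.2
  have hj := j.2
  rw [tgt_left] at h
  simp [Valid] at *; omega

lemma valid_self_zero_iff {i j : Fin n} : Valid n i j 0 ↔ i = j := by
  have hi := i.2
  unfold Valid
  rw [Fin.ext_iff]
  omega

lemma valid_symm {i j d : ℕ} (h : Valid n i j d) : Valid n j i d := by
  unfold Valid at *; omega

/-- The reflection d ↦ 2n - 1 - d changes the parity and exchanges the two families of admissible
lengths. It pairs each path with its dual for the trace form. -/
lemma valid_dual {i j d : ℕ} (hd : d < 2 * n) : Valid n j i (2 * n - 1 - d) ↔ Valid n i j d := by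
  unfold Valid; omega

lemma lt_two_mul_of_valid {i j d : ℕ} (h : Valid n i j d) : d < 2 * n := by
  have := NeZero.pos n
  unfold Valid at h; omega

lemma valid_arrow (a : LArrow n) : Valid n a.src a.tgt 1 := by
  have := NeZero.pos n
  rcases a with _ | k | k <;> simp [Valid] <;> omega

lemma valid_src_of_valid_tgt {i j d e : ℕ} (a : LArrow n) (h : Valid n i j d)
    (h' : Valid n j a.src e) (h'' : Valid n i a.tgt (d + e + 1)) : Valid n i a.src (d + e) := by
  rcases a with _ | k | k
  all_goals
    simp only [src_loop, src_up, src_down, tgt_loop, tgt_up, tgt_down] at *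
    unfold Valid at *
    omega

end LArrow

/-- Elements of an algebra which satisfy the relations of the preprojective algebra `P(𝕃_n)`. -/
structure LGenerators (K : Type u) [Field K] (n : ℕ) [NeZero n] (L : Type u) [Ring L]
    [Algebra K L] where
  vtx : Fin n → L
  gen : LArrow n → L
  vtx_mul_self : ∀ i, vtx i * vtx i = vtx i
  vtx_mul_of_ne : ∀ i j, i ≠ j → vtx i * vtx j = 0
  sum_vtx : ∑ i, vtx i = 1
  src_mul_gen : ∀ a, vtx a.src * gen a = gen a
  gen_mul_tgt : ∀ a, gen a * vtx a.tgt = gen a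
  sum_gen_mul_gen_bar : ∀ j, ∑ a : LArrow n with a.src = j, gen a * gen a.bar = 0

/-! ### Normal forms of paths from the relations. -/

namespace LGenerators

open LArrow

variable {K : Type u} [Field K] {n : ℕ} [NeZero n] {L : Type u} [Ring L] [Algebra K L]
  (G : LGenerators K n L)

/-- The rescaled arrows. -/
def arr (a : LArrow n) : L := ((a.scale : ℤ) : K) • G.gen a

lemma src_mul_arr (a : LArrow n) : G.vtx a.src * G.arr a = G.arr a := by
  rw [arr, mul_smul_comm, src_mul_gen]

lemma arr_mul_tgt (a : LArrow n) : G.arr a * G.vtx a.tgt = G.arr a := by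
  rw [arr, smul_mul_assoc, gen_mul_tgt]

lemma sum_sgn_arr_mul_arr_bar (j : Fin n) :
    ∑ a : LArrow n with a.src = j, ((a.sgn : ℤ) : K) • (G.arr a * G.arr a.bar) = 0 := by
  have h' := congrArg ((((-1 : ℤ) ^ (j : ℕ) : ℤ) : K) • ·) (G.sum_gen_mul_gen_bar j)
  simp only [smul_zero, Finset.smul_sum] at h'
  rw [← h']
  refine Finset.sum_congr rfl fun a ha => ?_
  have ha' : a.src = j := (Finset.mem_filter.1 ha).2
  have hs : ((a.sgn : ℤ) : K) * (((a.scale : ℤ) : K) * ((a.bar.scale : ℤ) : K)) =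
      (((-1 : ℤ) ^ (j : ℕ) : ℤ) : K) := by
    rw [← Int.cast_mul, ← Units.val_mul, scale_mul_scale_bar, ha', ← Int.cast_mul,
      ← Units.val_mul, mul_left_comm, ← sq, Int.units_sq]
    simp
  rw [arr, arr, smul_mul_smul_comm, smul_smul, hs]

lemma arr_left_mul (j : Fin n) : G.arr (left j) * G.arr (left j).bar =
    if h : (j : ℕ) < n - 1 then G.arr (up ⟨j, h⟩) * G.arr (down ⟨j, h⟩) else 0 := by
  have h := G.sum_sgn_arr_mul_arr_bar j
  rw [sum_src, sgn_left] at h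
  split_ifs at h ⊢ with hj
  · have : ((((up ⟨j, hj⟩ : LArrow n).sgn : ℤ)) : K) = -1 := by simp [sgn]
    rw [this, neg_smul, one_smul, ← sub_eq_add_neg] at h
    simpa [sub_eq_zero] using h
  · simpa using h

/-! The basis elements. -/

open Classical in
/-- The path of length `d` from `i` to `j`, unique up to the relations, or `0`. -/
def path (i : Fin n) : ℕ → Fin n → L
  | 0, j => if i = j then G.vtx i else 0
  | d + 1, j =>
    if h : ∃ a : LArrow n, a.tgt = j ∧ Valid n i a.src d ∧ Valid n i j (d + 1) then
      path i d h.choose.src * G.arr h.choose else 0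

lemma path_of_not_valid {i j : Fin n} {d : ℕ} (h : ¬ Valid n i j d) : G.path i d j = 0 := by
  cases d with
  | zero => rw [path, if_neg (by rwa [← valid_self_zero_iff])]
  | succ d => rw [path, dif_neg (by tauto)]

lemma path_zero (i : Fin n) : G.path i 0 i = G.vtx i := by rw [path, if_pos rfl]

lemma path_zero_of_ne {i j : Fin n} (h : i ≠ j) : G.path i 0 j = 0 := by rw [path, if_neg h]

/-- This makes `path` independent of the arrows chosen in its definition. It is the confluence of
the rewriting a ā = b b̄, by induction on the length; it also covers the case where the target
length is inadmissible and the product must vanish. -/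
lemma path_mul_arr {i : Fin n} {d : ℕ} (a : LArrow n) (h : Valid n i a.src d) :
    G.path i d a.src * G.arr a = G.path i (d + 1) a.tgt := by
  induction d using Nat.strong_induction_on generalizing a with
  | _ d ih =>
  -- Both paths factor through the path to j of length d - 1, followed by one of the two closed
  -- paths of length two at j; these agree by the relation.
  have key (j : Fin n) (hj : (j : ℕ) < n - 1) (hv : Valid n i (j + 1) d)
      (hl : Valid n i (left j).tgt d) : G.path i d (left j).bar.src * G.arr (left j).bar =
        G.path i d (down ⟨j, hj⟩ : LArrow n).src * G.arr (down ⟨j, hj⟩) := by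
    obtain ⟨e, rfl, he⟩ := exists_succ_of_valid_of_valid hl hv
    have h1 := ih e (Nat.lt_succ_self e) (left j) (by rwa [src_left])
    have h2 := ih e (Nat.lt_succ_self e) (up ⟨j, hj⟩) he
    rw [src_bar, ← h1]
    refine Eq.trans ?_ (congrArg (· * _) h2)
    rw [mul_assoc, mul_assoc, arr_left_mul, dif_pos hj, src_left]
    rfl
  by_cases hv : Valid n i a.tgt (d + 1)
  · have hex : ∃ b : LArrow n, b.tgt = a.tgt ∧ Valid n i b.src d ∧ Valid n i a.tgt (d + 1) :=
      ⟨a, rfl, h, hv⟩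
    rw [path, dif_pos hex]
    obtain ⟨hb, hb', -⟩ := hex.choose_spec
    generalize hex.choose = b at hb hb'
    have ha := eq_bar_left_or_down a
    have hb₀ := eq_bar_left_or_down b
    rw [hb] at hb₀
    generalize a.tgt = j at ha hb₀
    rcases ha with rfl | ⟨hj, rfl⟩ <;> rcases hb₀ with rfl | ⟨hj', rfl⟩
    · rfl
    · exact key j hj' (by simpa using hb') (by rwa [src_bar] at h)
    · exact (key j hj (by simpa using h) (by rwa [src_bar] at hb')).symm
    · rfl
  -- The product ends with ā a. Replacing it by the other closed path of length two at the target
  -- leads through an inadmissible path, hence through 0; at the last vertex ā a is itself 0.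
  · rw [G.path_of_not_valid hv]
    obtain ⟨e, rfl, he⟩ := exists_succ_of_not_valid a h hv
    have h1 := ih e (Nat.lt_succ_self e) a.bar (by rwa [src_bar])
    rw [tgt_bar, src_bar] at h1
    rw [← h1, mul_assoc]
    have ha := eq_bar_left_or_down a
    generalize a.tgt = j at ha hv he
    rcases ha with rfl | ⟨hj, rfl⟩
    · rw [bar_bar, arr_left_mul]
      split_ifs with hj
      · have h2 := ih e (Nat.lt_succ_self e) (up ⟨j, hj⟩) he
        rw [← mul_assoc]
        refine (congrArg (· * _) h2).trans ?_
        rw [G.path_of_not_valid, zero_mul]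
        intro h3
        exact hv (valid_of_valid_of_valid (by rwa [src_bar] at h) (by simpa using h3))
      · rw [mul_zero]
    · have h2 := ih e (Nat.lt_succ_self e) (left j) (by rwa [src_left])
      have h3 := G.arr_left_mul j
      rw [dif_pos hj] at h3
      rw [bar_down, ← h3, ← mul_assoc]
      rw [src_left] at h2
      rw [h2, path_of_not_valid, zero_mul]
      intro h3
      exact hv (valid_of_valid_of_valid h3 (by simpa using h))

lemma vtx_mul_path (i : Fin n) (d : ℕ) (j : Fin n) : G.vtx i * G.path i d j = G.path i d j := by
  induction d generalizing j with
  | zero =>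
    by_cases h : i = j
    · subst h; rw [path_zero, vtx_mul_self]
    · rw [path_zero_of_ne _ h, mul_zero]
  | succ d ih =>
    rw [path]
    split
    · rw [← mul_assoc, ih]
    · rw [mul_zero]

lemma path_mul_vtx (i : Fin n) (d : ℕ) (j : Fin n) : G.path i d j * G.vtx j = G.path i d j := by
  cases d with
  | zero =>
    by_cases h : i = j
    · subst h; rw [path_zero, vtx_mul_self]
    · rw [path_zero_of_ne _ h, zero_mul]
  | succ d =>
    rw [path]
    split
    · rename_i h
      have := G.arr_mul_tgt h.choose
      rw [h.choose_spec.1] at this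
      rw [mul_assoc, this]
    · rw [zero_mul]

lemma path_mul_path_of_ne {i j k l : Fin n} (d e : ℕ) (h : j ≠ k) :
    G.path i d j * G.path k e l = 0 := by
  rw [← path_mul_vtx, ← vtx_mul_path G k, mul_assoc, ← mul_assoc (G.vtx j),
    G.vtx_mul_of_ne _ _ h, zero_mul, mul_zero]

lemma path_mul_arr_of_ne {i j : Fin n} (d : ℕ) (a : LArrow n) (h : j ≠ a.src) :
    G.path i d j * G.arr a = 0 := by
  rw [← path_mul_vtx, ← src_mul_arr, mul_assoc, ← mul_assoc (G.vtx j),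
    G.vtx_mul_of_ne _ _ h, zero_mul, mul_zero]

lemma path_mul_path {i j k : Fin n} {d e : ℕ} (h : Valid n i j d) (h' : Valid n j k e) :
    G.path i d j * G.path j e k = G.path i (d + e) k := by
  induction e generalizing k with
  | zero =>
    obtain rfl := valid_self_zero_iff.1 h'
    rw [path_zero, path_mul_vtx, add_zero]
  | succ e ih =>
    obtain ⟨a, rfl, ha⟩ := exists_tgt_of_valid h'
    rw [← G.path_mul_arr a ha, ← mul_assoc, ih ha, ← add_assoc]
    by_cases hv : Valid n i a.src (d + e)
    · exact G.path_mul_arr a hv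
    -- If the product vanishes before its last arrow, the full length must be inadmissible as well,
    -- so both sides are 0.
    · rw [G.path_of_not_valid hv, zero_mul, G.path_of_not_valid]
      exact fun h1 => hv (valid_src_of_valid_tgt a h ha h1)

lemma sum_path_zero : ∑ i, G.path i 0 i = 1 := by
  simp_rw [path_zero, sum_vtx]

lemma gen_eq (a : LArrow n) : G.gen a = ((a.scale : ℤ) : K) • G.arr a := by
  rw [arr, smul_smul, ← Int.cast_mul, ← Units.val_mul, ← sq, Int.units_sq]
  simp

/-- The span of the paths. -/
def pathSpan : Submodule K L :=
  Submodule.span K {x | ∃ (i : Fin n) (d : ℕ) (j : Fin n), Valid n i j d ∧ x = G.path i d j}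

lemma path_mem_pathSpan (i : Fin n) (d : ℕ) (j : Fin n) : G.path i d j ∈ G.pathSpan := by
  by_cases h : Valid n i j d
  · exact Submodule.subset_span ⟨i, d, j, h, rfl⟩
  · rw [G.path_of_not_valid h]; exact zero_mem _

lemma mul_mem_pathSpan {x : L}
    (hx : ∀ (i : Fin n) (d : ℕ) (j : Fin n), Valid n i j d →
      G.path i d j * x ∈ G.pathSpan) {w : L} (hw : w ∈ G.pathSpan) :
    w * x ∈ G.pathSpan := by
  refine Submodule.span_induction ?_ ?_ ?_ ?_ hw
  · rintro _ ⟨i, d, j, h, rfl⟩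
    exact hx i d j h
  · rw [zero_mul]; exact zero_mem _
  · intro a b _ _ ha hb
    rw [add_mul]; exact add_mem ha hb
  · intro c a _ ha
    rw [smul_mul_assoc]; exact Submodule.smul_mem _ _ ha

/-- The elements which preserve the span of the paths. -/
def stabilizer : Subalgebra K L where
  carrier := {x | ∀ w ∈ G.pathSpan, w * x ∈ G.pathSpan}
  mul_mem' {a b} ha hb w hw := by rw [← mul_assoc]; exact hb _ (ha _ hw)
  add_mem' {a b} ha hb w hw := by rw [mul_add]; exact add_mem (ha _ hw) (hb _ hw)
  algebraMap_mem' c w hw := by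
    rw [← Algebra.commutes, ← Algebra.smul_def]; exact Submodule.smul_mem _ _ hw

/-- The generators generate the algebra. -/
def Generate : Prop :=
  ∀ S : Subalgebra K L, (∀ i, G.vtx i ∈ S) → (∀ a, G.gen a ∈ S) → S = ⊤

/-- The elements that preserve the span under right multiplication form a subalgebra containing the
generators, hence all of L. Since 1 lies in the span, so does 1 · x. -/
lemma pathSpan_eq_top (hG : G.Generate) : G.pathSpan = ⊤ := by
  have h : G.stabilizer = ⊤ := by
    refine hG _ (fun k w hw => G.mul_mem_pathSpan (fun i d j h => ?_) hw)
      fun a w hw => G.mul_mem_pathSpan (fun i d j h => ?_) hw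
    · rw [← path_zero]
      by_cases hj : j = k
      · subst hj
        rw [path_zero, path_mul_vtx]
        exact G.path_mem_pathSpan _ _ _
      · rw [path_mul_path_of_ne _ _ _ hj]
        exact zero_mem _
    · rw [gen_eq, mul_smul_comm]
      refine Submodule.smul_mem _ _ ?_
      by_cases hj : j = a.src
      · subst hj
        rw [G.path_mul_arr a h]
        exact G.path_mem_pathSpan _ _ _
      · rw [path_mul_arr_of_ne _ _ _ hj]
        exact zero_mem _
  have h1 : (1 : L) ∈ G.pathSpan := by
    rw [← G.sum_path_zero]
    exact sum_mem fun i _ => G.path_mem_pathSpan _ _ _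
  refine eq_top_iff.2 fun x _ => ?_
  have hx : x ∈ G.stabilizer := by rw [h]; trivial
  simpa using hx 1 h1

variable {L' : Type u} [Ring L'] [Algebra K L'] (G' : LGenerators K n L')

/-- The arrows chosen in the recursion depend only on the combinatorics of `Valid` and not on the
algebra, so the same choices are made on both sides. -/
lemma map_path (φ : L →ₐ[K] L') (hv : ∀ i, φ (G.vtx i) = G'.vtx i)
    (hg : ∀ a, φ (G.gen a) = G'.gen a) (i : Fin n) (d : ℕ) (j : Fin n) :
    φ (G.path i d j) = G'.path i d j := by
  induction d generalizing j with
  | zero =>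
    by_cases h : i = j
    · subst h; rw [path_zero, path_zero, hv]
    · rw [path_zero_of_ne _ h, path_zero_of_ne _ h, map_zero]
  | succ d ih =>
    rw [path, path]
    split
    · rw [map_mul, ih, arr, arr, map_smul, hg]
    · rw [map_zero]

end LGenerators

/-- The index set of the basis: all `(i, d, j)` such that there is a nonzero path of length `d`
from `i` to `j`. -/
abbrev PathIdx (n : ℕ) : Type := {x : Fin n × Fin (2 * n) × Fin n // Valid n x.1 x.2.2 x.2.1}

/-- A basis of an algebra which consists of paths in the quiver `𝕃_n`. -/
structure PathBasis (K : Type u) [Field K] (n : ℕ) [NeZero n] (L : Type u) [Ring L]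
    [Algebra K L] where
  path : Fin n → ℕ → Fin n → L
  path_of_not_valid : ∀ {i : Fin n} {d : ℕ} {j : Fin n}, ¬ Valid n i j d → path i d j = 0
  path_mul_path : ∀ {i j k : Fin n} {d e : ℕ}, Valid n i j d → Valid n j k e →
    path i d j * path j e k = path i (d + e) k
  path_mul_path_of_ne : ∀ {i j k l : Fin n} (d e : ℕ), j ≠ k → path i d j * path k e l = 0
  sum_path_zero : ∑ i, path i 0 i = 1
  basis : Module.Basis (PathIdx n) K L
  basis_apply : ∀ x, basis x = path x.1.1 x.1.2.1 x.1.2.2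

/-! ### The regular representation -/

namespace PathIdx

open LArrow

variable (K : Type u) [Field K] {n : ℕ} [NeZero n]

/-- The basis vectors of the regular representation. -/
def vec (i : Fin n) (d : ℕ) (j : Fin n) : PathIdx n →₀ K :=
  if h : Valid n i j d then
    Finsupp.single ⟨(i, ⟨d, lt_two_mul_of_valid h⟩, j), h⟩ 1 else 0

lemma vec_idx (x : PathIdx n) : vec K x.1.1 x.1.2.1 x.1.2.2 = Finsupp.single x 1 := by
  rw [vec, dif_pos x.2]

lemma vec_of_not_valid {i : Fin n} {d : ℕ} {j : Fin n} (h : ¬ Valid n i j d) :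
    vec K i d j = 0 := dif_neg h

/-- Right multiplication by a vertex. -/
def mulVtx (k : Fin n) : Module.End K (PathIdx n →₀ K) :=
  Finsupp.linearCombination K fun x => if x.1.2.2 = k then Finsupp.single x 1 else 0

/-- Right multiplication by an arrow. -/
def mulArr (a : LArrow n) : Module.End K (PathIdx n →₀ K) :=
  Finsupp.linearCombination K fun x =>
    if x.1.2.2 = a.src then vec K x.1.1 (x.1.2.1 + 1) a.tgt else 0

lemma mulVtx_vec (k i : Fin n) (d : ℕ) (j : Fin n) :
    mulVtx K k (vec K i d j) = if j = k then vec K i d j else 0 := by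
  unfold vec
  split
  · simp [mulVtx]
  · simp

lemma mulArr_vec {a : LArrow n} {i : Fin n} {d : ℕ} {j : Fin n} (h : Valid n i j d) :
    mulArr K a (vec K i d j) = if j = a.src then vec K i (d + 1) a.tgt else 0 := by
  rw [vec, dif_pos h]
  simp [mulArr]

lemma end_ext {f g : Module.End K (PathIdx n →₀ K)}
    (h : ∀ (i : Fin n) (d : ℕ) (j : Fin n), Valid n i j d → f (vec K i d j) = g (vec K i d j)) :
    f = g := by
  refine Finsupp.lhom_ext' fun x => LinearMap.ext_ring ?_
  simpa [vec_idx] using h _ _ _ x.2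

lemma mulArr_mulArr_bar {a : LArrow n} {i : Fin n} {d : ℕ} (h : Valid n i a.src d) :
    mulArr K a.bar (mulArr K a (vec K i d a.src)) = vec K i (d + 2) a.src := by
  rw [mulArr_vec K h, if_pos rfl]
  by_cases h1 : Valid n i a.tgt (d + 1)
  · rw [mulArr_vec K h1, src_bar, if_pos rfl, tgt_bar]
  · rw [vec_of_not_valid K h1, map_zero, vec_of_not_valid]
    exact fun h2 => h1 (valid_tgt_of_valid a h h2)

/-- The regular representation. -/
def generators : LGenerators K n (Module.End K (PathIdx n →₀ K))ᵐᵒᵖ where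
  -- Right multiplications compose in reverse order, hence the opposite algebra. The sign `scale`
  -- undoes the rescaling, so that the original relations hold.
  vtx k := MulOpposite.op (mulVtx K k)
  gen a := MulOpposite.op (((a.scale : ℤ) : K) • mulArr K a)
  vtx_mul_self k := by
    rw [← MulOpposite.op_mul]
    refine congrArg _ (end_ext K fun i d j h => ?_)
    rw [Module.End.mul_apply, mulVtx_vec]
    split <;> simp [mulVtx_vec, *]
  vtx_mul_of_ne k l hkl := by
    rw [← MulOpposite.op_mul, ← MulOpposite.op_zero]
    refine congrArg _ (end_ext K fun i d j h => ?_)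
    rw [Module.End.mul_apply, mulVtx_vec]
    split
    · rename_i h; subst h; rw [mulVtx_vec, if_neg hkl]; rfl
    · simp
  sum_vtx := by
    rw [← Finset.op_sum, ← MulOpposite.op_one]
    refine congrArg _ (end_ext K fun i d j h => ?_)
    simp [mulVtx_vec]
  src_mul_gen a := by
    rw [← MulOpposite.op_mul]
    refine congrArg _ (end_ext K fun i d j h => ?_)
    rw [Module.End.mul_apply, mulVtx_vec]
    split
    · rfl
    · simp [mulArr_vec K h, *]
  gen_mul_tgt a := by
    rw [← MulOpposite.op_mul]
    refine congrArg _ (end_ext K fun i d j h => ?_)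
    rw [Module.End.mul_apply, LinearMap.smul_apply, mulArr_vec K h]
    split <;> simp [mulVtx_vec]
  sum_gen_mul_gen_bar k := by
    simp_rw [← MulOpposite.op_mul]
    rw [← Finset.op_sum, ← MulOpposite.op_zero]
    refine congrArg _ (end_ext K fun i d j h => ?_)
    rw [LinearMap.sum_apply, LinearMap.zero_apply]
    have h1 (a : LArrow n) (ha : a.src = k) :
        ((((a.bar.scale : ℤ) : K) • mulArr K a.bar) * (((a.scale : ℤ) : K) • mulArr K a))
          (vec K i d j) = if j = k then
            ((((-1) ^ (k : ℕ) : ℤˣ) : ℤ) : K) • ((a.sgn : ℤ) : K) • vec K i (d + 2) j else 0 := by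
      subst ha
      rw [smul_mul_smul_comm, LinearMap.smul_apply, mul_comm, ← Int.cast_mul, ← Units.val_mul,
        scale_mul_scale_bar, Module.End.mul_apply]
      split
      · rename_i hj
        subst hj
        rw [mulArr_mulArr_bar K h, smul_smul]
        push_cast
        rfl
      · rw [mulArr_vec K h, if_neg ‹_›, map_zero, smul_zero]
    rw [Finset.sum_congr rfl fun a ha => h1 a (Finset.mem_filter.1 ha).2]
    by_cases hj : j = k
    · subst hj
      simp_rw [if_pos, ← Finset.smul_sum]
      rw [sum_src, sgn_left]
      -- All terms are the same vector up to `sgn`. If that vector is nonzero, j is not the last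
      -- vertex, so both arrows are present and their signs cancel.
      by_cases hv : Valid n i j (d + 2)
      · rw [dif_pos (lt_of_valid h hv)]
        simp [sgn]
      · rw [vec_of_not_valid K hv]
        simp
    · simp [hj]

end PathIdx

/-! ### The basis of `P(𝕃_n)` -/

namespace PL

variable (K : Type u) [Field K] (n : ℕ) [NeZero n]

/-- The projection from the free algebra. -/
def proj : FreeAlgebra K (Fin n ⊕ LArrow n) →ₐ[K] PL K n :=
  (RingQuot.mkAlgHom K ((LQuiver n).PreprojRel K)).comp
    (RingQuot.mkAlgHom K ((LQuiver n).PathRel K))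

lemma proj_surjective : Function.Surjective (proj K n) :=
  (RingQuot.mkAlgHom_surjective K _).comp (RingQuot.mkAlgHom_surjective K _)

lemma proj_eq_of_pathRel {x y : FreeAlgebra K (Fin n ⊕ LArrow n)}
    (h : (LQuiver n).PathRel K x y) : proj K n x = proj K n y :=
  congrArg (RingQuot.mkAlgHom K ((LQuiver n).PreprojRel K)) (RingQuot.mkAlgHom_rel K h)

/-- The generators of `P(𝕃_n)`. -/
def generators : LGenerators K n (PL K n) where
  vtx i := proj K n (SymQuiver.freeVertex K i)
  gen a := proj K n (SymQuiver.freeArrow K a)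
  vtx_mul_self i := by
    rw [← map_mul]; exact proj_eq_of_pathRel K n (.idem i)
  vtx_mul_of_ne i j h := by
    rw [← map_mul, proj_eq_of_pathRel K n (.orth i j h), map_zero]
  sum_vtx := by
    rw [← map_sum, proj_eq_of_pathRel K n .sum_one, map_one]
  src_mul_gen a := by
    rw [← map_mul]; exact proj_eq_of_pathRel K n (.src_mul a)
  gen_mul_tgt a := by
    rw [← map_mul]; exact proj_eq_of_pathRel K n (.mul_tgt a)
  sum_gen_mul_gen_bar j := by
    have h := RingQuot.mkAlgHom_rel K (SymQuiver.PreprojRel.vertex (Q := LQuiver n) (K := K) j)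
    rw [map_sum, map_zero] at h
    rw [← h]
    refine Finset.sum_congr ?_ fun a _ => ?_
    · ext a
      simp only [Finset.mem_filter]
    · rw [map_mul]
      rfl

lemma generate_generators : (generators K n).Generate := by
  intro S hv hg
  have h : S.comap (proj K n) = ⊤ := by
    rw [eq_top_iff, ← FreeAlgebra.adjoin_range_ι, Algebra.adjoin_le_iff]
    rintro _ ⟨i | a, rfl⟩
    · exact hv i
    · exact hg a
  refine eq_top_iff.2 fun x _ => ?_
  obtain ⟨y, rfl⟩ := proj_surjective K n x
  have : y ∈ S.comap (proj K n) := by rw [h]; trivial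
  exact this

variable {K n} {L : Type u} [Ring L] [Algebra K L] (G : LGenerators K n L)

/-- The homomorphism to an algebra with generators that satisfy the relations. -/
def liftFree : FreeAlgebra K (Fin n ⊕ LArrow n) →ₐ[K] L :=
  FreeAlgebra.lift K (Sum.elim G.vtx G.gen)

lemma liftFree_vertex (i : Fin n) : liftFree G (SymQuiver.freeVertex K i) = G.vtx i := by
  simp [liftFree, SymQuiver.freeVertex]

lemma liftFree_arrow (a : LArrow n) : liftFree G (SymQuiver.freeArrow K a) = G.gen a := by
  simp [liftFree, SymQuiver.freeArrow]

lemma liftFree_rel {x y : FreeAlgebra K (Fin n ⊕ LArrow n)} (h : (LQuiver n).PathRel K x y) :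
    liftFree G x = liftFree G y := by
  cases h with
  | idem i => rw [map_mul, liftFree_vertex, G.vtx_mul_self]
  | orth i j h => rw [map_mul, liftFree_vertex, liftFree_vertex, G.vtx_mul_of_ne _ _ h, map_zero]
  | sum_one => rw [map_sum, map_one]; simp_rw [liftFree_vertex]; exact G.sum_vtx
  | src_mul a => rw [map_mul, liftFree_vertex, liftFree_arrow]; exact G.src_mul_gen a
  | mul_tgt a => rw [map_mul, liftFree_vertex, liftFree_arrow]; exact G.gen_mul_tgt a

/-- The homomorphism on the path algebra. -/
def liftPath : (LQuiver n).PathAlgebra K →ₐ[K] L :=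
  RingQuot.liftAlgHom K ⟨liftFree G, fun _ _ h => liftFree_rel G h⟩

lemma liftPath_arrow (a : LArrow n) : liftPath G ((LQuiver n).arrow K a) = G.gen a := by
  rw [liftPath, SymQuiver.arrow, RingQuot.liftAlgHom_mkAlgHom_apply, liftFree_arrow]

lemma liftPath_rel {x y : (LQuiver n).PathAlgebra K} (h : (LQuiver n).PreprojRel K x y) :
    liftPath G x = liftPath G y := by
  cases h with
  | vertex j =>
    rw [map_sum, map_zero, ← G.sum_gen_mul_gen_bar j]
    refine Finset.sum_congr ?_ fun a _ => ?_
    · ext a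
      simp only [Finset.mem_filter]
    · rw [map_mul, liftPath_arrow, liftPath_arrow]

/-- The homomorphism on the preprojective algebra. -/
def lift : PL K n →ₐ[K] L := RingQuot.liftAlgHom K ⟨liftPath G, fun _ _ h => liftPath_rel G h⟩

lemma lift_proj (x : FreeAlgebra K (Fin n ⊕ LArrow n)) : lift G (proj K n x) = liftFree G x := by
  rw [lift, proj, AlgHom.comp_apply, RingQuot.liftAlgHom_mkAlgHom_apply, liftPath,
    RingQuot.liftAlgHom_mkAlgHom_apply]

lemma lift_vtx (i : Fin n) : lift G ((generators K n).vtx i) = G.vtx i :=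
  (lift_proj G _).trans (liftFree_vertex G i)

lemma lift_gen (a : LArrow n) : lift G ((generators K n).gen a) = G.gen a :=
  (lift_proj G _).trans (liftFree_arrow G a)

end PL

/-! ### Independence of the paths, through the regular representation. -/

namespace PathIdx

open LArrow

variable (K : Type u) [Field K] {n : ℕ} [NeZero n]

/-- The vector on which the paths act as a basis. -/
def vacuum : PathIdx n →₀ K := ∑ i, vec K i 0 i

/-- The vacuum is the formal unit, the sum of the trivial paths. A path acting on it from the right
gives back the symbol of that path. -/
lemma unop_path_vacuum (i : Fin n) (d : ℕ) (j : Fin n) :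
    MulOpposite.unop ((generators K).path i d j) (vacuum K) = vec K i d j := by
  induction d generalizing j with
  | zero =>
    by_cases h : i = j
    · subst h
      rw [LGenerators.path_zero, vacuum, map_sum]
      refine (Finset.sum_congr rfl fun k _ => mulVtx_vec K i k 0 k).trans ?_
      simp
    · rw [LGenerators.path_zero_of_ne _ h, vec_of_not_valid]
      · rfl
      · rwa [valid_self_zero_iff]
  | succ d ih =>
    by_cases hv : Valid n i j (d + 1)
    · obtain ⟨a, rfl, ha⟩ := exists_tgt_of_valid hv
      rw [← LGenerators.path_mul_arr _ a ha, MulOpposite.unop_mul, Module.End.mul_apply, ih]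
      have : MulOpposite.unop ((generators K).arr a) = mulArr K a := by
        rw [LGenerators.arr, generators]
        dsimp only
        rw [← MulOpposite.op_smul, MulOpposite.unop_op, smul_smul, ← Int.cast_mul,
          ← Units.val_mul, ← sq, Int.units_sq]
        simp
      rw [this, mulArr_vec K ha, if_pos rfl]
    · rw [LGenerators.path_of_not_valid _ hv, vec_of_not_valid K hv]
      rfl

end PathIdx

namespace PL

variable (K : Type u) [Field K] (n : ℕ) [NeZero n]

/-- The paths, as a family indexed by `PathIdx n`. -/
def pathFamily (x : PathIdx n) : PL K n := (generators K n).path x.1.1 x.1.2.1 x.1.2.2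

/-- Acting on the vacuum sends the paths to the standard basis vectors, so no linear relation among
them can hold. -/
lemma linearIndependent_pathFamily : LinearIndependent K (pathFamily K n) := by
  let ev : (Module.End K (PathIdx n →₀ K))ᵐᵒᵖ →ₗ[K] PathIdx n →₀ K :=
    (LinearMap.applyₗ (PathIdx.vacuum K)).comp (MulOpposite.opLinearEquiv K).symm.toLinearMap
  refine LinearIndependent.of_comp (ev.comp (lift (PathIdx.generators K)).toLinearMap) ?_
  have h (x : PathIdx n) : ev (lift (PathIdx.generators K) (pathFamily K n x)) =
      Finsupp.single x 1 := by
    have h1 := (generators K n).map_path (PathIdx.generators K) (lift (PathIdx.generators K))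
      (lift_vtx _) (lift_gen _) x.1.1 x.1.2.1 x.1.2.2
    refine (congrArg ev h1).trans ?_
    exact (PathIdx.unop_path_vacuum K _ _ _).trans (PathIdx.vec_idx K x)
  have h' : (ev.comp (lift (PathIdx.generators K)).toLinearMap) ∘ pathFamily K n =
      (Finsupp.basisSingleOne : Module.Basis (PathIdx n) K (PathIdx n →₀ K)) := by
    ext1 x
    simpa using h x
  rw [h']
  exact Module.Basis.linearIndependent _

lemma span_pathFamily : ⊤ ≤ Submodule.span K (Set.range (pathFamily K n)) := by
  rw [← (generators K n).pathSpan_eq_top (generate_generators K n), LGenerators.pathSpan,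
    Submodule.span_le]
  rintro _ ⟨i, d, j, h, rfl⟩
  exact Submodule.subset_span ⟨⟨(i, ⟨d, LArrow.lt_two_mul_of_valid h⟩, j), h⟩, rfl⟩

/-- The basis of `P(𝕃_n)` which consists of paths. -/
def pathBasis : PathBasis K n (PL K n) where
  path := (generators K n).path
  path_of_not_valid := (generators K n).path_of_not_valid
  path_mul_path := (generators K n).path_mul_path
  path_mul_path_of_ne := (generators K n).path_mul_path_of_ne
  sum_path_zero := (generators K n).sum_path_zero
  basis := Module.Basis.mk (linearIndependent_pathFamily K n) (span_pathFamily K n)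
  basis_apply x := Module.Basis.mk_apply _ _ x

end PL

/-! ### Coefficients with respect to the basis of paths -/

namespace PathBasis

open LArrow

variable {K : Type u} [Field K] {n : ℕ} [NeZero n] {L : Type u} [Ring L] [Algebra K L]
  (B : PathBasis K n L)

lemma module_finite (B : PathBasis K n L) : Module.Finite K L := Module.Finite.of_basis B.basis

lemma hom_ext {M : Type*} [AddCommGroup M] [Module K M] {f g : L →ₗ[K] M}
    (h : ∀ (i : Fin n) (d : ℕ) (j : Fin n), Valid n i j d → f (B.path i d j) = g (B.path i d j)) :
    f = g := by
  refine B.basis.ext fun x => ?_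
  rw [B.basis_apply]
  exact h _ _ _ x.2

/-- The coefficient of the path of length `d` from `i` to `j`. -/
def coef (i : Fin n) (d : ℕ) (j : Fin n) : L →ₗ[K] K :=
  if h : Valid n i j d then B.basis.coord ⟨(i, ⟨d, lt_two_mul_of_valid h⟩, j), h⟩ else 0

lemma coef_of_not_valid {i : Fin n} {d : ℕ} {j : Fin n} (h : ¬ Valid n i j d) :
    B.coef i d j = 0 := dif_neg h

lemma coef_path {i' : Fin n} {d' : ℕ} {j' : Fin n} (h : Valid n i' j' d') (i : Fin n) (d : ℕ)
    (j : Fin n) :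
    B.coef i d j (B.path i' d' j') = if i' = i ∧ d' = d ∧ j' = j then 1 else 0 := by
  have h1 : B.path i' d' j' = B.basis ⟨(i', ⟨d', lt_two_mul_of_valid h⟩, j'), h⟩ :=
    (B.basis_apply ⟨(i', ⟨d', lt_two_mul_of_valid h⟩, j'), h⟩).symm
  by_cases hv : Valid n i j d
  · rw [h1, coef, dif_pos hv, Module.Basis.coord_apply, Module.Basis.repr_self,
      Finsupp.single_apply]
    simp
  · rw [coef_of_not_valid _ hv, LinearMap.zero_apply, if_neg]
    rintro ⟨rfl, rfl, rfl⟩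
    exact hv h

lemma coef_path_self {i : Fin n} {d : ℕ} {j : Fin n} (h : Valid n i j d) :
    B.coef i d j (B.path i d j) = 1 := by
  rw [B.coef_path h, if_pos ⟨rfl, rfl, rfl⟩]

lemma coef_eq_repr (x : PathIdx n) (v : L) :
    B.coef x.1.1 x.1.2.1 x.1.2.2 v = B.basis.repr v x := by
  rw [coef, dif_pos x.2]
  rfl

lemma ext_coef {x y : L} (h : ∀ (i : Fin n) (d : ℕ) (j : Fin n), Valid n i j d →
    B.coef i d j x = B.coef i d j y) : x = y := by
  refine B.basis.ext_elem fun z => ?_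
  rw [← coef_eq_repr, ← coef_eq_repr]
  exact h _ _ _ z.2

/-- The idempotent of a vertex. -/
def vtx (i : Fin n) : L := B.path i 0 i

/-- The arrows. -/
def arr (a : LArrow n) : L := B.path a.src 1 a.tgt

lemma valid_self (i : Fin n) : Valid n i i 0 := valid_self_zero_iff.2 rfl

lemma valid_last (i : Fin n) : Valid n i i (2 * n - 1) := by
  have := i.2; unfold Valid; omega

lemma vtx_mul_path (i : Fin n) (d : ℕ) (j : Fin n) : B.vtx i * B.path i d j = B.path i d j := by
  by_cases h : Valid n i j d
  · rw [vtx, B.path_mul_path (valid_self i) h, zero_add]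
  · rw [B.path_of_not_valid h, mul_zero]

lemma path_mul_vtx (i : Fin n) (d : ℕ) (j : Fin n) : B.path i d j * B.vtx j = B.path i d j := by
  by_cases h : Valid n i j d
  · rw [vtx, B.path_mul_path h (valid_self j), add_zero]
  · rw [B.path_of_not_valid h, zero_mul]

lemma vtx_mul_self (i : Fin n) : B.vtx i * B.vtx i = B.vtx i := B.vtx_mul_path i 0 i

lemma vtx_mul_arr (a : LArrow n) : B.vtx a.src * B.arr a = B.arr a := B.vtx_mul_path _ _ _

lemma arr_mul_vtx (a : LArrow n) : B.arr a * B.vtx a.tgt = B.arr a := B.path_mul_vtx _ _ _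

lemma path_mul_arr {i : Fin n} {d : ℕ} {a : LArrow n} (h : Valid n i a.src d) :
    B.path i d a.src * B.arr a = B.path i (d + 1) a.tgt := B.path_mul_path h (valid_arrow a)

lemma arr_mul_path {d : ℕ} {a : LArrow n} {j : Fin n} (h : Valid n a.tgt j d) :
    B.arr a * B.path a.tgt d j = B.path a.src (d + 1) j := by
  rw [arr, B.path_mul_path (valid_arrow a) h, add_comm]

lemma vtx_mul_path_of_ne {k i : Fin n} (h : k ≠ i) (d : ℕ) (j : Fin n) :
    B.vtx k * B.path i d j = 0 := B.path_mul_path_of_ne 0 d h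

lemma path_mul_vtx_of_ne {j k : Fin n} (h : j ≠ k) (i : Fin n) (d : ℕ) :
    B.path i d j * B.vtx k = 0 := B.path_mul_path_of_ne d 0 h

lemma path_mul_arr_of_ne {j : Fin n} {a : LArrow n} (h : j ≠ a.src) (i : Fin n) (d : ℕ) :
    B.path i d j * B.arr a = 0 := B.path_mul_path_of_ne d 1 h

lemma arr_mul_path_of_ne {i : Fin n} {a : LArrow n} (h : a.tgt ≠ i) (d : ℕ) (j : Fin n) :
    B.arr a * B.path i d j = 0 := B.path_mul_path_of_ne 1 d h

lemma arr_mul_arr_bar (a : LArrow n) : B.arr a * B.arr a.bar = B.path a.src 2 a.src := by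
  have h := B.path_mul_arr (i := a.src) (d := 1) (a := a.bar)
    (by rw [src_bar]; exact valid_arrow a)
  rw [src_bar, tgt_bar] at h
  exact h

lemma not_valid_two {j : Fin n} (h : ¬ (j : ℕ) < n - 1) : ¬ Valid n j j 2 := by
  have := j.2; unfold Valid; omega

lemma sum_sgn_arr_mul_arr_bar (j : Fin n) :
    ∑ a : LArrow n with a.src = j, ((a.sgn : ℤ) : K) • (B.arr a * B.arr a.bar) = 0 := by
  simp_rw [arr_mul_arr_bar]
  rw [sum_src, sgn_left, src_left]
  split_ifs with h
  · change _ + (((-1 : ℤˣ) : ℤ) : K) • B.path j 2 j = 0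
    simp
  · rw [B.path_of_not_valid (not_valid_two h), smul_zero, add_zero]

lemma coef_arr_mul_zero (i j : Fin n) (a : LArrow n) (x : L) :
    B.coef i 0 j (B.arr a * x) = 0 := by
  have : (B.coef i 0 j).comp (LinearMap.mulLeft K (B.arr a)) = 0 := by
    refine B.hom_ext fun i' d' j' h => ?_
    rw [LinearMap.comp_apply, LinearMap.mulLeft_apply, LinearMap.zero_apply]
    by_cases hj : a.tgt = i'
    · subst hj
      rw [B.arr_mul_path h]
      by_cases h1 : Valid n a.src j' (d' + 1)
      · rw [B.coef_path h1, if_neg (by omega)]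
      · rw [B.path_of_not_valid h1, map_zero]
    · rw [B.arr_mul_path_of_ne hj, map_zero]
  exact LinearMap.congr_fun this x

/-- The only path which a can turn into the given one is the path without its last arrow.
Admissibility of the longer path is needed: otherwise the left side is zero by convention while the
right side need not be. -/
lemma coef_mul_arr {i : Fin n} {d : ℕ} {a : LArrow n} (hv : Valid n i a.tgt (d + 1)) (x : L) :
    B.coef i (d + 1) a.tgt (x * B.arr a) = B.coef i d a.src x := by
  have : (B.coef i (d + 1) a.tgt).comp (LinearMap.mulRight K (B.arr a)) = B.coef i d a.src := by
    refine B.hom_ext fun i' d' j' h => ?_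
    rw [LinearMap.comp_apply, LinearMap.mulRight_apply, B.coef_path h]
    by_cases hj : j' = a.src
    · subst hj
      rw [B.path_mul_arr h]
      by_cases h1 : Valid n i' a.tgt (d' + 1)
      · rw [B.coef_path h1]
        simp
      · rw [B.path_of_not_valid h1, map_zero, if_neg]
        rintro ⟨rfl, rfl, -⟩
        exact h1 hv
    · rw [B.path_mul_arr_of_ne hj, map_zero, if_neg]
      tauto
  exact LinearMap.congr_fun this x

lemma coef_arr_mul {a : LArrow n} {d : ℕ} {j : Fin n} (hv : Valid n a.src j (d + 1)) (x : L) :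
    B.coef a.src (d + 1) j (B.arr a * x) = B.coef a.tgt d j x := by
  have : (B.coef a.src (d + 1) j).comp (LinearMap.mulLeft K (B.arr a)) = B.coef a.tgt d j := by
    refine B.hom_ext fun i' d' j' h => ?_
    rw [LinearMap.comp_apply, LinearMap.mulLeft_apply, B.coef_path h]
    by_cases hj : a.tgt = i'
    · subst hj
      rw [B.arr_mul_path h]
      by_cases h1 : Valid n a.src j' (d' + 1)
      · rw [B.coef_path h1]
        simp
      · rw [B.path_of_not_valid h1, map_zero, if_neg]
        rintro ⟨-, rfl, rfl⟩
        exact h1 hv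
    · rw [B.arr_mul_path_of_ne hj, map_zero, if_neg]
      tauto
  exact LinearMap.congr_fun this x

lemma coef_vtx_mul (i j : Fin n) (d : ℕ) (x : L) :
    B.coef i d j (B.vtx i * x) = B.coef i d j x := by
  have : (B.coef i d j).comp (LinearMap.mulLeft K (B.vtx i)) = B.coef i d j := by
    refine B.hom_ext fun i' d' j' h => ?_
    rw [LinearMap.comp_apply, LinearMap.mulLeft_apply]
    by_cases hi : i = i'
    · subst hi; rw [vtx_mul_path]
    · rw [B.vtx_mul_path_of_ne hi, map_zero, B.coef_path h, if_neg (by tauto)]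
  exact LinearMap.congr_fun this x

/-- The trace form: the sum of the coefficients of the longest paths. -/
def trace : L →ₗ[K] K := ∑ i, B.coef i (2 * n - 1) i

lemma trace_path {i : Fin n} {d : ℕ} {j : Fin n} :
    B.trace (B.path i d j) = if d = 2 * n - 1 ∧ i = j then 1 else 0 := by
  by_cases h : Valid n i j d
  · rw [trace, LinearMap.sum_apply]
    simp_rw [B.coef_path h]
    split_ifs with h'
    · obtain ⟨rfl, rfl⟩ := h'
      simp
    · refine Finset.sum_eq_zero fun k _ => if_neg ?_
      rintro ⟨rfl, rfl, rfl⟩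
      exact h' ⟨rfl, rfl⟩
  · rw [B.path_of_not_valid h, map_zero, if_neg]
    rintro ⟨rfl, rfl⟩
    exact h (valid_last i)

lemma trace_path_mul_path {i j k l : Fin n} {d e : ℕ} (h : Valid n i j d) (h' : Valid n k l e) :
    B.trace (B.path i d j * B.path k e l) =
      if d + e = 2 * n - 1 ∧ j = k ∧ i = l then 1 else 0 := by
  by_cases hj : j = k
  · subst hj
    rw [B.path_mul_path h h', trace_path]
    simp
  · rw [B.path_mul_path_of_ne _ _ hj, map_zero, if_neg (by tauto)]

/-- On basis paths both traces are 1 exactly when the two paths close up to a cycle of length 2n -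
1, a condition symmetric in the two. -/
lemma trace_mul_comm (x y : L) : B.trace (x * y) = B.trace (y * x) := by
  have : (LinearMap.mul K L).compr₂ B.trace = (LinearMap.mul K L).flip.compr₂ B.trace := by
    refine B.hom_ext fun i d j h => B.hom_ext fun k e l h' => ?_
    simp only [LinearMap.compr₂_apply, LinearMap.flip_apply, LinearMap.mul_apply']
    rw [B.trace_path_mul_path h h', B.trace_path_mul_path h' h]
    refine if_congr ?_ rfl rfl
    rw [add_comm]
    tauto
  exact LinearMap.congr_fun (LinearMap.congr_fun this x) y

/-- The path back from j to i of complementary length is the dual basis element. Nondegeneracy of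
the trace form is read off from this. -/
lemma trace_path_mul {i : Fin n} {d : ℕ} {j : Fin n} (h : Valid n i j d) (x : L) :
    B.trace (B.path j (2 * n - 1 - d) i * x) = B.coef i d j x := by
  have hd := lt_two_mul_of_valid h
  have : B.trace.comp (LinearMap.mulLeft K (B.path j (2 * n - 1 - d) i)) = B.coef i d j := by
    refine B.hom_ext fun i' d' j' h' => ?_
    rw [LinearMap.comp_apply, LinearMap.mulLeft_apply, B.coef_path h',
      B.trace_path_mul_path ((valid_dual hd).2 h) h']
    have hd' := lt_two_mul_of_valid h'
    refine if_congr ?_ rfl rfl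
    rw [show (2 * n - 1 - d + d' = 2 * n - 1) ↔ d' = d by omega]
    tauto
  exact LinearMap.congr_fun this x

/-- The algebra is symmetric. -/
def symmForm : SymmForm K L where
  τ := B.trace
  symm := B.trace_mul_comm
  nondegenerate x hx := B.ext_coef fun i d j h => by
    rw [← B.trace_path_mul h, hx, map_zero]

end PathBasis

/-! ### Projective modules given by idempotents, and maps given by matrices -/

section IdemRows

variable {R : Type u} [Ring R] {I J : Type} [Fintype I] [DecidableEq I] [Fintype J]
  [DecidableEq J]

/-- The direct sum of the projective left modules `R ε_i`. -/
def idemRows (ε : I → R) : Submodule R (I → R) where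
  carrier := {f | ∀ i, f i * ε i = f i}
  add_mem' {f g} hf hg i := by rw [Pi.add_apply, add_mul, hf i, hg i]
  zero_mem' i := zero_mul _
  smul_mem' r f hf i := by rw [Pi.smul_apply, smul_eq_mul, mul_assoc, hf i]

lemma projective_idemRows {ε : I → R} (hε : ∀ i, ε i * ε i = ε i) :
    Module.Projective R (idemRows ε) := by
  let s : (I → R) →ₗ[R] idemRows ε :=
    { toFun := fun f => ⟨fun i => f i * ε i, fun i => by rw [mul_assoc, hε]⟩
      map_add' := fun f g => Subtype.ext (funext fun i => add_mul _ _ _)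
      map_smul' := fun r f => Subtype.ext (funext fun i => mul_assoc _ _ _) }
  refine Module.Projective.of_split (idemRows ε).subtype s (LinearMap.ext fun f => ?_)
  exact Subtype.ext (funext fun i => f.2 i)

/-- The map between projective modules given by a matrix. -/
def rowHom {ε : I → R} {ε' : J → R} (M : Matrix I J R) (hM : ∀ i j, M i j * ε' j = M i j) :
    idemRows ε →ₗ[R] idemRows ε' where
  toFun f := ⟨Matrix.vecMul f M, fun j => by
    simp only [Matrix.vecMul, dotProduct, Finset.sum_mul, mul_assoc, hM]⟩
  map_add' f g := Subtype.ext (Matrix.add_vecMul _ _ _)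
  map_smul' r f := Subtype.ext (Matrix.smul_vecMul _ _ _)

lemma rowHom_apply {ε : I → R} {ε' : J → R} (M : Matrix I J R)
    (hM : ∀ i j, M i j * ε' j = M i j) (f : idemRows ε) (j : J) :
    (rowHom M hM f : J → R) j = ∑ i, (f : I → R) i * M i j := rfl

/-- The generators. -/
def idemGen {ε : I → R} (hε : ∀ i, ε i * ε i = ε i) (i : I) : idemRows ε :=
  ⟨Pi.single i (ε i), fun j => by
    by_cases h : j = i
    · subst h; simp [hε]
    · simp [h]⟩

lemma eq_sum_idemGen {ε : I → R} (hε : ∀ i, ε i * ε i = ε i) (f : idemRows ε) :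
    f = ∑ i, (f : I → R) i • idemGen hε i := by
  refine Subtype.ext (funext fun j => ?_)
  simp only [AddSubmonoidClass.coe_finsetSum, Finset.sum_apply, SetLike.val_smul, Pi.smul_apply,
    idemGen, smul_eq_mul]
  rw [Finset.sum_eq_single j]
  · simp [f.2 j]
  · intro i _ hi
    rw [Pi.single_eq_of_ne hi.symm, mul_zero]
  · simp

lemma rowHom_idemGen {ε : I → R} {ε' : J → R} (hε : ∀ i, ε i * ε i = ε i)
    (hε' : ∀ i, ε' i * ε' i = ε' i) (M : Matrix I J R) (hM : ∀ i j, M i j * ε' j = M i j)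
    (hM' : ∀ i j, ε i * M i j = M i j) (i : I) :
    rowHom M hM (idemGen hε i) = ∑ j, M i j • idemGen hε' j := by
  rw [eq_sum_idemGen hε' (rowHom M hM (idemGen hε i))]
  refine Finset.sum_congr rfl fun j _ => ?_
  rw [rowHom_apply, Finset.sum_eq_single i]
  · simp [idemGen, hM']
  · intro k _ hk
    simp [idemGen, hk]
  · simp

variable {K : Type u} [Field K] [Algebra K R]

/-- Exactness follows from a count of dimensions. -/
lemma range_eq_ker_of_finrank {V W X : Type u} [AddCommGroup V] [AddCommGroup W] [AddCommGroup X]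
    [Module K V] [Module K W] [Module K X] [Module.Finite K W] (f : V →ₗ[K] W) (g : W →ₗ[K] X)
    (h : ∀ x, g (f x) = 0)
    (hd : Module.finrank K W ≤
      Module.finrank K (LinearMap.range f) + Module.finrank K (LinearMap.range g)) :
    LinearMap.range f = LinearMap.ker g := by
  refine Submodule.eq_of_le_of_finrank_le ?_ ?_
  · rintro _ ⟨x, rfl⟩
    exact h x
  · have := g.finrank_range_add_finrank_ker
    omega

/-- The dimension of the range of a map which kills a part of a basis and fixes the rest. -/
lemma finrank_range_of_basis {V ι : Type*} [AddCommGroup V] [Module K V] [Fintype ι]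
    (b : Module.Basis ι K V) (π : V →ₗ[K] V) (p : ι → Prop) [DecidablePred p]
    (h : ∀ i, π (b i) = if p i then b i else 0) :
    Module.finrank K (LinearMap.range π) = Fintype.card {i // p i} := by
  have h1 : LinearMap.range π = Submodule.span K (Set.range fun i : {i // p i} => b i) := by
    rw [LinearMap.range_eq_map, ← b.span_eq, Submodule.map_span]
    refine le_antisymm (Submodule.span_le.2 ?_) (Submodule.span_le.2 ?_)
    · rintro _ ⟨_, ⟨i, rfl⟩, rfl⟩
      rw [h]
      split
      · rename_i hi
        exact Submodule.subset_span ⟨⟨i, hi⟩, rfl⟩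
      · exact zero_mem _
    · rintro _ ⟨i, rfl⟩
      refine Submodule.subset_span ⟨b i, ⟨i, rfl⟩, ?_⟩
      rw [h, if_pos i.2]
  rw [h1, finrank_span_eq_card]
  exact b.linearIndependent.comp _ Subtype.val_injective

end IdemRows

/-! ### Morphisms out of projectives given by idempotents. -/

section HomGeneral

open scoped ModuleCat

variable {K : Type u} [Field K] {R : Type u} [Ring R] [Algebra K R]
  {I J : Type} [Fintype I] [DecidableEq I] [Fintype J] [DecidableEq J] (N : ModuleCat.{u} R)

/-- Multiplication by a scalar, as a linear map over the base field. -/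
def smulHom (r : R) : N →ₗ[K] N where
  toFun x := r • x
  map_add' := smul_add r
  map_smul' c x := by
    have key (y : N) : c • y = algebraMap K R c • y := (algebraMap_smul R c y).symm
    rw [RingHom.id_apply, key, key, smul_smul, smul_smul, Algebra.commutes]

/-- The space of morphisms from `idemRows ε`, in coordinates. -/
def homCols (K : Type u) [Field K] [Algebra K R] (ε : I → R) : Submodule K (I → N) where
  carrier := {g | ∀ i, ε i • g i = g i}
  add_mem' {f g} hf hg i := by rw [Pi.add_apply, smul_add, hf i, hg i]
  zero_mem' i := smul_zero _
  smul_mem' r f hf i := by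
    have := (smulHom (K := K) N (ε i)).map_smul r (f i)
    rw [Pi.smul_apply]
    exact this.trans (congrArg _ (hf i))

/-- The evaluation of morphisms at the generators. -/
def homEval (K : Type u) [Field K] [Algebra K R] {ε : I → R} (hε : ∀ i, ε i * ε i = ε i) :
    (ModuleCat.of R (idemRows ε) ⟶ N) →ₗ[K] (I → N) where
  toFun φ i := φ.hom (idemGen hε i)
  map_add' _ _ := rfl
  map_smul' _ _ := rfl

lemma homEval_injective {ε : I → R} (hε : ∀ i, ε i * ε i = ε i) :
    Function.Injective (homEval N K hε) := by
  rw [injective_iff_map_eq_zero]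
  intro φ hφ
  ext f
  rw [eq_sum_idemGen hε f, map_sum]
  refine Finset.sum_eq_zero fun i _ => ?_
  rw [map_smul]
  exact (congrArg _ (congrFun hφ i)).trans (smul_zero _)

/-- A morphism from R ε is determined by the image of ε, which can be any element of N fixed by ε.
-/
lemma range_homEval {ε : I → R} (hε : ∀ i, ε i * ε i = ε i) :
    LinearMap.range (homEval N K hε) = homCols N K ε := by
  refine le_antisymm ?_ fun g hg => ?_
  · rintro _ ⟨φ, rfl⟩ i
    change ε i • φ.hom (idemGen hε i) = φ.hom (idemGen hε i)
    rw [← map_smul]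
    congr 1
    refine Subtype.ext (funext fun j => ?_)
    by_cases h : j = i
    · subst h; simp [idemGen, hε]
    · simp [idemGen, h]
  · let φ : idemRows ε →ₗ[R] N :=
      { toFun := fun f => ∑ i, (f : I → R) i • g i
        map_add' := fun f f' => by
          rw [← Finset.sum_add_distrib]
          exact Finset.sum_congr rfl fun i _ => add_smul _ _ _
        map_smul' := fun r f => by
          rw [RingHom.id_apply, Finset.smul_sum]
          exact Finset.sum_congr rfl fun i _ => mul_smul _ _ _ }
    refine ⟨ModuleCat.ofHom φ, funext fun i => ?_⟩
    change ∑ j, (Pi.single i (ε i) : I → R) j • g j = g i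
    rw [Finset.sum_eq_single i]
    · rw [Pi.single_eq_same]; exact hg i
    · intro j _ hj
      rw [Pi.single_eq_of_ne hj, zero_smul]
    · simp

/-- The action of a matrix on columns with entries in a module. -/
def colHom (K : Type u) [Field K] [Algebra K R] (M : Matrix I J R) : (J → N) →ₗ[K] (I → N) :=
  LinearMap.pi fun i => ∑ j, (smulHom N (M i j)).comp (LinearMap.proj j)

lemma colHom_apply (M : Matrix I J R) (g : J → N) (i : I) :
    colHom N K M g i = ∑ j, M i j • g j := by
  simp only [colHom, LinearMap.pi_apply, LinearMap.sum_apply]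
  rfl

/-- Matrices act on rows of the projectives from the right, hence on columns of values of morphisms
from the left. This reduces differentials on cochains to explicit matrices. -/
lemma homEval_comp {ε : I → R} {ε' : J → R}
    (hε : ∀ i, ε i * ε i = ε i) (hε' : ∀ i, ε' i * ε' i = ε' i) (M : Matrix I J R)
    (hM : ∀ i j, M i j * ε' j = M i j) (hM' : ∀ i j, ε i * M i j = M i j)
    (f : ModuleCat.of R (idemRows ε) ⟶ ModuleCat.of R (idemRows ε'))
    (hf : f.hom = rowHom M hM) :
    homEval N K hε ∘ₗ Linear.leftComp K N f = colHom N K M ∘ₗ homEval N K hε' := by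
  refine LinearMap.ext fun φ => funext fun i => ?_
  rw [LinearMap.comp_apply, LinearMap.comp_apply, colHom_apply]
  change φ.hom (f.hom (idemGen hε i)) = _
  rw [hf, rowHom_idemGen hε hε' M hM hM', map_sum]
  refine Finset.sum_congr rfl fun j _ => ?_
  rw [map_smul]
  rfl

lemma finrank_hom_eq {ε : I → R} (hε : ∀ i, ε i * ε i = ε i) :
    Module.finrank K (ModuleCat.of R (idemRows ε) ⟶ N) = Module.finrank K (homCols N K ε) := by
  rw [← range_homEval N hε, LinearMap.finrank_range_of_inj (homEval_injective N hε)]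

lemma finrank_range_leftComp {ε : I → R} {ε' : J → R}
    (hε : ∀ i, ε i * ε i = ε i) (hε' : ∀ i, ε' i * ε' i = ε' i) (M : Matrix I J R)
    (hM : ∀ i j, M i j * ε' j = M i j) (hM' : ∀ i j, ε i * M i j = M i j)
    (f : ModuleCat.of R (idemRows ε) ⟶ ModuleCat.of R (idemRows ε'))
    (hf : f.hom = rowHom M hM) :
    Module.finrank K (LinearMap.range (Linear.leftComp K N f)) =
      Module.finrank K ((homCols N K ε').map (colHom N K M)) := by
  have h : (homCols N K ε').map (colHom N K M) =
      (LinearMap.range (Linear.leftComp K N f)).map (homEval N K hε) := by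
    rw [← LinearMap.range_comp, homEval_comp N hε hε' M hM hM' f hf, LinearMap.range_comp,
      range_homEval]
  rw [h]
  exact LinearEquiv.finrank_eq (Submodule.equivMapOfInjective _ (homEval_injective N hε) _)

end HomGeneral

/-! ### Cochains with values in the bimodule `L`, as columns of elements of `L`. -/

section HomSelf

open scoped ModuleCat

variable {K : Type u} [Field K] {L : Type u} [Ring L] [Algebra K L]
  {I J : Type} [Fintype I] [DecidableEq I] [Fintype J] [DecidableEq J]

/-- The action of `L ⊗ Lᵒᵖ` on `L`. -/
def envAct : EnvAlg K L →ₗ[K] L →ₗ[K] L :=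
  TensorProduct.lift (LinearMap.mk₂ K (fun a b => LinearMap.mulLeft K a ∘ₗ
    LinearMap.mulRight K (MulOpposite.unop b))
    (fun a b c => by ext; simp [add_mul]) (fun c a b => by ext; simp)
    (fun a b c => by ext; simp [mul_add]) (fun c a b => by ext; simp))

lemma envAct_tmul (a b x : L) :
    envAct (a ⊗ₜ[K] MulOpposite.op b : EnvAlg K L) x = a * x * b := by
  simp [envAct, mul_assoc]

lemma envSelfEquiv_smul_eq (r : EnvAlg K L) (x : envSelf K L) :
    envSelfEquiv (r • x) = envAct r (envSelfEquiv x) := by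
  induction r using TensorProduct.induction_on with
  | zero =>
    rw [map_zero, LinearMap.zero_apply]
    exact (congrArg envSelfEquiv (zero_smul (EnvAlg K L) x)).trans (map_zero _)
  | add r s hr hs => rw [map_add, LinearMap.add_apply, ← hr, ← hs, ← map_add, ← add_smul]
  | tmul a b =>
    obtain ⟨b, rfl⟩ := MulOpposite.op_surjective b
    rw [envSelfEquiv_smul, envAct_tmul]

lemma envAct_mul (r s : EnvAlg K L) (x : L) : envAct (r * s) x = envAct r (envAct s x) := by
  have h := envSelfEquiv_smul_eq (r * s) (envSelfEquiv.symm x : envSelf K L)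
  rw [LinearEquiv.apply_symm_apply] at h
  rw [← h, mul_smul, envSelfEquiv_smul_eq, envSelfEquiv_smul_eq, LinearEquiv.apply_symm_apply]

/-- The space of morphisms from `idemRows ε` to `L`, in coordinates. -/
def idemCols (ε : I → EnvAlg K L) : Submodule K (I → L) where
  carrier := {g | ∀ i, envAct (ε i) (g i) = g i}
  add_mem' {f g} hf hg i := by rw [Pi.add_apply, map_add, hf i, hg i]
  zero_mem' i := map_zero _
  smul_mem' r f hf i := by rw [Pi.smul_apply, map_smul, hf i]

/-- The action of a matrix on columns. -/
def colMap (M : Matrix I J (EnvAlg K L)) : (J → L) →ₗ[K] (I → L) :=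
  LinearMap.pi fun i => ∑ j, (envAct (M i j)).comp (LinearMap.proj j)

lemma colMap_apply (M : Matrix I J (EnvAlg K L)) (g : J → L) (i : I) :
    colMap M g i = ∑ j, envAct (M i j) (g j) := by
  simp [colMap]

/-- Columns with entries in the bimodule `L` are columns with entries in `L`. -/
def colEquiv (K : Type u) [Field K] (L : Type u) [Ring L] [Algebra K L] (I : Type) :
    (I → envSelf K L) ≃ₗ[K] (I → L) :=
  LinearEquiv.piCongrRight fun _ => envSelfEquiv

lemma colEquiv_apply (g : I → envSelf K L) (i : I) : colEquiv K L I g i = envSelfEquiv (g i) := rfl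

lemma map_homCols (ε : I → EnvAlg K L) :
    (homCols (envSelf K L) K ε).map (colEquiv K L I).toLinearMap = idemCols ε := by
  ext g
  rw [Submodule.mem_map]
  constructor
  · rintro ⟨f, hf, rfl⟩ i
    change envAct (ε i) (envSelfEquiv (f i)) = envSelfEquiv (f i)
    rw [← envSelfEquiv_smul_eq, hf i]
  · intro hg
    refine ⟨(colEquiv K L I).symm g, fun i => envSelfEquiv.injective ?_,
      (colEquiv K L I).apply_symm_apply g⟩
    rw [envSelfEquiv_smul_eq, ← colEquiv_apply, LinearEquiv.apply_symm_apply, hg i]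

lemma colEquiv_comp_colHom (M : Matrix I J (EnvAlg K L)) :
    (colEquiv K L I).toLinearMap ∘ₗ colHom (envSelf K L) K M =
      colMap M ∘ₗ (colEquiv K L J).toLinearMap := by
  refine LinearMap.ext fun g => funext fun i => ?_
  change envSelfEquiv (colHom (envSelf K L) K M g i) = colMap M (colEquiv K L J g) i
  rw [colMap_apply, colHom_apply, map_sum]
  exact Finset.sum_congr rfl fun j _ => envSelfEquiv_smul_eq _ _

lemma finrank_hom_envSelf {ε : I → EnvAlg K L} (hε : ∀ i, ε i * ε i = ε i) :
    Module.finrank K (ModuleCat.of (EnvAlg K L) (idemRows ε) ⟶ envSelf K L) =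
      Module.finrank K (idemCols ε) := by
  rw [finrank_hom_eq (envSelf K L) hε, ← map_homCols]
  exact (LinearEquiv.finrank_map_eq (colEquiv K L I) _).symm

lemma finite_hom_envSelf [Module.Finite K L] {ε : I → EnvAlg K L} (hε : ∀ i, ε i * ε i = ε i) :
    Module.Finite K (ModuleCat.of (EnvAlg K L) (idemRows ε) ⟶ envSelf K L) :=
  Module.Finite.of_injective
    ((colEquiv K L I).toLinearMap ∘ₗ homEval (envSelf K L) K hε)
    ((colEquiv K L I).injective.comp (homEval_injective (K := K) (envSelf K L) hε))

lemma finrank_range_precompSelf {ε : I → EnvAlg K L} {ε' : J → EnvAlg K L}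
    (hε : ∀ i, ε i * ε i = ε i) (hε' : ∀ i, ε' i * ε' i = ε' i) (M : Matrix I J (EnvAlg K L))
    (hM : ∀ i j, M i j * ε' j = M i j) (hM' : ∀ i j, ε i * M i j = M i j)
    (f : ModuleCat.of (EnvAlg K L) (idemRows ε) ⟶ ModuleCat.of (EnvAlg K L) (idemRows ε'))
    (hf : f.hom = rowHom M hM) :
    Module.finrank K (LinearMap.range (precompSelf K L f)) =
      Module.finrank K ((idemCols ε').map (colMap M)) := by
  have h := finrank_range_leftComp (K := K) (envSelf K L) hε hε' M hM hM' f hf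
  rw [precompSelf, h, ← map_homCols (K := K) ε', ← Submodule.map_comp,
    ← colEquiv_comp_colHom (K := K) M,
    Submodule.map_comp]
  exact (LinearEquiv.finrank_map_eq (colEquiv K L I) _).symm

end HomSelf

/-! ### The matrices of the bimodule resolution -/

section PureTensor

variable {K : Type u} [Field K] {L : Type u} [Ring L] [Algebra K L]

/-- The pure tensors of the enveloping algebra. -/
def tm (K : Type u) [Field K] {L : Type u} [Ring L] [Algebra K L] (x y : L) : EnvAlg K L :=
  x ⊗ₜ[K] MulOpposite.op y

lemma tm_mul_tm (x y x' y' : L) : tm K x y * tm K x' y' = tm K (x * x') (y' * y) := by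
  rw [tm, tm, Algebra.TensorProduct.tmul_mul_tmul, ← MulOpposite.op_mul, tm]

lemma tm_zero_left (y : L) : tm K 0 y = 0 := TensorProduct.zero_tmul _ _

lemma tm_zero_right (x : L) : tm K x 0 = 0 := TensorProduct.tmul_zero _ _

lemma sum_tm {ι : Type*} (s : Finset ι) (x : ι → L) (y : L) :
    ∑ i ∈ s, tm K (x i) y = tm K (∑ i ∈ s, x i) y := (TensorProduct.sum_tmul _ _ _).symm

lemma tm_sum {ι : Type*} (s : Finset ι) (x : L) (y : ι → L) :
    ∑ i ∈ s, tm K x (y i) = tm K x (∑ i ∈ s, y i) := by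
  rw [tm, Finset.op_sum, TensorProduct.tmul_sum]
  rfl

lemma smul_tm (c : K) (x y : L) : c • tm K x y = tm K (c • x) y := TensorProduct.smul_tmul' _ _ _

lemma smul_tm_right (c : K) (x y : L) : c • tm K x y = tm K x (c • y) := by
  rw [tm, tm, MulOpposite.op_smul, TensorProduct.tmul_smul]

lemma envAct_tm (a b x : L) : envAct (tm K a b) x = a * x * b := envAct_tmul _ _ _

end PureTensor

namespace PathBasis

open LArrow

variable {K : Type u} [Field K] {n : ℕ} [NeZero n] {L : Type u} [Ring L] [Algebra K L]
  (B : PathBasis K n L)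

/-- The idempotents of the vertices. -/
def vtxIdem (i : Fin n) : EnvAlg K L := tm K (B.vtx i) (B.vtx i)

/-- The idempotents of the arrows. -/
def arrIdem (a : LArrow n) : EnvAlg K L := tm K (B.vtx a.src) (B.vtx a.tgt)

lemma vtxIdem_mul_self (i : Fin n) : B.vtxIdem i * B.vtxIdem i = B.vtxIdem i := by
  rw [vtxIdem, tm_mul_tm, vtx_mul_self]

lemma arrIdem_mul_self (a : LArrow n) : B.arrIdem a * B.arrIdem a = B.arrIdem a := by
  rw [arrIdem, tm_mul_tm, vtx_mul_self, vtx_mul_self]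

/-- The sign of an arrow, as an element of the field. -/
def sg (K : Type u) [Field K] (a : LArrow n) : K := ((a.sgn : ℤ) : K)

/-- The first differential. -/
def mat₁ (s : K) : Matrix (LArrow n) (Fin n) (EnvAlg K L) := fun a i =>
  (if a.tgt = i then tm K (B.arr a) (B.vtx a.tgt) else 0) -
    if a.src = i then s • tm K (B.vtx a.src) (B.arr a) else 0

/-- The second differential. -/
def mat₂ (s : K) : Matrix (Fin n) (LArrow n) (EnvAlg K L) := fun i a =>
  (if a.tgt = i then sg K a.bar • tm K (B.arr a.bar) (B.vtx a.tgt) else 0) +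
    if a.src = i then (s * sg K a) • tm K (B.vtx a.src) (B.arr a.bar) else 0

/-- The third differential. -/
def mat₃ (s : K) : Matrix (Fin n) (Fin n) (EnvAlg K L) := fun j i =>
  (-1 : K) ^ (i : ℕ) • ∑ d ∈ Finset.range (2 * n),
    (-s) ^ d • tm K (B.path j d i) (B.path i (2 * n - 1 - d) j)

lemma arr_bar_mul_vtx (a : LArrow n) : B.arr a.bar * B.vtx a.src = B.arr a.bar := by
  rw [← tgt_bar, arr_mul_vtx]

lemma vtx_mul_arr_bar (a : LArrow n) : B.vtx a.tgt * B.arr a.bar = B.arr a.bar := by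
  rw [← src_bar, vtx_mul_arr]

lemma mat₁_mul_vtxIdem (s : K) (a : LArrow n) (i : Fin n) :
    B.mat₁ s a i * B.vtxIdem i = B.mat₁ s a i := by
  rw [mat₁, vtxIdem, sub_mul]
  congr 1
  · split_ifs with h
    · subst h; rw [tm_mul_tm, arr_mul_vtx, vtx_mul_self]
    · rw [zero_mul]
  · split_ifs with h
    · subst h; rw [smul_mul_assoc, tm_mul_tm, vtx_mul_arr, vtx_mul_self]
    · rw [zero_mul]

lemma arrIdem_mul_mat₁ (s : K) (a : LArrow n) (i : Fin n) :
    B.arrIdem a * B.mat₁ s a i = B.mat₁ s a i := by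
  rw [mat₁, arrIdem, mul_sub]
  congr 1
  · split_ifs with h
    · rw [tm_mul_tm, vtx_mul_arr, vtx_mul_self]
    · rw [mul_zero]
  · split_ifs with h
    · rw [mul_smul_comm, tm_mul_tm, arr_mul_vtx, vtx_mul_self]
    · rw [mul_zero]

lemma mat₂_mul_arrIdem (s : K) (i : Fin n) (a : LArrow n) :
    B.mat₂ s i a * B.arrIdem a = B.mat₂ s i a := by
  rw [mat₂, arrIdem, add_mul]
  congr 1
  · split_ifs with h
    · rw [smul_mul_assoc, tm_mul_tm, arr_bar_mul_vtx, vtx_mul_self]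
    · rw [zero_mul]
  · split_ifs with h
    · rw [smul_mul_assoc, tm_mul_tm, vtx_mul_self, vtx_mul_arr_bar]
    · rw [zero_mul]

lemma vtxIdem_mul_mat₂ (s : K) (i : Fin n) (a : LArrow n) :
    B.vtxIdem i * B.mat₂ s i a = B.mat₂ s i a := by
  rw [mat₂, vtxIdem, mul_add]
  congr 1
  · split_ifs with h
    · subst h; rw [mul_smul_comm, tm_mul_tm, vtx_mul_arr_bar, vtx_mul_self]
    · rw [mul_zero]
  · split_ifs with h
    · subst h; rw [mul_smul_comm, tm_mul_tm, vtx_mul_self, arr_bar_mul_vtx]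
    · rw [mul_zero]

lemma mat₃_mul_vtxIdem (s : K) (j i : Fin n) : B.mat₃ s j i * B.vtxIdem i = B.mat₃ s j i := by
  rw [mat₃, vtxIdem, smul_mul_assoc, Finset.sum_mul]
  congr 1
  refine Finset.sum_congr rfl fun d _ => ?_
  rw [smul_mul_assoc, tm_mul_tm, path_mul_vtx, vtx_mul_path]

lemma vtxIdem_mul_mat₃ (s : K) (j i : Fin n) : B.vtxIdem j * B.mat₃ s j i = B.mat₃ s j i := by
  rw [mat₃, vtxIdem, mul_smul_comm, Finset.mul_sum]
  congr 1
  refine Finset.sum_congr rfl fun d _ => ?_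
  rw [mul_smul_comm, tm_mul_tm, path_mul_vtx, vtx_mul_path]

/-- The involution on arrows. -/
def barEquiv (n : ℕ) [NeZero n] : LArrow n ≃ LArrow n where
  toFun := LArrow.bar
  invFun := LArrow.bar
  left_inv := bar_bar
  right_inv := bar_bar

/-- Expanding gives four sums over arrows. The two in which both factors act on the same side
contain the relation at i and vanish; the two mixed ones become equal after replacing a by ā and
enter with opposite signs. -/
lemma mat₂_mul_mat₁ {s : K} : B.mat₂ s * B.mat₁ s = 0 := by
  ext i k
  rw [Matrix.mul_apply, Matrix.zero_apply]
  have hsum (j : Fin n) : ∑ a : LArrow n, (if a.src = j then sg K a • (B.arr a * B.arr a.bar)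
      else 0) = 0 := by
    rw [← Finset.sum_filter]
    exact B.sum_sgn_arr_mul_arr_bar j
  have h1 : ∑ a : LArrow n,
      (if a.tgt = i then sg K a.bar • tm K (B.arr a.bar) (B.vtx a.tgt) else 0)
      * (if a.tgt = k then tm K (B.arr a) (B.vtx a.tgt) else 0) = 0 := by
    rw [← (barEquiv n).sum_comp]
    by_cases hik : i = k
    · subst hik
      refine Eq.trans (b := ∑ b : LArrow n, tm K (if b.src = i then
        sg K b • (B.arr b * B.arr b.bar) else 0) (B.vtx i))
        (Finset.sum_congr rfl fun b _ => ?_) (by rw [sum_tm, hsum, tm_zero_left])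
      change (if b.bar.tgt = i then sg K b.bar.bar • tm K (B.arr b.bar.bar) (B.vtx b.bar.tgt)
        else 0) * (if b.bar.tgt = i then tm K (B.arr b.bar) (B.vtx b.bar.tgt) else 0) = _
      rw [tgt_bar, bar_bar]
      split_ifs with h
      · rw [smul_mul_assoc, tm_mul_tm, vtx_mul_self, smul_tm, h]
      · rw [zero_mul, tm_zero_left]
    · refine Finset.sum_eq_zero fun b _ => ?_
      split_ifs with h h'
      · exact absurd (h.symm.trans h') hik
      all_goals simp
  have h4 : ∑ a : LArrow n,
      (if a.src = i then (s * sg K a) • tm K (B.vtx a.src) (B.arr a.bar) else 0)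
      * (if a.src = k then s • tm K (B.vtx a.src) (B.arr a) else 0) = 0 := by
    by_cases hik : i = k
    · subst hik
      refine Eq.trans (b := ∑ b : LArrow n, (s * s) • tm K (B.vtx i) (if b.src = i then
        sg K b • (B.arr b * B.arr b.bar) else 0)) (Finset.sum_congr rfl fun b _ => ?_)
        (by rw [← Finset.smul_sum, tm_sum, hsum, tm_zero_right, smul_zero])
      split_ifs with h
      · rw [smul_mul_smul_comm, tm_mul_tm, vtx_mul_self, ← smul_tm_right, smul_smul, h,
          mul_right_comm]
      · rw [zero_mul, tm_zero_right, smul_zero]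
    · refine Finset.sum_eq_zero fun b _ => ?_
      split_ifs with h h'
      · exact absurd (h.symm.trans h') hik
      all_goals simp
  have h23 : ∑ a : LArrow n,
      (if a.tgt = i then sg K a.bar • tm K (B.arr a.bar) (B.vtx a.tgt) else 0)
      * (if a.src = k then s • tm K (B.vtx a.src) (B.arr a) else 0) = ∑ a : LArrow n,
      (if a.src = i then (s * sg K a) • tm K (B.vtx a.src) (B.arr a.bar) else 0)
      * (if a.tgt = k then tm K (B.arr a) (B.vtx a.tgt) else 0) := by
    rw [← (barEquiv n).sum_comp]
    refine Finset.sum_congr rfl fun b _ => ?_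
    change (if b.bar.tgt = i then sg K b.bar.bar • tm K (B.arr b.bar.bar) (B.vtx b.bar.tgt)
      else 0) * (if b.bar.src = k then s • tm K (B.vtx b.bar.src) (B.arr b.bar) else 0) = _
    rw [tgt_bar, bar_bar, src_bar]
    split_ifs
    · rw [smul_mul_smul_comm, tm_mul_tm, smul_mul_assoc, tm_mul_tm, arr_mul_vtx, vtx_mul_arr,
        arr_bar_mul_vtx, vtx_mul_arr_bar, mul_comm]
    all_goals simp
  simp_rw [mat₂, mat₁, mul_sub, add_mul, Finset.sum_sub_distrib, Finset.sum_add_distrib]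
  rw [h1, h4, h23]
  abel

/-- A sliding property of the Casimir element. -/
lemma tm_path_mul_arr_bar (j : Fin n) (a : LArrow n) {d : ℕ} (hd : d < 2 * n) :
    tm K (B.path j d a.tgt * B.arr a.bar) (B.path a.tgt (2 * n - 1 - d) j) =
      tm K (B.path j (d + 1) a.src) (B.path a.tgt (2 * n - 1 - d) j) := by
  by_cases h : Valid n j a.tgt d
  · rw [← src_bar] at h ⊢
    rw [B.path_mul_arr h, tgt_bar]
  · rw [B.path_of_not_valid (mt (valid_dual hd).1 h), tm_zero_right, tm_zero_right]

lemma tm_arr_bar_mul_path (j : Fin n) (a : LArrow n) {d : ℕ} (hd : d < 2 * n) :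
    tm K (B.path j d a.src) (B.arr a.bar * B.path a.src (2 * n - 1 - d) j) =
      tm K (B.path j d a.src) (B.path a.tgt (2 * n - d) j) := by
  by_cases h : Valid n j a.src d
  · have h' := (valid_dual hd).2 h
    rw [← tgt_bar] at h' ⊢
    rw [B.arr_mul_path h', src_bar, show 2 * n - 1 - d + 1 = 2 * n - d by omega]
  · rw [B.path_of_not_valid h, tm_zero_left, tm_zero_left]

lemma not_valid_two_mul (i j : Fin n) : ¬ Valid n i j (2 * n) := fun h =>
  lt_irrefl _ (lt_two_mul_of_valid h)

/-- Shift the index by one. The terms at the two ends vanish because no path has length 2n, and the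
shift costs the factor -s because s² = 1. -/
lemma sum_shift {s : K} (hs : s * s = 1) (i j k l : Fin n) :
    ∑ d ∈ Finset.range (2 * n),
      (-s) ^ d • tm K (B.path j (d + 1) i) (B.path k (2 * n - 1 - d) l) =
    -s • ∑ d ∈ Finset.range (2 * n), (-s) ^ d • tm K (B.path j d i) (B.path k (2 * n - d) l) := by
  obtain ⟨m, hm⟩ : ∃ m, 2 * n = m + 1 := ⟨2 * n - 1, by have := NeZero.pos n; omega⟩
  have h1 : B.path j (m + 1) i = 0 := by
    rw [← hm]; exact B.path_of_not_valid (not_valid_two_mul _ _)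
  have h2 : B.path k (m + 1 - 0) l = 0 := by
    rw [← hm]; exact B.path_of_not_valid (not_valid_two_mul _ _)
  rw [hm, Finset.sum_range_succ, h1, tm_zero_left, smul_zero, add_zero, Finset.sum_range_succ',
    h2, tm_zero_right, smul_zero, add_zero, Finset.smul_sum]
  refine Finset.sum_congr rfl fun d hd => ?_
  rw [smul_smul, ← pow_succ', pow_succ, pow_succ, mul_assoc, neg_mul_neg, hs, mul_one,
    show m + 1 - 1 - d = m + 1 - (d + 1) by omega]

lemma tm_arr_mul_path (k : Fin n) (a : LArrow n) {d : ℕ} (hd : d < 2 * n) :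
    tm K (B.arr a * B.path a.tgt d k) (B.path k (2 * n - 1 - d) a.tgt) =
      tm K (B.path a.src (d + 1) k) (B.path k (2 * n - 1 - d) a.tgt) := by
  by_cases h : Valid n a.tgt k d
  · rw [B.arr_mul_path h]
  · rw [B.path_of_not_valid (mt (valid_dual hd).1 h), tm_zero_right, tm_zero_right]

lemma tm_path_mul_arr (k : Fin n) (a : LArrow n) {d : ℕ} (hd : d < 2 * n) :
    tm K (B.path a.src d k) (B.path k (2 * n - 1 - d) a.src * B.arr a) =
      tm K (B.path a.src d k) (B.path k (2 * n - d) a.tgt) := by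
  by_cases h : Valid n a.src k d
  · rw [B.path_mul_arr ((valid_dual hd).2 h), show 2 * n - 1 - d + 1 = 2 * n - d by omega]
  · rw [B.path_of_not_valid h, tm_zero_left, tm_zero_left]

/-- This is what the weight (-1) ^ i in `mat₃` is for: it makes the signs of an arrow and its
opposite comparable. -/
lemma sg_bar (a : LArrow n) :
    (-1 : K) ^ (a.tgt : ℕ) * sg K a.bar = (-1) ^ (a.src : ℕ) * sg K a := by
  rcases a with _ | i | i <;> simp [sg, sgn, pow_succ]

/-- Moving the arrow ā across the tensor sign by `sum_shift` brings both contributions to the same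
sum. By `sg_bar` and s² = 1 their coefficients cancel. -/
lemma mat₃_mul_mat₂ {s : K} (hs : s * s = 1) : B.mat₃ s * B.mat₂ s = 0 := by
  ext j a
  rw [Matrix.mul_apply, Matrix.zero_apply]
  simp_rw [mat₂, mul_add, Finset.sum_add_distrib, mul_ite, mul_zero]
  rw [Finset.sum_ite_eq, Finset.sum_ite_eq, if_pos (Finset.mem_univ _), if_pos (Finset.mem_univ _)]
  simp_rw [mat₃, smul_mul_smul_comm, Finset.sum_mul, smul_mul_assoc, tm_mul_tm, vtx_mul_path,
    path_mul_vtx]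
  have h1 : ∑ d ∈ Finset.range (2 * n), (-s) ^ d •
      tm K (B.path j d a.tgt * B.arr a.bar) (B.path a.tgt (2 * n - 1 - d) j) =
      ∑ d ∈ Finset.range (2 * n), (-s) ^ d •
        tm K (B.path j (d + 1) a.src) (B.path a.tgt (2 * n - 1 - d) j) :=
    Finset.sum_congr rfl fun d hd => by rw [B.tm_path_mul_arr_bar j a (Finset.mem_range.1 hd)]
  have h2 : ∑ d ∈ Finset.range (2 * n), (-s) ^ d •
      tm K (B.path j d a.src) (B.arr a.bar * B.path a.src (2 * n - 1 - d) j) =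
      ∑ d ∈ Finset.range (2 * n), (-s) ^ d •
        tm K (B.path j d a.src) (B.path a.tgt (2 * n - d) j) :=
    Finset.sum_congr rfl fun d hd => by rw [B.tm_arr_bar_mul_path j a (Finset.mem_range.1 hd)]
  rw [h1, h2, B.sum_shift hs, smul_smul, ← add_smul, sg_bar]
  convert zero_smul K _ using 2
  ring

/-- Sliding an arrow through the Casimir element costs -s, so it is `mat₁` for -s that kills it.
This is the twist which makes the period of the resolution 6 and not 3. -/
lemma mat₁_mul_mat₃ {s : K} (hs : s * s = 1) : B.mat₁ (-s) * B.mat₃ s = 0 := by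
  ext a k
  rw [Matrix.mul_apply, Matrix.zero_apply]
  simp_rw [mat₁, sub_mul, Finset.sum_sub_distrib, ite_mul, zero_mul]
  rw [Finset.sum_ite_eq, Finset.sum_ite_eq, if_pos (Finset.mem_univ _), if_pos (Finset.mem_univ _)]
  simp_rw [mat₃, mul_smul_comm, smul_mul_assoc, Finset.mul_sum, mul_smul_comm, tm_mul_tm,
    vtx_mul_path, path_mul_vtx]
  have h1 : ∑ d ∈ Finset.range (2 * n), (-s) ^ d •
      tm K (B.arr a * B.path a.tgt d k) (B.path k (2 * n - 1 - d) a.tgt) =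
      ∑ d ∈ Finset.range (2 * n), (-s) ^ d •
        tm K (B.path a.src (d + 1) k) (B.path k (2 * n - 1 - d) a.tgt) :=
    Finset.sum_congr rfl fun d hd => by rw [B.tm_arr_mul_path k a (Finset.mem_range.1 hd)]
  have h2 : ∑ d ∈ Finset.range (2 * n), (-s) ^ d •
      tm K (B.path a.src d k) (B.path k (2 * n - 1 - d) a.src * B.arr a) =
      ∑ d ∈ Finset.range (2 * n), (-s) ^ d •
        tm K (B.path a.src d k) (B.path k (2 * n - d) a.tgt) :=
    Finset.sum_congr rfl fun d hd => by rw [B.tm_path_mul_arr k a (Finset.mem_range.1 hd)]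
  rw [h1, h2, B.sum_shift hs, smul_comm ((-1 : K) ^ (k : ℕ)) (-s), sub_self]

end PathBasis

/-! ### Dimensions of the projective bimodules -/

namespace LArrow

variable {n : ℕ}

/-- The number of paths between two vertices. -/
def mult (n i j : ℕ) : ℕ := 2 * (n - max i j)

/-- The two parities give two arithmetic progressions of step 2, starting at |i - j| and at i + j +
1, with n - max(i, j) terms each. -/
lemma card_valid (i j : Fin n) :
    ((Finset.range (2 * n)).filter fun d => Valid n i j d).card = mult n i j := by
  have hi := i.2
  have hj := j.2
  have h : ((Finset.range (2 * n)).filter fun d => Valid n i j d) =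
      (Finset.range (n - max (i : ℕ) j)).image (fun k => (max (i : ℕ) j - min (i : ℕ) j) + 2 * k) ∪
        (Finset.range (n - max (i : ℕ) j)).image (fun k => i + j + 1 + 2 * k) := by
    ext d
    simp only [Finset.mem_filter, Finset.mem_range, Finset.mem_union, Finset.mem_image]
    constructor
    · rintro ⟨-, h | h⟩
      · exact Or.inl ⟨(d - (max (i : ℕ) j - min (i : ℕ) j)) / 2, by omega, by omega⟩
      · exact Or.inr ⟨(d - (i + j + 1)) / 2, by omega, by omega⟩
    · rintro (⟨k, hk, rfl⟩ | ⟨k, hk, rfl⟩) <;> unfold Valid <;> omega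
  rw [h, Finset.card_union_of_disjoint, Finset.card_image_of_injective,
    Finset.card_image_of_injective, Finset.card_range, mult, two_mul]
  · intro a b hab
    simpa using hab
  · intro a b hab
    simpa using hab
  · rw [Finset.disjoint_left]
    simp only [Finset.mem_image, Finset.mem_range]
    rintro _ ⟨k, hk, rfl⟩ ⟨l, hl, h⟩
    omega

lemma mult_comm (i j : ℕ) : mult n i j = mult n j i := by rw [mult, mult, max_comm]

variable [NeZero n]

/-- This is the matrix identity (2 - A) C = 2, with A the adjacency matrix of the graph and C the
Cartan matrix of the numbers `mult`. As a function of j, C is constant up to i and then decreases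
linearly to 0 at n; the loop is the reflecting boundary at 0. It yields the dimension balances and
the invertibility of C when 2 ≠ 0. -/
lemma sum_mult_tgt (i j : Fin n) :
    ∑ a : LArrow n with a.src = j, mult n i a.tgt + (if i = j then 2 else 0) = 2 * mult n i j := by
  rw [sum_src, tgt_left]
  have hi := i.2
  have hj := j.2
  simp only [tgt_up, mult, Fin.ext_iff]
  split_ifs <;> omega

/-- The number of paths which end at a vertex. -/
def cnt (n j : ℕ) : ℕ := ∑ i : Fin n, mult n i j

lemma sum_cnt_tgt (j : Fin n) :
    ∑ a : LArrow n with a.src = j, cnt n a.tgt + 2 = 2 * cnt n j := by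
  have h := Finset.sum_congr (rfl : (Finset.univ : Finset (Fin n)) = _)
    fun i _ => sum_mult_tgt i j
  rw [Finset.sum_add_distrib, Finset.sum_comm, ← Finset.mul_sum, Finset.sum_ite_eq',
    if_pos (Finset.mem_univ _)] at h
  exact h

lemma sum_eq_sum_src {M : Type*} [AddCommMonoid M] (f : LArrow n → M) :
    ∑ a, f a = ∑ j : Fin n, ∑ a : LArrow n with a.src = j, f a :=
  (Finset.sum_fiberwise _ _ _).symm

lemma sum_mult_arrow : ∑ a : LArrow n, mult n a.src a.tgt + 2 * n =
    2 * ∑ j : Fin n, mult n j j := by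
  have h := Finset.sum_congr (rfl : (Finset.univ : Finset (Fin n)) = _)
    fun j _ => sum_mult_tgt j j
  simp only [if_true, Finset.sum_add_distrib, Finset.sum_const, Finset.card_univ,
    Fintype.card_fin, smul_eq_mul, ← Finset.mul_sum] at h
  rw [sum_eq_sum_src, ← h, mul_comm 2 n]
  congr 1
  refine Finset.sum_congr rfl fun j _ => Finset.sum_congr rfl fun a ha => ?_
  rw [(Finset.mem_filter.1 ha).2]

lemma sum_cnt_arrow : ∑ a : LArrow n, cnt n a.src * cnt n a.tgt + 2 * ∑ j : Fin n, cnt n j =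
    2 * ∑ j : Fin n, cnt n j * cnt n j := by
  rw [sum_eq_sum_src, Finset.mul_sum, Finset.mul_sum, ← Finset.sum_add_distrib]
  refine Finset.sum_congr rfl fun j _ => ?_
  have h : ∑ a : LArrow n with a.src = j, cnt n a.src * cnt n a.tgt =
      cnt n j * ∑ a : LArrow n with a.src = j, cnt n a.tgt := by
    rw [Finset.mul_sum]
    exact Finset.sum_congr rfl fun a ha => by rw [(Finset.mem_filter.1 ha).2]
  rw [h]
  linear_combination (cnt n j) * sum_cnt_tgt j

end LArrow

namespace PathIdx

open LArrow

variable {n : ℕ} [NeZero n]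

lemma sum_eq {M : Type*} [AddCommMonoid M] (f : Fin n → ℕ → Fin n → M) :
    ∑ x : PathIdx n, f x.1.1 x.1.2.1 x.1.2.2 =
      ∑ i : Fin n, ∑ j : Fin n, ∑ d ∈ Finset.range (2 * n),
        if Valid n i j d then f i d j else 0 := by
  have h : ∑ x : PathIdx n, f x.1.1 x.1.2.1 x.1.2.2 = ∑ x : Fin n × Fin (2 * n) × Fin n,
      if Valid n x.1 x.2.2 x.2.1 then f x.1 x.2.1 x.2.2 else 0 := by
    rw [← Finset.sum_filter]
    exact (Finset.sum_subtype (Finset.univ.filter fun x : Fin n × Fin (2 * n) × Fin n =>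
      Valid n x.1 x.2.2 x.2.1) (fun x => by simp) fun x => f x.1 x.2.1 x.2.2).symm
  rw [h, Fintype.sum_prod_type]
  refine Finset.sum_congr rfl fun i _ => ?_
  rw [Fintype.sum_prod_type, Finset.sum_comm]
  exact Finset.sum_congr rfl fun j _ =>
    (Finset.sum_range fun d => if Valid n i j d then f i d j else 0).symm

lemma sum_ite (i j : Fin n) :
    ∑ x : PathIdx n, (if x.1.1 = i ∧ x.1.2.2 = j then 1 else 0) = mult n i j := by
  rw [sum_eq fun i' _ j' => if i' = i ∧ j' = j then 1 else 0, Finset.sum_eq_single i,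
    Finset.sum_eq_single j, ← card_valid, Finset.card_filter]
  · simp
  · intro b _ hb; simp [hb]
  · simp
  · intro b _ hb; simp [hb]
  · simp

lemma sum_ite_snd (j : Fin n) :
    ∑ x : PathIdx n, (if x.1.2.2 = j then 1 else 0) = cnt n j := by
  rw [cnt]
  simp_rw [← sum_ite]
  rw [Finset.sum_comm]
  refine Finset.sum_congr rfl fun x _ => ?_
  simp [ite_and]

lemma sum_ite_fst (i : Fin n) :
    ∑ x : PathIdx n, (if x.1.1 = i then 1 else 0) = cnt n i := by
  rw [cnt]
  simp_rw [mult_comm (n := n) _ (i : ℕ), ← sum_ite]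
  rw [Finset.sum_comm]
  refine Finset.sum_congr rfl fun x _ => ?_
  simp [and_comm (a := x.1.1 = i), ite_and]

lemma card_eq : Fintype.card (PathIdx n) = ∑ j : Fin n, cnt n j := by
  simp_rw [← sum_ite_snd]
  rw [Finset.sum_comm]
  simp

end PathIdx

namespace PathBasis

open LArrow

variable {K : Type u} [Field K] {n : ℕ} [NeZero n] {L : Type u} [Ring L] [Algebra K L]
  (B : PathBasis K n L)

lemma finrank_eq (B : PathBasis K n L) : Module.finrank K L = ∑ j : Fin n, cnt n j := by
  rw [Module.finrank_eq_card_basis B.basis, PathIdx.card_eq]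

/-- The basis of the enveloping algebra given by the paths. -/
def envBasis : Module.Basis (PathIdx n × PathIdx n) K (EnvAlg K L) :=
  B.basis.tensorProduct (B.basis.map (MulOpposite.opLinearEquiv K))

lemma envBasis_apply (x : PathIdx n × PathIdx n) : B.envBasis x =
    tm K (B.path x.1.1.1 x.1.1.2.1 x.1.1.2.2) (B.path x.2.1.1 x.2.1.2.1 x.2.1.2.2) := by
  rw [envBasis, Module.Basis.tensorProduct_apply, Module.Basis.map_apply, basis_apply, basis_apply]
  rfl

lemma finite_envAlg (B : PathBasis K n L) : Module.Finite K (EnvAlg K L) :=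
  Module.Finite.of_basis B.envBasis

section

variable {I : Type} [Fintype I] {ε : I → EnvAlg K L} {p q : I → Fin n}

lemma finite_idemRows (B : PathBasis K n L) (ε : I → EnvAlg K L) :
    Module.Finite K (idemRows ε) := by
  have := B.finite_envAlg
  exact Module.Finite.of_injective ((idemRows ε).subtype.restrictScalars K)
    Subtype.val_injective

variable [DecidableEq I]

/-- Multiplication by an idempotent keeps or kills each basis element of the enveloping algebra. The
survivors are pairs of a path ending at p and a path starting at q. -/
lemma finrank_idemRows (hε : ∀ i, ε i = tm K (B.vtx (p i)) (B.vtx (q i))) :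
    Module.finrank K (idemRows ε) = ∑ i, cnt n (p i) * cnt n (q i) := by
  let π : (I → EnvAlg K L) →ₗ[K] (I → EnvAlg K L) :=
    LinearMap.pi fun i => LinearMap.mulRight K (ε i) ∘ₗ LinearMap.proj i
  have hε' (i : I) : ε i * ε i = ε i := by
    rw [hε, tm_mul_tm, vtx_mul_self, vtx_mul_self]
  have h1 : LinearMap.range π = (idemRows ε).restrictScalars K := by
    refine le_antisymm ?_ fun f hf => ⟨f, funext hf⟩
    rintro _ ⟨f, rfl⟩ i
    change f i * ε i * ε i = f i * ε i
    rw [mul_assoc, hε']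
  have h2 := finrank_range_of_basis (Pi.basis fun _ : I => B.envBasis) π
    (fun z => z.2.1.1.2.2 = p z.1 ∧ q z.1 = z.2.2.1.1) (fun z => by
      refine funext fun i => ?_
      rw [Pi.basis_apply]
      change (Pi.single z.1 (B.envBasis z.2) : I → EnvAlg K L) i * ε i = _
      by_cases hi : i = z.1
      · subst hi
        rw [Pi.single_eq_same, envBasis_apply, hε, tm_mul_tm]
        split_ifs with h
        · rw [← h.1, h.2, path_mul_vtx, vtx_mul_path, Pi.single_eq_same]
        · rw [not_and_or] at h
          rcases h with h | h
          · rw [B.path_mul_vtx_of_ne h, tm_zero_left]; rfl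
          · rw [B.vtx_mul_path_of_ne h, tm_zero_right]; rfl
      · rw [Pi.single_eq_of_ne hi, zero_mul]
        split_ifs
        · rw [Pi.single_eq_of_ne hi]
        · rfl)
  rw [h1] at h2
  refine h2.trans ?_
  rw [Fintype.card_subtype, Finset.card_filter, Fintype.sum_sigma]
  refine Finset.sum_congr rfl fun i _ => ?_
  rw [← PathIdx.sum_ite_snd, ← PathIdx.sum_ite_fst, Fintype.sum_prod_type, Finset.sum_mul_sum]
  refine Finset.sum_congr rfl fun x _ => Finset.sum_congr rfl fun y _ => ?_
  by_cases h1 : x.1.2.2 = p i <;> by_cases h2 : y.1.1 = q i <;> simp [h1, h2, Ne.symm]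

lemma finrank_idemCols (hε : ∀ i, ε i = tm K (B.vtx (p i)) (B.vtx (q i))) :
    Module.finrank K (idemCols ε) = ∑ i, mult n (p i) (q i) := by
  let π : (I → L) →ₗ[K] (I → L) :=
    LinearMap.pi fun i => envAct (ε i) ∘ₗ LinearMap.proj i
  have hε' (i : I) : ε i * ε i = ε i := by
    rw [hε, tm_mul_tm, vtx_mul_self, vtx_mul_self]
  have h1 : LinearMap.range π = idemCols ε := by
    refine le_antisymm ?_ fun f hf => ⟨f, funext hf⟩
    rintro _ ⟨f, rfl⟩ i
    change envAct (ε i) (envAct (ε i) (f i)) = envAct (ε i) (f i)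
    rw [← envAct_mul, hε']
  have h2 := finrank_range_of_basis (Pi.basis fun _ : I => B.basis) π
    (fun z => z.2.1.1 = p z.1 ∧ z.2.1.2.2 = q z.1) (fun z => by
      refine funext fun i => ?_
      rw [Pi.basis_apply]
      change envAct (ε i) ((Pi.single z.1 (B.basis z.2) : I → L) i) = _
      by_cases hi : i = z.1
      · subst hi
        rw [Pi.single_eq_same, basis_apply, hε, envAct_tm]
        split_ifs with h
        · rw [← h.1, ← h.2, vtx_mul_path, path_mul_vtx, Pi.single_eq_same]
        · rw [not_and_or] at h
          rcases h with h | h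
          · rw [B.vtx_mul_path_of_ne (Ne.symm h), zero_mul]; rfl
          · rw [mul_assoc, B.path_mul_vtx_of_ne h, mul_zero]; rfl
      · rw [Pi.single_eq_of_ne hi, map_zero]
        split_ifs
        · rw [Pi.single_eq_of_ne hi]
        · rfl)
  rw [h1] at h2
  refine h2.trans ?_
  rw [Fintype.card_subtype, Finset.card_filter, Fintype.sum_sigma]
  exact Finset.sum_congr rfl fun i _ => PathIdx.sum_ite (p i) (q i)

end

end PathBasis

/-! ### Exactness of the bimodule resolution -/

section IdemElt

variable {K : Type u} [Field K] {R : Type u} [Ring R] [Algebra K R] {I J : Type} [DecidableEq I]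

/-- The elements of `idemRows ε` which are concentrated in one component. -/
def idemElt (K : Type u) [Field K] [Algebra K R] {ε : I → R} (hε : ∀ i, ε i * ε i = ε i) (i : I) :
    R →ₗ[K] idemRows ε where
  toFun z := ⟨Pi.single i (z * ε i), fun j => by
    by_cases h : j = i
    · subst h; simp [mul_assoc, hε]
    · simp [h]⟩
  map_add' z w := Subtype.ext (by
    change (Pi.single i ((z + w) * ε i) : I → R) = Pi.single i (z * ε i) + Pi.single i (w * ε i)
    rw [add_mul, Pi.single_add])
  map_smul' c z := Subtype.ext (by
    change (Pi.single i ((c • z) * ε i) : I → R) = c • Pi.single i (z * ε i)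
    rw [smul_mul_assoc, Pi.single_smul])

lemma idemElt_apply {ε : I → R} (hε : ∀ i, ε i * ε i = ε i) (i : I) (z : R) (j : I) :
    (idemElt K hε i z : I → R) j = if j = i then z * ε i else 0 := by
  change (Pi.single i (z * ε i) : I → R) j = _
  rw [Pi.single_apply]

variable [Fintype I]

lemma sum_idemElt {ε : I → R} (hε : ∀ i, ε i * ε i = ε i) (f : idemRows ε) :
    ∑ i, idemElt K hε i ((f : I → R) i) = f := by
  refine Subtype.ext (funext fun j => ?_)
  simp only [AddSubmonoidClass.coe_finsetSum, Finset.sum_apply, idemElt_apply]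
  rw [Finset.sum_ite_eq, if_pos (Finset.mem_univ _), f.2]

lemma rowHom_idemElt [Fintype J] [DecidableEq J] {ε : I → R} {ε' : J → R}
    (hε : ∀ i, ε i * ε i = ε i)
    (M : Matrix I J R) (hM : ∀ i j, M i j * ε' j = M i j) (hM' : ∀ i j, ε i * M i j = M i j)
    (i : I) (z : R) (j : J) :
    (rowHom M hM (idemElt K hε i z) : J → R) j = z * M i j := by
  rw [rowHom_apply, Finset.sum_eq_single i]
  · rw [idemElt_apply, if_pos rfl, mul_assoc, hM']
  · intro k _ hk
    rw [idemElt_apply, if_neg hk, zero_mul]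
  · simp

lemma rowHom_comp_apply {A : Type} [Fintype J] [Fintype A] [DecidableEq J] [DecidableEq A]
    {ε : I → R} {ε' : J → R} {ε'' : A → R}
    (M : Matrix I J R) (hM : ∀ i j, M i j * ε' j = M i j)
    (N : Matrix J A R) (hN : ∀ i j, N i j * ε'' j = N i j) (h : M * N = 0) (f : idemRows ε) :
    rowHom N hN (rowHom M hM f) = 0 := by
  refine Subtype.ext ?_
  change Matrix.vecMul (Matrix.vecMul (f : I → R) M) N = 0
  rw [Matrix.vecMul_vecMul, h, Matrix.vecMul_zero]

/-- The dimension of the range of a linear map, over the base field. -/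
def rankOver (K : Type u) [Field K] [Algebra K R] {ε : I → R} {ε' : J → R}
    (f : idemRows ε →ₗ[R] idemRows ε') : ℕ :=
  Module.finrank K (LinearMap.range (f.restrictScalars K))

variable [Fintype J] {ε : I → R} {ε' : J → R}

lemma range_eq_ker_of_rankOver {A : Type} {ε'' : A → R} (f : idemRows ε →ₗ[R] idemRows ε')
    (g : idemRows ε' →ₗ[R] idemRows ε'') [Module.Finite K (idemRows ε')]
    (h : ∀ x, g (f x) = 0)
    (hd : Module.finrank K (idemRows ε') ≤ rankOver K f + rankOver K g) :
    LinearMap.range f = LinearMap.ker g := by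
  have h1 := range_eq_ker_of_finrank (f.restrictScalars K) (g.restrictScalars K) h hd
  ext x
  exact SetLike.ext_iff.1 h1 x

variable {V : Type*} [AddCommGroup V] [Module K V]

lemma finrank_le_of_range_sup [Module.Finite K V] [Module.Finite K (idemRows ε')]
    (f : idemRows ε →ₗ[R] idemRows ε') (g : V →ₗ[K] idemRows ε')
    (h : LinearMap.range (f.restrictScalars K) ⊔ LinearMap.range g = ⊤) :
    Module.finrank K (idemRows ε') ≤ rankOver K f + Module.finrank K V := by
  rw [← finrank_top K (idemRows ε'), ← h]
  refine (Submodule.finrank_add_le_finrank_add_finrank _ _).trans ?_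
  rw [rankOver]
  gcongr
  exact LinearMap.finrank_range_le _

lemma finrank_le_of_injective_on_ker [Module.Finite K V] [Module.Finite K (idemRows ε)]
    (f : idemRows ε →ₗ[R] idemRows ε') (g : idemRows ε →ₗ[K] V)
    (h : ∀ w, f w = 0 → g w = 0 → w = 0) :
    Module.finrank K (idemRows ε) ≤ rankOver K f + Module.finrank K V := by
  have h1 := (f.restrictScalars K).finrank_range_add_finrank_ker
  have h2 : Module.finrank K (LinearMap.ker (f.restrictScalars K)) ≤ Module.finrank K V := by
    refine LinearMap.finrank_le_finrank_of_injective
      (f := g ∘ₗ (LinearMap.ker (f.restrictScalars K)).subtype) ?_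
    rw [injective_iff_map_eq_zero]
    exact fun w hw => Subtype.ext (h w w.2 hw)
  rw [rankOver]
  omega

lemma finrank_le_rankOver [Module.Finite K (idemRows ε')] (f : idemRows ε →ₗ[R] idemRows ε')
    (g : V →ₗ[K] idemRows ε) (h : ∀ y, f (g y) = 0 → y = 0) :
    Module.finrank K V ≤ rankOver K f := by
  rw [← LinearMap.finrank_range_of_inj (f := f.restrictScalars K ∘ₗ g)
    ((injective_iff_map_eq_zero _).2 h)]
  exact Submodule.finrank_mono (LinearMap.range_comp_le_range _ _)

end IdemElt

lemma tm_add_right {K : Type u} [Field K] {L : Type u} [Ring L] [Algebra K L] (x y y' : L) :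
    tm K x (y + y') = tm K x y + tm K x y' := TensorProduct.tmul_add _ _ _

namespace PathBasis

open LArrow

variable {K : Type u} [Field K] {n : ℕ} [NeZero n] {L : Type u} [Ring L] [Algebra K L]
  (B : PathBasis K n L)

/-- The first differential, as a map. -/
def diff₁ (s : K) : idemRows B.arrIdem →ₗ[EnvAlg K L] idemRows B.vtxIdem :=
  rowHom (B.mat₁ s) (B.mat₁_mul_vtxIdem s)

/-- The second differential, as a map. -/
def diff₂ (s : K) : idemRows B.vtxIdem →ₗ[EnvAlg K L] idemRows B.arrIdem :=
  rowHom (B.mat₂ s) (B.mat₂_mul_arrIdem s)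

/-- The third differential, as a map. -/
def diff₃ (s : K) : idemRows B.vtxIdem →ₗ[EnvAlg K L] idemRows B.vtxIdem :=
  rowHom (B.mat₃ s) (B.mat₃_mul_vtxIdem s)

lemma vtx_mul_vtx_of_ne {i j : Fin n} (h : i ≠ j) : B.vtx i * B.vtx j = 0 :=
  B.vtx_mul_path_of_ne h 0 j

/-- The subspace of the sum of the `L e_i ⊗ e_i L` given by the `e_i ⊗ e_i y`. -/
def incl : L →ₗ[K] idemRows B.vtxIdem where
  toFun y := ⟨fun j => tm K (B.vtx j) (B.vtx j * y), fun j => by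
    rw [vtxIdem, tm_mul_tm, vtx_mul_self, ← mul_assoc, vtx_mul_self]⟩
  map_add' x y := Subtype.ext (funext fun j => by
    change tm K _ _ = tm K _ _ + tm K _ _
    rw [mul_add, tm_add_right])
  map_smul' c y := Subtype.ext (funext fun j => by
    change tm K _ _ = c • tm K _ _
    rw [mul_smul_comm, smul_tm_right])

lemma incl_apply (y : L) (j : Fin n) :
    (B.incl y : Fin n → EnvAlg K L) j = tm K (B.vtx j) (B.vtx j * y) := rfl

lemma idemElt_path_zero (k : Fin n) (y : L) :
    idemElt K B.vtxIdem_mul_self k (tm K (B.vtx k) y) = B.incl (B.vtx k * y) := by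
  refine Subtype.ext (funext fun j => ?_)
  rw [idemElt_apply, incl_apply]
  split_ifs with h
  · subst h
    rw [vtxIdem, tm_mul_tm, vtx_mul_self, ← mul_assoc, vtx_mul_self]
  · rw [← mul_assoc, B.vtx_mul_vtx_of_ne h, zero_mul, tm_zero_right]

lemma diff₁_idemElt (s : K) {i : Fin n} {d : ℕ} {a : LArrow n} (h : Valid n i a.src d) (y : L) :
    B.diff₁ s (idemElt K B.arrIdem_mul_self a (tm K (B.path i d a.src) y)) =
      idemElt K B.vtxIdem_mul_self a.tgt (tm K (B.path i (d + 1) a.tgt) y) -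
        s • idemElt K B.vtxIdem_mul_self a.src (tm K (B.path i d a.src) (B.arr a * y)) := by
  refine Subtype.ext (funext fun j => ?_)
  rw [diff₁, rowHom_idemElt _ _ _ (B.arrIdem_mul_mat₁ s)]
  change _ = (idemElt K B.vtxIdem_mul_self a.tgt (tm K (B.path i (d + 1) a.tgt) y) :
    Fin n → EnvAlg K L) j - s • (idemElt K B.vtxIdem_mul_self a.src
      (tm K (B.path i d a.src) (B.arr a * y)) : Fin n → EnvAlg K L) j
  rw [idemElt_apply, idemElt_apply, mat₁, mul_sub]
  congr 1
  · simp only [eq_comm (a := j)]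
    split_ifs with hj
    · rw [vtxIdem, tm_mul_tm, tm_mul_tm, B.path_mul_arr h, path_mul_vtx]
    · rw [mul_zero]
  · simp only [eq_comm (a := j)]
    split_ifs with hj
    · rw [vtxIdem, mul_smul_comm, tm_mul_tm, tm_mul_tm, ← mul_assoc, vtx_mul_arr]
    · rw [mul_zero, smul_zero]

/-- Modulo the image of the first differential, the last arrow of the left factor moves over to the
right factor at the cost of s. Repeating this leaves a vertex on the left. -/
lemma idemElt_path_mem (s : K) (d : ℕ) (i k : Fin n) (h : Valid n i k d) (y : L) :
    idemElt K B.vtxIdem_mul_self k (tm K (B.path i d k) y) ∈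
      LinearMap.range ((B.diff₁ s).restrictScalars K) ⊔ LinearMap.range B.incl := by
  induction d generalizing k y with
  | zero =>
    obtain rfl := valid_self_zero_iff.1 h
    exact Submodule.mem_sup_right ⟨_, (B.idemElt_path_zero i y).symm⟩
  | succ d ih =>
    obtain ⟨a, rfl, ha⟩ := exists_tgt_of_valid h
    rw [← sub_add_cancel (idemElt K B.vtxIdem_mul_self a.tgt (tm K (B.path i (d + 1) a.tgt) y)),
      ← B.diff₁_idemElt s ha]
    exact add_mem (Submodule.mem_sup_left ⟨_, rfl⟩) (Submodule.smul_mem _ _ (ih _ ha _))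

lemma range_diff₁_sup (s : K) :
    LinearMap.range ((B.diff₁ s).restrictScalars K) ⊔ LinearMap.range B.incl = ⊤ := by
  refine eq_top_iff.2 fun f _ => ?_
  set S := LinearMap.range ((B.diff₁ s).restrictScalars K) ⊔ LinearMap.range B.incl
  rw [← sum_idemElt (K := K) B.vtxIdem_mul_self f]
  refine sum_mem fun k _ => ?_
  have hS : Submodule.span K (Set.range B.envBasis) ≤
      S.comap (idemElt K B.vtxIdem_mul_self k) := by
    refine Submodule.span_le.2 ?_
    rintro _ ⟨x, rfl⟩
    change idemElt K B.vtxIdem_mul_self k (B.envBasis x) ∈ S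
    rw [envBasis_apply]
    by_cases hj : x.1.1.2.2 = k
    · rw [← hj]
      exact B.idemElt_path_mem s _ _ _ x.1.2 _
    · convert zero_mem S
      refine Subtype.ext (funext fun l => ?_)
      rw [idemElt_apply, vtxIdem, tm_mul_tm, B.path_mul_vtx_of_ne hj, tm_zero_left, ite_self]
      rfl
  rw [B.envBasis.span_eq] at hS
  exact hS trivial

lemma finrank_le_diff₁ (s : K) : Module.finrank K (idemRows B.vtxIdem) ≤
    rankOver K (B.diff₁ s) + Module.finrank K L := by
  have := B.module_finite
  have := B.finite_idemRows B.vtxIdem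
  exact finrank_le_of_range_sup _ _ (B.range_diff₁_sup s)

/-- The coefficients of the elements of the enveloping algebra. -/
def coef₂ (i : Fin n) (d : ℕ) (j k : Fin n) (e : ℕ) (l : Fin n) : EnvAlg K L →ₗ[K] K :=
  LinearMap.mul' K K ∘ₗ TensorProduct.map (B.coef i d j)
    (B.coef k e l ∘ₗ (MulOpposite.opLinearEquiv K).symm.toLinearMap)

lemma coef₂_tm (i : Fin n) (d : ℕ) (j k : Fin n) (e : ℕ) (l : Fin n) (x y : L) :
    B.coef₂ i d j k e l (tm K x y) = B.coef i d j x * B.coef k e l y := rfl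

lemma env_ext {V : Type*} [AddCommGroup V] [Module K V] {f g : EnvAlg K L →ₗ[K] V}
    (h : ∀ x y, f (tm K x y) = g (tm K x y)) : f = g :=
  TensorProduct.ext' fun x y => h x (MulOpposite.unop y)

lemma eq_zero_of_coef₂ {z : EnvAlg K L} (h : ∀ (i : Fin n) (d : ℕ) (j k : Fin n) (e : ℕ)
    (l : Fin n), Valid n i j d → Valid n k l e → B.coef₂ i d j k e l z = 0) : z = 0 := by
  refine B.envBasis.ext_elem fun x => ?_
  have hx : B.coef₂ x.1.1.1 x.1.1.2.1 x.1.1.2.2 x.2.1.1 x.2.1.2.1 x.2.1.2.2 =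
      B.envBasis.coord x := by
    refine B.envBasis.ext fun y => ?_
    rw [envBasis_apply, coef₂_tm, B.coef_path y.1.2, B.coef_path y.2.2, ← envBasis_apply,
      Module.Basis.coord_apply, Module.Basis.repr_self, Finsupp.single_apply, ite_zero_mul_ite_zero,
      mul_one]
    congr 1
    rw [Prod.ext_iff, Subtype.ext_iff, Subtype.ext_iff, Prod.ext_iff, Prod.ext_iff, Prod.ext_iff,
      Prod.ext_iff, Fin.ext_iff (a := y.1.1.2.1), Fin.ext_iff (a := y.2.1.2.1)]
  rw [map_zero, Finsupp.zero_apply, ← Module.Basis.coord_apply, ← hx]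
  exact h _ _ _ _ _ _ x.1.2 x.2.2

lemma coef_mul_vtx (i j : Fin n) (d : ℕ) (x : L) :
    B.coef i d j (x * B.vtx j) = B.coef i d j x := by
  have : (B.coef i d j).comp (LinearMap.mulRight K (B.vtx j)) = B.coef i d j := by
    refine B.hom_ext fun i' d' j' h => ?_
    rw [LinearMap.comp_apply, LinearMap.mulRight_apply]
    by_cases hi : j' = j
    · subst hi; rw [path_mul_vtx]
    · rw [B.path_mul_vtx_of_ne hi, map_zero, B.coef_path h, if_neg (by tauto)]
  exact LinearMap.congr_fun this x

lemma coef_mul_vtx_of_ne {i j k : Fin n} (hjk : j ≠ k) (d : ℕ) (x : L) :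
    B.coef i d j (x * B.vtx k) = 0 := by
  have : (B.coef i d j).comp (LinearMap.mulRight K (B.vtx k)) = 0 := by
    refine B.hom_ext fun i' d' j' h => ?_
    rw [LinearMap.comp_apply, LinearMap.mulRight_apply, LinearMap.zero_apply]
    by_cases hi : j' = k
    · subst hi; rw [path_mul_vtx, B.coef_path h, if_neg (by tauto)]
    · rw [B.path_mul_vtx_of_ne hi, map_zero]
  exact LinearMap.congr_fun this x

lemma coef_vtx_mul_of_ne {i j k : Fin n} (hik : i ≠ k) (d : ℕ) (x : L) :
    B.coef i d j (B.vtx k * x) = 0 := by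
  have : (B.coef i d j).comp (LinearMap.mulLeft K (B.vtx k)) = 0 := by
    refine B.hom_ext fun i' d' j' h => ?_
    rw [LinearMap.comp_apply, LinearMap.mulLeft_apply, LinearMap.zero_apply]
    by_cases hi : k = i'
    · subst hi; rw [vtx_mul_path, B.coef_path h, if_neg (by tauto)]
    · rw [B.vtx_mul_path_of_ne hi, map_zero]
  exact LinearMap.congr_fun this x

lemma coef₂_mul_vtxIdem_of_ne {i j k l m : Fin n} (h : j ≠ m ∨ k ≠ m) (d e : ℕ) (z : EnvAlg K L) :
    B.coef₂ i d j k e l (z * B.vtxIdem m) = 0 := by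
  have : B.coef₂ i d j k e l ∘ₗ LinearMap.mulRight K (B.vtxIdem m) = 0 := by
    refine env_ext fun x y => ?_
    rw [LinearMap.comp_apply, LinearMap.mulRight_apply, vtxIdem, tm_mul_tm, coef₂_tm]
    rcases h with h | h
    · rw [B.coef_mul_vtx_of_ne h, zero_mul]; rfl
    · rw [B.coef_vtx_mul_of_ne h, mul_zero]; rfl
  exact LinearMap.congr_fun this z

lemma coef₂_mul_arr {i k l : Fin n} {d e : ℕ} {a : LArrow n} (hv : Valid n i a.tgt (d + 1))
    (z : EnvAlg K L) : B.coef₂ i (d + 1) a.tgt k e l (z * tm K (B.arr a) (B.vtx k)) =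
      B.coef₂ i d a.src k e l z := by
  have : B.coef₂ i (d + 1) a.tgt k e l ∘ₗ LinearMap.mulRight K (tm K (B.arr a) (B.vtx k)) =
      B.coef₂ i d a.src k e l := by
    refine env_ext fun x y => ?_
    rw [LinearMap.comp_apply, LinearMap.mulRight_apply, tm_mul_tm, coef₂_tm, coef₂_tm,
      B.coef_mul_arr hv, coef_vtx_mul]
  exact LinearMap.congr_fun this z

lemma coef₂_arr_mul_zero {i j k l m : Fin n} {d : ℕ} {a : LArrow n} (z : EnvAlg K L) :
    B.coef₂ i d j k 0 l (z * tm K (B.vtx m) (B.arr a)) = 0 := by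
  have : B.coef₂ i d j k 0 l ∘ₗ LinearMap.mulRight K (tm K (B.vtx m) (B.arr a)) = 0 := by
    refine env_ext fun x y => ?_
    rw [LinearMap.comp_apply, LinearMap.mulRight_apply, tm_mul_tm, coef₂_tm,
      B.coef_arr_mul_zero, mul_zero]
    rfl
  exact LinearMap.congr_fun this z

lemma coef₂_arr_mul {i j l : Fin n} {d e : ℕ} {a : LArrow n} (hv : Valid n a.src l (e + 1))
    (z : EnvAlg K L) : B.coef₂ i d j a.src (e + 1) l (z * tm K (B.vtx j) (B.arr a)) =
      B.coef₂ i d j a.tgt e l z := by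
  have : B.coef₂ i d j a.src (e + 1) l ∘ₗ LinearMap.mulRight K (tm K (B.vtx j) (B.arr a)) =
      B.coef₂ i d j a.tgt e l := by
    refine env_ext fun x y => ?_
    rw [LinearMap.comp_apply, LinearMap.mulRight_apply, tm_mul_tm, coef₂_tm, coef₂_tm,
      B.coef_arr_mul hv, coef_mul_vtx]
  exact LinearMap.congr_fun this z

lemma exists_arrow_valid {i k : Fin n} {d : ℕ} (h : Valid n i k d)
    (h' : ¬ (i = k ∧ d = 2 * n - 1)) : ∃ b : LArrow n, b.src = k ∧ Valid n i b.tgt (d + 1) := by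
  have hi := i.2
  have hk := k.2
  rw [Fin.ext_iff] at h'
  by_cases h1 : Valid n i (left k).tgt (d + 1)
  · exact ⟨_, src_left k, h1⟩
  · rw [tgt_left] at h1
    have hk' : (k : ℕ) < n - 1 := by unfold Valid at h h1; omega
    refine ⟨up ⟨k, hk'⟩, rfl, ?_⟩
    rw [tgt_up]
    unfold Valid at h h1 ⊢
    dsimp only
    omega

lemma sg_ne_zero (a : LArrow n) : sg K a ≠ 0 := by
  rcases a with _ | i | i <;> simp [sg, sgn]

lemma diff₂_apply (s : K) (w : idemRows B.vtxIdem) (a : LArrow n) :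
    (B.diff₂ s w : LArrow n → EnvAlg K L) a =
      sg K a.bar • ((w : Fin n → EnvAlg K L) a.tgt * tm K (B.arr a.bar) (B.vtx a.tgt)) +
        (s * sg K a) • ((w : Fin n → EnvAlg K L) a.src * tm K (B.vtx a.src) (B.arr a.bar)) := by
  rw [diff₂, rowHom_apply]
  simp_rw [mat₂, mul_add, Finset.sum_add_distrib, mul_ite, mul_zero, mul_smul_comm]
  rw [Finset.sum_ite_eq, Finset.sum_ite_eq, if_pos (Finset.mem_univ _), if_pos (Finset.mem_univ _)]

/-- The coefficients which determine the elements of the kernel of the second differential. -/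
def socleCoef (B : PathBasis K n L) : idemRows B.vtxIdem →ₗ[K] PathIdx n → K :=
  LinearMap.pi fun x => B.coef₂ x.1.1 (2 * n - 1) x.1.1 x.1.1 x.1.2.1 x.1.2.2 ∘ₗ
    LinearMap.proj x.1.1 ∘ₗ (idemRows B.vtxIdem).subtype.restrictScalars K

/-- Induction on the length e of the right factor. If the left factor is not a longest path, extend
it by an arrow b: one coefficient of the image relates the pair of lengths (d, e) to the pair (d +
1, e - 1), already treated, or to nothing if e = 0. The longest left factors are covered by the
assumption on `socleCoef`. -/
lemma eq_zero_of_diff₂ (s : K) {w : idemRows B.vtxIdem} (hw : B.diff₂ s w = 0)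
    (h : B.socleCoef w = 0) : w = 0 := by
  have key (e : ℕ) : ∀ (i : Fin n) (d : ℕ) (k j : Fin n), Valid n i k d → Valid n k j e →
      B.coef₂ i d k k e j ((w : Fin n → EnvAlg K L) k) = 0 := by
    induction e with
    | zero =>
      intro i d k j hl hr
      by_cases hs : i = k ∧ d = 2 * n - 1
      · obtain ⟨rfl, rfl⟩ := hs
        exact congrFun h ⟨(i, ⟨0, lt_two_mul_of_valid hr⟩, j), hr⟩
      · obtain ⟨b, rfl, hb⟩ := exists_arrow_valid hl hs
        -- The component at b̄ is taken because the second differential multiplies by the opposite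
        -- of the arrow that indexes the component.
        have h1 := congrFun (congrArg Subtype.val hw) b.bar
        rw [diff₂_apply, bar_bar, src_bar, tgt_bar] at h1
        have h2 := congrArg (B.coef₂ i (d + 1) b.tgt b.src 0 j) h1
        rw [map_add, map_smul, map_smul, B.coef₂_mul_arr hb, coef₂_arr_mul_zero, smul_zero,
          add_zero] at h2
        exact (smul_eq_zero.1 (h2.trans (map_zero _))).resolve_left (sg_ne_zero _)
    | succ e ih =>
      intro i d k j hl hr
      by_cases hs : i = k ∧ d = 2 * n - 1
      · obtain ⟨rfl, rfl⟩ := hs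
        exact congrFun h ⟨(i, ⟨e + 1, lt_two_mul_of_valid hr⟩, j), hr⟩
      · obtain ⟨b, rfl, hb⟩ := exists_arrow_valid hl hs
        have h1 := congrFun (congrArg Subtype.val hw) b.bar
        rw [diff₂_apply, bar_bar, src_bar, tgt_bar] at h1
        have h2 := congrArg (B.coef₂ i (d + 1) b.tgt b.src (e + 1) j) h1
        have h3 : B.coef₂ i (d + 1) b.tgt b.tgt e j ((w : Fin n → EnvAlg K L) b.tgt) = 0 := by
          by_cases hv : Valid n b.tgt j e
          · exact ih _ _ _ _ hb hv
          · have hz : B.coef₂ i (d + 1) b.tgt b.tgt e j = 0 := by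
              refine env_ext fun x y => ?_
              rw [coef₂_tm, B.coef_of_not_valid hv, LinearMap.zero_apply, mul_zero]
              rfl
            rw [hz]; rfl
        rw [map_add, map_smul, map_smul, B.coef₂_mul_arr hb, B.coef₂_arr_mul hr, h3, smul_zero,
          add_zero] at h2
        exact (smul_eq_zero.1 (h2.trans (map_zero _))).resolve_left (sg_ne_zero _)
  refine Subtype.ext (funext fun m => B.eq_zero_of_coef₂ fun i d j k e l hl hr => ?_)
  by_cases hm : j = m ∧ k = m
  · obtain ⟨rfl, rfl⟩ := hm
    exact key e i d _ l hl hr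
  · rw [← w.2 m]
    exact B.coef₂_mul_vtxIdem_of_ne (by tauto) d e _

lemma finrank_le_diff₂ (s : K) : Module.finrank K (idemRows B.vtxIdem) ≤
    rankOver K (B.diff₂ s) + Module.finrank K L := by
  have := B.finite_idemRows B.vtxIdem
  rw [Module.finrank_eq_card_basis B.basis, ← Module.finrank_fintype_fun_eq_card K]
  exact finrank_le_of_injective_on_ker _ B.socleCoef fun w => B.eq_zero_of_diff₂ s

/-- The contraction of the first factor with a coefficient. -/
def contract (i : Fin n) (d : ℕ) (j : Fin n) : EnvAlg K L →ₗ[K] L :=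
  TensorProduct.lid K L ∘ₗ TensorProduct.map (B.coef i d j)
    (MulOpposite.opLinearEquiv K).symm.toLinearMap

lemma contract_tm (i : Fin n) (d : ℕ) (j : Fin n) (x y : L) :
    B.contract i d j (tm K x y) = B.coef i d j x • y := rfl

lemma sum_vtx_mul (y : L) : ∑ i, B.vtx i * y = y := by
  rw [← Finset.sum_mul]
  exact (congrArg (· * y) B.sum_path_zero).trans (one_mul y)

/-- The longest path at i occurs as a left factor only for j = i and d = 2n - 1, and there the right
factor of the Casimir element is the vertex i. So y can be recovered, up to signs and powers of s,
from the image of `B.incl y`. -/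
lemma contract_diff₃ {s : K} (y : L) (i : Fin n) : B.contract i (2 * n - 1) i
    ((B.diff₃ s (B.incl y) : Fin n → EnvAlg K L) i) =
      ((-1 : K) ^ (i : ℕ) * (-s) ^ (2 * n - 1)) • (B.vtx i * y) := by
  have hn := NeZero.pos n
  rw [diff₃, rowHom_apply, map_sum, Finset.sum_eq_single i]
  · rw [incl_apply, mat₃, mul_smul_comm, map_smul, Finset.mul_sum, map_sum,
      Finset.sum_eq_single (2 * n - 1), mul_smul]
    · rw [mul_smul_comm, map_smul, tm_mul_tm, contract_tm, vtx_mul_path,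
        B.coef_path_self (valid_last i), one_smul, Nat.sub_self, ← mul_assoc, path_mul_vtx]
      rfl
    · intro d _ hd
      rw [mul_smul_comm, map_smul, tm_mul_tm, contract_tm, vtx_mul_path]
      by_cases hv : Valid n i i d
      · rw [B.coef_path hv, if_neg (by tauto), zero_smul, smul_zero]
      · rw [B.path_of_not_valid hv, map_zero, zero_smul, smul_zero]
    · intro h
      exact absurd (Finset.mem_range.2 (by omega)) h
  · intro j _ hj
    rw [incl_apply, mat₃, mul_smul_comm, map_smul, Finset.mul_sum, map_sum, Finset.sum_eq_zero,
      smul_zero]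
    intro d _
    rw [mul_smul_comm, map_smul, tm_mul_tm, contract_tm, vtx_mul_path]
    by_cases hv : Valid n j i d
    · rw [B.coef_path hv, if_neg (by tauto), zero_smul, smul_zero]
    · rw [B.path_of_not_valid hv, map_zero, zero_smul, smul_zero]
  · simp

lemma finrank_le_diff₃ {s : K} (hs : s * s = 1) :
    Module.finrank K L ≤ rankOver K (B.diff₃ s) := by
  have := B.finite_idemRows B.vtxIdem
  have hs0 : s ≠ 0 := by rintro rfl; simp at hs
  refine finrank_le_rankOver _ B.incl fun y hy => ?_
  rw [← B.sum_vtx_mul y]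
  refine Finset.sum_eq_zero fun i _ => ?_
  have h := B.contract_diff₃ (s := s) y i
  rw [hy] at h
  refine (smul_eq_zero.1 (h.symm.trans (map_zero _))).resolve_left ?_
  exact mul_ne_zero (pow_ne_zero _ (by simp)) (pow_ne_zero _ (by simpa using hs0))

end PathBasis

/-! ### The bimodule resolution -/

namespace PathBasis

open LArrow

variable {K : Type u} [Field K] {n : ℕ} [NeZero n] {L : Type u} [Ring L] [Algebra K L]
  (B : PathBasis K n L)

lemma finrank_idemRows_vtxIdem :
    Module.finrank K (idemRows B.vtxIdem) = ∑ j : Fin n, cnt n j * cnt n j :=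
  B.finrank_idemRows (p := id) (q := id) fun _ => rfl

lemma finrank_idemRows_arrIdem :
    Module.finrank K (idemRows B.arrIdem) = ∑ a : LArrow n, cnt n a.src * cnt n a.tgt :=
  B.finrank_idemRows (p := LArrow.src) (q := LArrow.tgt) fun _ => rfl

lemma finrank_idemRows_add : Module.finrank K (idemRows B.arrIdem) + 2 * Module.finrank K L =
    2 * Module.finrank K (idemRows B.vtxIdem) := by
  rw [finrank_idemRows_arrIdem, finrank_idemRows_vtxIdem, B.finrank_eq, sum_cnt_arrow]

/-- The ranks of the two maps are each at least dim P₀ - dim Λ, and these bounds add up to dim P₁ by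
the balance of dimensions. -/
lemma range_diff₂ (s : K) : LinearMap.range (B.diff₂ s) = LinearMap.ker (B.diff₁ s) := by
  have := B.finite_idemRows B.arrIdem
  refine range_eq_ker_of_rankOver (K := K) _ _ (fun x => ?_) ?_
  · exact rowHom_comp_apply _ _ _ _ B.mat₂_mul_mat₁ x
  · have h1 := B.finrank_le_diff₁ s
    have h2 := B.finrank_le_diff₂ s
    have h3 := B.finrank_idemRows_add
    omega

lemma range_diff₃ {s : K} (hs : s * s = 1) :
    LinearMap.range (B.diff₃ s) = LinearMap.ker (B.diff₂ s) := by
  have := B.finite_idemRows B.vtxIdem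
  refine range_eq_ker_of_rankOver (K := K) _ _ (fun x => ?_) ?_
  · exact rowHom_comp_apply _ _ _ _ (B.mat₃_mul_mat₂ hs) x
  · have h1 := B.finrank_le_diff₃ hs
    have h2 := B.finrank_le_diff₂ s
    omega

lemma range_diff₁ {s : K} (hs : s * s = 1) :
    LinearMap.range (B.diff₁ (-s)) = LinearMap.ker (B.diff₃ s) := by
  have := B.finite_idemRows B.vtxIdem
  refine range_eq_ker_of_rankOver (K := K) _ _ (fun x => ?_) ?_
  · exact rowHom_comp_apply _ _ _ _ (B.mat₁_mul_mat₃ hs) x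
  · have h1 := B.finrank_le_diff₃ hs
    have h2 := B.finrank_le_diff₁ (-s)
    omega

/-- The augmentation of the resolution. -/
def aug : idemRows B.vtxIdem →ₗ[EnvAlg K L] envSelf K L where
  toFun f := ∑ i, (f : Fin n → EnvAlg K L) i • (envSelfEquiv.symm (B.vtx i) : envSelf K L)
  map_add' f g := by
    rw [← Finset.sum_add_distrib]
    exact Finset.sum_congr rfl fun i _ => add_smul _ _ _
  map_smul' r f := by
    rw [RingHom.id_apply, Finset.smul_sum]
    exact Finset.sum_congr rfl fun i _ => mul_smul _ _ _

lemma aug_apply (f : idemRows B.vtxIdem) : envSelfEquiv (B.aug f) =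
    ∑ i, envAct ((f : Fin n → EnvAlg K L) i) (B.vtx i) := by
  change envSelfEquiv (∑ i, (f : Fin n → EnvAlg K L) i •
    (envSelfEquiv.symm (B.vtx i) : envSelf K L)) = _
  rw [map_sum]
  refine Finset.sum_congr rfl fun i _ => ?_
  rw [envSelfEquiv_smul_eq, LinearEquiv.apply_symm_apply]

lemma aug_incl (y : L) : envSelfEquiv (B.aug (B.incl y)) = y := by
  rw [aug_apply]
  conv_rhs => rw [← B.sum_vtx_mul y]
  refine Finset.sum_congr rfl fun i _ => ?_
  rw [incl_apply, envAct_tm, vtx_mul_self, ← mul_assoc, vtx_mul_self]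

lemma sum_mat₁_vtx (a : LArrow n) : ∑ i, envAct (B.mat₁ 1 a i) (B.vtx i) = 0 := by
  have h (i : Fin n) : envAct (B.mat₁ 1 a i) (B.vtx i) =
      (if a.tgt = i then B.arr a else 0) - if a.src = i then B.arr a else 0 := by
    rw [mat₁, map_sub, LinearMap.sub_apply]
    congr 1
    · split_ifs with hi
      · rw [envAct_tm, ← hi, arr_mul_vtx, arr_mul_vtx]
      · rw [map_zero, LinearMap.zero_apply]
    · split_ifs with hi
      · rw [one_smul, envAct_tm, ← hi, vtx_mul_self, vtx_mul_arr]
      · rw [map_zero, LinearMap.zero_apply]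
  simp_rw [h]
  rw [Finset.sum_sub_distrib, Finset.sum_ite_eq, Finset.sum_ite_eq, if_pos (Finset.mem_univ _),
    if_pos (Finset.mem_univ _), sub_self]

lemma aug_diff₁ (f : idemRows B.arrIdem) : B.aug (B.diff₁ 1 f) = 0 := by
  refine envSelfEquiv.injective ?_
  rw [aug_apply, map_zero]
  simp_rw [diff₁, rowHom_apply, map_sum, LinearMap.sum_apply]
  rw [Finset.sum_comm]
  refine Finset.sum_eq_zero fun a _ => ?_
  simp_rw [envAct_mul]
  rw [← map_sum, B.sum_mat₁_vtx, map_zero]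

/-- Every element is a boundary plus some `B.incl y`, and the augmentation maps this sum to y. So y
= 0 on the kernel. -/
lemma range_diff₁_one : LinearMap.range (B.diff₁ 1) = LinearMap.ker B.aug := by
  refine le_antisymm ?_ fun f hf => ?_
  · rintro _ ⟨f, rfl⟩
    exact B.aug_diff₁ f
  · have h : f ∈ LinearMap.range ((B.diff₁ 1).restrictScalars K) ⊔ LinearMap.range B.incl := by
      rw [B.range_diff₁_sup]; trivial
    obtain ⟨_, ⟨g, rfl⟩, _, ⟨y, rfl⟩, rfl⟩ := Submodule.mem_sup.1 h
    have h1 : B.aug (B.diff₁ 1 g) + B.aug (B.incl y) = 0 := by rw [← map_add]; exact hf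
    rw [aug_diff₁, zero_add] at h1
    have h2 := B.aug_incl y
    rw [h1, map_zero] at h2
    refine ⟨g, ?_⟩
    rw [← h2, map_zero, add_zero]
    rfl

/-- The terms of the resolution. -/
def resX : ℕ → ModuleCat.{u} (EnvAlg K L)
  | 0 => ModuleCat.of _ (idemRows B.vtxIdem)
  | 1 => ModuleCat.of _ (idemRows B.arrIdem)
  | 2 => ModuleCat.of _ (idemRows B.vtxIdem)
  | m + 3 => resX m

/-- The differentials of the resolution. -/
def resD : K → ∀ m, B.resX (m + 1) ⟶ B.resX m
  | s, 0 => ModuleCat.ofHom (B.diff₁ s)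
  | s, 1 => ModuleCat.ofHom (B.diff₂ s)
  | s, 2 => ModuleCat.ofHom (B.diff₃ s)
  -- After three steps the same maps return with the opposite sign.
  | s, m + 3 => resD (-s) m

lemma resD_exact : ∀ (s : K) (_ : s * s = 1) (m : ℕ),
    LinearMap.range (B.resD s (m + 1)).hom = LinearMap.ker (B.resD s m).hom
  | s, _, 0 => B.range_diff₂ s
  | _, hs, 1 => B.range_diff₃ hs
  | _, hs, 2 => B.range_diff₁ hs
  | s, hs, m + 3 => resD_exact (-s) (by rwa [neg_mul_neg]) m

lemma projective_resX : ∀ m, Projective (B.resX m)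
  | 0 => (IsProjective.iff_projective _).1 (projective_idemRows B.vtxIdem_mul_self)
  | 1 => (IsProjective.iff_projective _).1 (projective_idemRows B.arrIdem_mul_self)
  | 2 => (IsProjective.iff_projective _).1 (projective_idemRows B.vtxIdem_mul_self)
  | m + 3 => projective_resX m

/-- The periodic bimodule resolution. -/
def resolution : ExactResolution (envSelf K L) where
  X := B.resX
  d := B.resD 1
  π := @ModuleCat.ofHom (EnvAlg K L) _ (idemRows B.vtxIdem) (envSelf K L) _ _ _ _ B.aug
  projective := B.projective_resX
  exact := B.resD_exact 1 (one_mul 1)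
  exact_zero := B.range_diff₁_one
  surjective y := ⟨B.incl (envSelfEquiv y), envSelfEquiv.injective (B.aug_incl _)⟩

lemma finite_resX_hom : ∀ m, Module.Finite K (B.resX m ⟶ envSelf K L)
  | 0 => have := B.module_finite; finite_hom_envSelf B.vtxIdem_mul_self
  | 1 => have := B.module_finite; finite_hom_envSelf B.arrIdem_mul_self
  | 2 => have := B.module_finite; finite_hom_envSelf B.vtxIdem_mul_self
  | m + 3 => finite_resX_hom m

end PathBasis

/-! ### Ranks of the differentials on the Hochschild cochains -/

section Linear

variable {K : Type u} [Field K] {V W : Type*} [AddCommGroup V] [Module K V] [AddCommGroup W]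
  [Module K W]

lemma finrank_map_add_finrank_inf_ker [Module.Finite K V] (p : Submodule K V) (f : V →ₗ[K] W) :
    Module.finrank K (p.map f) + Module.finrank K (p ⊓ LinearMap.ker f : Submodule K V) =
      Module.finrank K p := by
  have h := (f.domRestrict p).finrank_range_add_finrank_ker
  rw [LinearMap.range_domRestrict, LinearMap.ker_domRestrict] at h
  rw [← h, ← Submodule.map_comap_subtype, Submodule.finrank_map_subtype_eq]

/-- Here f reads off coordinates, which are injective on p, and g rebuilds an element of p from
them. Only f ∘ g has to be computed. -/
lemma finrank_eq_of_coordinates [Module.Finite K V] [Module.Finite K W] (p : Submodule K V)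
    (f : V →ₗ[K] W) (g : W →ₗ[K] V)
    (hf : ∀ v ∈ p, f v = 0 → v = 0) (hg : ∀ w, g w ∈ p) (hfg : ∀ w, f (g w) = w) :
    Module.finrank K p = Module.finrank K W := by
  refine le_antisymm ?_ ?_
  · refine LinearMap.finrank_le_finrank_of_injective (f := f.domRestrict p) ?_
    rw [injective_iff_map_eq_zero]
    exact fun v hv => Subtype.ext (hf v v.2 hv)
  · rw [← LinearMap.finrank_range_of_inj (f := g) (Function.LeftInverse.injective hfg)]
    refine Submodule.finrank_mono ?_
    rintro _ ⟨w, rfl⟩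
    exact hg w

variable {L : Type u} [Ring L] [Algebra K L] {I J : Type} [Fintype I] [DecidableEq I] [Fintype J]
  [DecidableEq J]

/-- The matrix absorbs the idempotents, so projecting a column to `idemCols` first does not change
its image. Ranks may thus be computed on all columns. -/
lemma map_idemCols_eq_range {ε : J → EnvAlg K L} (hε : ∀ i, ε i * ε i = ε i)
    (M : Matrix I J (EnvAlg K L)) (hM : ∀ i j, M i j * ε j = M i j) :
    (idemCols ε).map (colMap M) = LinearMap.range (colMap M) := by
  refine le_antisymm (LinearMap.map_le_range) ?_
  rintro _ ⟨g, rfl⟩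
  refine ⟨fun j => envAct (ε j) (g j), fun j => ?_, funext fun i => ?_⟩
  · rw [← envAct_mul, hε]
  · rw [colMap_apply, colMap_apply]
    refine Finset.sum_congr rfl fun j _ => ?_
    rw [← envAct_mul, hM]

namespace SymmForm

variable (F : SymmForm K L)

/-- The bilinear form on columns, as a map to the dual space. -/
def colForm (I : Type) [Fintype I] : (I → L) →ₗ[K] Module.Dual K (I → L) :=
  ∑ i, (LinearMap.proj (R := K) (φ := fun _ : I => L) i).dualMap ∘ₗ F.form ∘ₗ LinearMap.proj i

lemma colForm_apply (w v : I → L) : F.colForm I w v = ∑ i, F.τ (v i * w i) := by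
  simp [colForm, form_apply]

lemma colForm_injective : Function.Injective (F.colForm I) := by
  rw [injective_iff_map_eq_zero]
  intro w hw
  refine funext fun i => F.nondegenerate _ fun y => ?_
  have h := LinearMap.congr_fun hw (Pi.single i y)
  rw [colForm_apply, Finset.sum_eq_single i] at h
  · rwa [Pi.single_eq_same] at h
  · intro j _ hj
    rw [Pi.single_eq_of_ne hj, zero_mul, map_zero]
  · simp

lemma colForm_surjective [Module.Finite K L] : Function.Surjective (F.colForm I) :=
  (LinearMap.injective_iff_surjective_of_finrank_eq_finrank Subspace.dual_finrank_eq.symm).1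
    F.colForm_injective

lemma finrank_range_eq_of_adjoint [Module.Finite K L] (f : (I → L) →ₗ[K] (J → L))
    (f' : (J → L) →ₗ[K] (I → L))
    (h : ∀ v w, ∑ j, F.τ (f v j * w j) = ∑ i, F.τ (v i * f' w i)) :
    Module.finrank K (LinearMap.range f) = Module.finrank K (LinearMap.range f') := by
  have h1 : f.dualMap ∘ₗ F.colForm J = F.colForm I ∘ₗ f' := by
    refine LinearMap.ext fun w => LinearMap.ext fun v => ?_
    rw [LinearMap.comp_apply, LinearMap.comp_apply, LinearMap.dualMap_apply, colForm_apply,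
      colForm_apply, h]
  have h2 : LinearMap.range f.dualMap = (LinearMap.range f').map (F.colForm I) := by
    rw [← LinearMap.range_comp, ← h1, LinearMap.range_comp_of_range_eq_top]
    exact LinearMap.range_eq_top.2 F.colForm_surjective
  rw [← LinearMap.finrank_range_dualMap_eq_finrank_range, h2]
  exact LinearEquiv.finrank_eq (Submodule.equivMapOfInjective _ F.colForm_injective _).symm

end SymmForm

end Linear

namespace PathBasis

open LArrow

variable {K : Type u} [Field K] {n : ℕ} [NeZero n] {L : Type u} [Ring L] [Algebra K L]
  (B : PathBasis K n L)

lemma finrank_idemCols_add : Module.finrank K (idemCols B.arrIdem) + 2 * n =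
    2 * Module.finrank K (idemCols B.vtxIdem) := by
  rw [B.finrank_idemCols (ε := B.arrIdem) (p := LArrow.src) (q := LArrow.tgt) fun _ => rfl,
    B.finrank_idemCols (ε := B.vtxIdem) (p := id) (q := id) fun _ => rfl]
  exact sum_mult_arrow

lemma colMap_mat₁ (s : K) (g : Fin n → L) (a : LArrow n) : colMap (B.mat₁ s) g a =
    B.arr a * g a.tgt * B.vtx a.tgt - s • (B.vtx a.src * g a.src * B.arr a) := by
  have h (i : Fin n) : envAct (B.mat₁ s a i) (g i) =
      (if a.tgt = i then B.arr a * g a.tgt * B.vtx a.tgt else 0) -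
        if a.src = i then s • (B.vtx a.src * g a.src * B.arr a) else 0 := by
    rw [mat₁, map_sub, LinearMap.sub_apply]
    congr 1
    · split_ifs with hi
      · rw [envAct_tm, ← hi]
      · rw [map_zero, LinearMap.zero_apply]
    · split_ifs with hi
      · rw [map_smul, LinearMap.smul_apply, envAct_tm, ← hi]
      · rw [map_zero, LinearMap.zero_apply]
  rw [colMap_apply]
  simp_rw [h]
  rw [Finset.sum_sub_distrib, Finset.sum_ite_eq, Finset.sum_ite_eq, if_pos (Finset.mem_univ _),
    if_pos (Finset.mem_univ _)]

lemma coef_colMap_mat₁ (s : K) (g : Fin n → L) {a : LArrow n} {d : ℕ}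
    (h : Valid n a.src a.tgt (d + 1)) : B.coef a.src (d + 1) a.tgt (colMap (B.mat₁ s) g a) =
      B.coef a.tgt d a.tgt (g a.tgt) - s * B.coef a.src d a.src (g a.src) := by
  rw [colMap_mat₁, map_sub, map_smul, coef_mul_vtx, B.coef_arr_mul h, B.coef_mul_arr h,
    coef_vtx_mul, smul_eq_mul]

lemma eq_of_colMap_mat₁ {s : K} {g : Fin n → L} (hg : colMap (B.mat₁ s) g = 0) (a : LArrow n)
    {d : ℕ} (h : Valid n a.src a.tgt (d + 1)) :
    B.coef a.tgt d a.tgt (g a.tgt) = s * B.coef a.src d a.src (g a.src) := by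
  have h1 := B.coef_colMap_mat₁ s g h
  rw [hg, Pi.zero_apply, map_zero] at h1
  exact (sub_eq_zero.1 h1.symm)

/-- The equation for the arrow i → i + 1 equates, up to the factor s, the coefficients of the same
length at i and i + 1. Climbing the graph, an odd length below 2n - 1 eventually becomes too short
to be admissible, and the coefficient there is 0. -/
lemma coef_odd_eq_zero {s : K} (hs : s ≠ 0) {g : Fin n → L} (hg : colMap (B.mat₁ s) g = 0)
    (m : ℕ) : ∀ i : Fin n, 2 * i + 1 + 2 * m + 3 ≤ 2 * n →
      B.coef i (2 * i + 1 + 2 * m) i (g i) = 0 := by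
  induction m with
  | zero =>
    intro i hi
    have h := B.eq_of_colMap_mat₁ hg (up ⟨i, by omega⟩) (d := 2 * i + 1 + 2 * 0)
      (by rw [src_up, tgt_up]; dsimp only; unfold Valid; omega)
    -- The shortest odd closed path at i + 1 has length 2i + 3, which exceeds 2i + 1.
    rw [B.coef_of_not_valid (i := (up ⟨i, by omega⟩ : LArrow n).tgt)
      (by rw [tgt_up]; dsimp only; unfold Valid; omega)] at h
    exact (mul_eq_zero.1 h.symm).resolve_left hs
  | succ m ih =>
    intro i hi
    have h := B.eq_of_colMap_mat₁ hg (up ⟨i, by omega⟩) (d := 2 * i + 1 + 2 * (m + 1))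
      (by rw [src_up, tgt_up]; dsimp only; unfold Valid; omega)
    have h' := ih (up ⟨i, by omega⟩ : LArrow n).tgt (by rw [tgt_up]; dsimp only; omega)
    rw [tgt_up] at h'
    rw [show 2 * (i : ℕ) + 1 + 2 * (m + 1) = 2 * (i + 1) + 1 + 2 * m by ring] at h ⊢
    rw [h'] at h
    exact (mul_eq_zero.1 h.symm).resolve_left hs

lemma eq_zero_of_mem_idemCols {g : Fin n → L} (hg : g ∈ idemCols B.vtxIdem)
    (h : ∀ (i : Fin n) (d : ℕ), B.coef i d i (g i) = 0) : g = 0 := by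
  refine funext fun i => B.ext_coef fun i' d j hv => ?_
  rw [Pi.zero_apply, map_zero]
  have h1 : B.vtx i * g i * B.vtx i = g i := (envAct_tm _ _ _).symm.trans (hg i)
  by_cases hj : j = i
  · subst hj
    by_cases hi : i' = j
    · subst hi; exact h _ _
    · rw [← h1, mul_assoc, B.coef_vtx_mul_of_ne hi]
  · rw [← h1, B.coef_mul_vtx_of_ne hj]

/-- Along the arrows k → k + 1 each coefficient below the top length is determined by the one at
vertex 0. There the odd ones vanish by `coef_odd_eq_zero`, which leaves the even ones and the
longest closed paths. -/
lemma eq_zero_of_colMap_mat₁ {s : K} (hs : s ≠ 0) {g : Fin n → L}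
    (hg : g ∈ idemCols B.vtxIdem ⊓ LinearMap.ker (colMap (B.mat₁ s)))
    (h0 : ∀ e : ℕ, e < n → B.coef 0 (2 * e) 0 (g 0) = 0)
    (h1 : ∀ i, B.coef i (2 * n - 1) i (g i) = 0) : g = 0 := by
  have hk : colMap (B.mat₁ s) g = 0 := hg.2
  have key (k : ℕ) : ∀ (hk : k < n) (d : ℕ), B.coef ⟨k, hk⟩ d ⟨k, hk⟩ (g ⟨k, hk⟩) = 0 := by
    induction k with
    | zero =>
      intro hn d
      by_cases hv : Valid n 0 0 d
      · by_cases hd : d = 2 * n - 1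
        · subst hd; exact h1 _
        · have := lt_two_mul_of_valid hv
          obtain ⟨e, rfl | rfl⟩ := Nat.even_or_odd' d
          · exact h0 e (by omega)
          · have := B.coef_odd_eq_zero hs hk e ⟨0, hn⟩ (by dsimp only; omega)
            dsimp only at this
            rwa [show 2 * 0 + 1 + 2 * e = 2 * e + 1 by ring] at this
      · rw [B.coef_of_not_valid hv, LinearMap.zero_apply]
    | succ k ih =>
      intro hn d
      by_cases hv : Valid n (k + 1) (k + 1) d
      · by_cases hd : d = 2 * n - 1
        · subst hd; exact h1 _
        · refine (B.eq_of_colMap_mat₁ hk (up ⟨k, by omega⟩) (d := d) ?_).trans ?_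
          · rw [src_up, tgt_up]
            dsimp only
            unfold Valid at hv ⊢
            omega
          · exact mul_eq_zero_of_right _ (ih (by omega) d)
      · rw [B.coef_of_not_valid hv, LinearMap.zero_apply]
  exact B.eq_zero_of_mem_idemCols hg.1 fun i d => key i i.2 d

/-- The columns of multiples of the longest paths. -/
def socCol : (Fin n → K) →ₗ[K] (Fin n → L) :=
  LinearMap.pi fun i => (LinearMap.toSpanSingleton K L (B.path i (2 * n - 1) i)) ∘ₗ
    LinearMap.proj i

lemma socCol_apply (y : Fin n → K) (i : Fin n) :
    B.socCol y i = y i • B.path i (2 * n - 1) i := rfl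

/-- The columns of linear combinations of closed paths of even length. -/
def evenCol : (Fin n → K) →ₗ[K] (Fin n → L) :=
  LinearMap.pi fun i => Fintype.linearCombination K fun e : Fin n => B.path i (2 * e) i

lemma evenCol_apply (x : Fin n → K) (i : Fin n) :
    B.evenCol x i = ∑ e : Fin n, x e • B.path i (2 * e) i := rfl

lemma envAct_vtxIdem_path (i : Fin n) (d : ℕ) :
    envAct (B.vtxIdem i) (B.path i d i) = B.path i d i := by
  rw [vtxIdem, envAct_tm, vtx_mul_path, path_mul_vtx]

lemma arr_mul_path_last (a : LArrow n) : B.arr a * B.path a.tgt (2 * n - 1) a.tgt = 0 := by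
  rw [B.arr_mul_path (valid_last _), B.path_of_not_valid]
  intro h
  have := lt_two_mul_of_valid h
  omega

lemma path_last_mul_arr (a : LArrow n) : B.path a.src (2 * n - 1) a.src * B.arr a = 0 := by
  rw [B.path_mul_arr (valid_last _), B.path_of_not_valid]
  intro h
  have := lt_two_mul_of_valid h
  omega

lemma socCol_mem (s : K) (y : Fin n → K) :
    B.socCol y ∈ idemCols B.vtxIdem ⊓ LinearMap.ker (colMap (B.mat₁ s)) := by
  refine ⟨fun i => ?_, funext fun a => ?_⟩
  · rw [socCol_apply, map_smul, envAct_vtxIdem_path]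
  · rw [colMap_mat₁, socCol_apply, socCol_apply, mul_smul_comm, arr_mul_path_last, mul_assoc,
      smul_mul_assoc _ (B.path a.src _ a.src), path_last_mul_arr]
    simp

/-- Both products are the path of length 2e + 1 along a. If either closed path is inadmissible, so
is this longer one. Hence the sum of the closed paths of length 2e over all vertices is central. -/
lemma arr_mul_path_even (a : LArrow n) (e : ℕ) :
    B.arr a * B.path a.tgt (2 * e) a.tgt = B.path a.src (2 * e) a.src * B.arr a := by
  have hs := a.src.2
  have ht := a.tgt.2
  have h1 : ¬ Valid n a.tgt a.tgt (2 * e) → ¬ Valid n a.src a.tgt (2 * e + 1) := by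
    rcases a with _ | i | i <;> simp <;> unfold Valid <;> omega
  have h2 : ¬ Valid n a.src a.src (2 * e) → ¬ Valid n a.src a.tgt (2 * e + 1) := by
    rcases a with _ | i | i <;> simp <;> unfold Valid <;> omega
  have h3 : B.arr a * B.path a.tgt (2 * e) a.tgt = B.path a.src (2 * e + 1) a.tgt := by
    by_cases h : Valid n a.tgt a.tgt (2 * e)
    · exact B.arr_mul_path h
    · rw [B.path_of_not_valid h, B.path_of_not_valid (h1 h), mul_zero]
  rw [h3]
  by_cases h : Valid n a.src a.src (2 * e)
  · exact (B.path_mul_arr h).symm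
  · rw [B.path_of_not_valid h, B.path_of_not_valid (h2 h), zero_mul]

lemma evenCol_mem (x : Fin n → K) :
    B.evenCol x ∈ idemCols B.vtxIdem ⊓ LinearMap.ker (colMap (B.mat₁ 1)) := by
  have h (i : Fin n) : envAct (B.vtxIdem i) (B.evenCol x i) = B.evenCol x i := by
    rw [evenCol_apply, map_sum]
    exact Finset.sum_congr rfl fun e _ => by rw [map_smul, envAct_vtxIdem_path]
  have h' (i : Fin n) : B.vtx i * B.evenCol x i * B.vtx i = B.evenCol x i :=
    (envAct_tm _ _ _).symm.trans (h i)
  have hl (i : Fin n) : B.evenCol x i * B.vtx i = B.evenCol x i := by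
    rw [← h', mul_assoc, vtx_mul_self]
  have hr (i : Fin n) : B.vtx i * B.evenCol x i = B.evenCol x i := by
    rw [← h', ← mul_assoc, ← mul_assoc, vtx_mul_self]
  refine ⟨h, funext fun a => ?_⟩
  rw [colMap_mat₁, one_smul, mul_assoc, hl, hr, evenCol_apply, evenCol_apply, Finset.mul_sum,
    Finset.sum_mul, Pi.zero_apply, sub_eq_zero]
  refine Finset.sum_congr rfl fun e _ => ?_
  rw [mul_smul_comm, smul_mul_assoc, arr_mul_path_even]

lemma coef_last_socCol (y : Fin n → K) (i : Fin n) :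
    B.coef i (2 * n - 1) i (B.socCol y i) = y i := by
  rw [socCol_apply, map_smul, B.coef_path_self (valid_last i), smul_eq_mul, mul_one]

lemma coef_last_evenCol (x : Fin n → K) (i : Fin n) :
    B.coef i (2 * n - 1) i (B.evenCol x i) = 0 := by
  have := NeZero.pos n
  rw [evenCol_apply, map_sum]
  refine Finset.sum_eq_zero fun e _ => ?_
  rw [map_smul]
  by_cases h : Valid n i i (2 * e)
  · rw [B.coef_path h, if_neg (by omega), smul_zero]
  · rw [B.path_of_not_valid h, map_zero, smul_zero]

lemma coef_even_socCol (y : Fin n → K) (e : ℕ) : B.coef 0 (2 * e) 0 (B.socCol y 0) = 0 := by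
  have := NeZero.pos n
  rw [socCol_apply, map_smul, B.coef_path (valid_last 0), if_neg (by omega), smul_zero]

lemma coef_even_evenCol (x : Fin n → K) (e : Fin n) :
    B.coef 0 (2 * e) 0 (B.evenCol x 0) = x e := by
  have hv (e : Fin n) : Valid n (0 : Fin n) (0 : Fin n) (2 * e) := by
    have := e.2
    simp only [Fin.val_zero]
    unfold Valid
    omega
  rw [evenCol_apply, map_sum, Finset.sum_eq_single e]
  · rw [map_smul, B.coef_path_self (hv e), smul_eq_mul, mul_one]
  · intro e' _ h
    rw [map_smul, B.coef_path (hv e'), if_neg, smul_zero]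
    have := Fin.val_ne_of_ne h
    omega
  · simp

lemma finrank_ker_mat₁_one : Module.finrank K
    (idemCols B.vtxIdem ⊓ LinearMap.ker (colMap (B.mat₁ 1)) : Submodule K (Fin n → L)) =
      2 * n := by
  have := B.module_finite
  rw [finrank_eq_of_coordinates (W := (Fin n → K) × (Fin n → K)) _
    (LinearMap.prod (LinearMap.pi fun e : Fin n => B.coef 0 (2 * e) 0 ∘ₗ LinearMap.proj 0)
      (LinearMap.pi fun i => B.coef i (2 * n - 1) i ∘ₗ LinearMap.proj i))
    (LinearMap.coprod B.evenCol B.socCol)]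
  · rw [Module.finrank_prod, Module.finrank_fintype_fun_eq_card, Fintype.card_fin, two_mul]
  · intro g hg h
    rw [Prod.ext_iff] at h
    exact B.eq_zero_of_colMap_mat₁ one_ne_zero hg (fun e he => congrFun h.1 ⟨e, he⟩)
      fun i => congrFun h.2 i
  · rintro ⟨x, y⟩
    exact add_mem (B.evenCol_mem x) (B.socCol_mem 1 y)
  · rintro ⟨x, y⟩
    refine Prod.ext (funext fun e => ?_) (funext fun i => ?_)
    · change B.coef 0 (2 * e) 0 (B.evenCol x 0 + B.socCol y 0) = x e
      rw [map_add, coef_even_evenCol, coef_even_socCol, add_zero]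
    · change B.coef i (2 * n - 1) i (B.evenCol x i + B.socCol y i) = y i
      rw [map_add, coef_last_evenCol, coef_last_socCol, zero_add]

/-- At the loop, source and target coincide and the equation reads c = -c for the even coefficients,
which vanish as 2 ≠ 0. Only the longest paths remain. -/
lemma finrank_ker_mat₁_neg_one (h2 : (2 : K) ≠ 0) : Module.finrank K
    (idemCols B.vtxIdem ⊓ LinearMap.ker (colMap (B.mat₁ (-1))) : Submodule K (Fin n → L)) =
      n := by
  have := B.module_finite
  rw [finrank_eq_of_coordinates (W := Fin n → K) _
      (LinearMap.pi fun i => B.coef i (2 * n - 1) i ∘ₗ LinearMap.proj i) B.socCol]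
  · rw [Module.finrank_fintype_fun_eq_card, Fintype.card_fin]
  · intro g hg h
    refine B.eq_zero_of_colMap_mat₁ (by simp) hg (fun e he => ?_) fun i => congrFun h i
    have h1 := B.eq_of_colMap_mat₁ hg.2 loop (d := 2 * e)
      -- The length 2e + 1 is admissible at vertex 0 because e < n.
      (by rw [src_loop, tgt_loop]; unfold Valid; omega)
    change B.coef 0 (2 * e) 0 (g 0) = -1 * B.coef 0 (2 * e) 0 (g 0) at h1
    refine (mul_eq_zero.1 ?_).resolve_left h2
    linear_combination h1
  · exact B.socCol_mem _
  · intro y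
    exact funext fun i => B.coef_last_socCol y i

lemma finrank_range_mat₁_one : Module.finrank K (LinearMap.range (colMap (B.mat₁ 1))) + 2 * n =
    Module.finrank K (idemCols B.vtxIdem) := by
  have := B.module_finite
  rw [← map_idemCols_eq_range B.vtxIdem_mul_self _ (B.mat₁_mul_vtxIdem 1),
    ← B.finrank_ker_mat₁_one, finrank_map_add_finrank_inf_ker]

lemma finrank_range_mat₁_neg_one (h2 : (2 : K) ≠ 0) :
    Module.finrank K (LinearMap.range (colMap (B.mat₁ (-1)))) + n =
      Module.finrank K (idemCols B.vtxIdem) := by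
  have := B.module_finite
  have h := finrank_map_add_finrank_inf_ker (idemCols B.vtxIdem) (colMap (B.mat₁ (-1)))
  rwa [B.finrank_ker_mat₁_neg_one h2,
    map_idemCols_eq_range B.vtxIdem_mul_self _ (B.mat₁_mul_vtxIdem (-1))] at h

end PathBasis

/-! ### Ranks of the second and third differentials. -/

namespace PathBasis

open LArrow

variable {K : Type u} [Field K] {n : ℕ} [NeZero n] {L : Type u} [Ring L] [Algebra K L]
  (B : PathBasis K n L)

lemma colMap_mat₂ (s : K) (h : LArrow n → L) (i : Fin n) : colMap (B.mat₂ s) h i =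
    ∑ a : LArrow n, ((if a.tgt = i then sg K a.bar • (B.arr a.bar * h a * B.vtx a.tgt) else 0) +
      if a.src = i then (s * sg K a) • (B.vtx a.src * h a * B.arr a.bar) else 0) := by
  rw [colMap_apply]
  refine Finset.sum_congr rfl fun a _ => ?_
  rw [mat₂, map_add, LinearMap.add_apply]
  congr 1
  · split_ifs
    · rw [map_smul, LinearMap.smul_apply, envAct_tm]
    · rw [map_zero, LinearMap.zero_apply]
  · split_ifs
    · rw [map_smul, LinearMap.smul_apply, envAct_tm]
    · rw [map_zero, LinearMap.zero_apply]

/-- The adjoint of the second differential is, up to signs, the first one. -/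
def adjMat₂ (s : K) : (Fin n → L) →ₗ[K] (LArrow n → L) :=
  LinearMap.pi fun a => (s * sg K a * (-1) ^ (a.src : ℕ)) •
    (LinearMap.proj a.bar ∘ₗ colMap (B.mat₁ (-s)) ∘ₗ
      LinearMap.pi fun i : Fin n => (-1 : K) ^ (i : ℕ) • LinearMap.proj i)

lemma adjMat₂_apply {s : K} (hs : s * s = 1) (g : Fin n → L) (a : LArrow n) : B.adjMat₂ s g a =
    sg K a.bar • (B.vtx a.tgt * g a.tgt * B.arr a.bar) +
      (s * sg K a) • (B.arr a.bar * g a.src * B.vtx a.src) := by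
  have h1 : B.adjMat₂ s g a = (s * sg K a * (-1) ^ (a.src : ℕ)) •
    colMap (B.mat₁ (-s)) (fun i : Fin n => (-1 : K) ^ (i : ℕ) • g i) a.bar := rfl
  have e1 : (-1 : K) ^ (a.src : ℕ) * (-1) ^ (a.src : ℕ) = 1 := by
    rw [← mul_pow, neg_one_mul, neg_neg, one_pow]
  have e2 : (-1 : K) ^ (a.tgt : ℕ) * (-1) ^ (a.tgt : ℕ) = 1 := by
    rw [← mul_pow, neg_one_mul, neg_neg, one_pow]
  have e3 := sg_bar (K := K) a
  rw [h1, colMap_mat₁, tgt_bar, src_bar, neg_smul, sub_neg_eq_add, smul_add, add_comm]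
  congr 1
  · rw [mul_smul_comm, smul_mul_assoc, smul_smul, smul_smul]
    congr 1
    -- The sign at the source is traded for the sign at the target by `e3`; the squares of signs and
    -- of s are 1.
    linear_combination (s * s * (-1) ^ (a.tgt : ℕ)) * (-e3) +
      (s * s * sg K a.bar) * e2 + sg K a.bar * hs
  · rw [mul_smul_comm, smul_mul_assoc, smul_smul]
    congr 1
    linear_combination (s * sg K a) * e1

/-- Cyclic invariance of the trace carries a left factor of h to a right factor of g and conversely.
-/
lemma adjoint_mat₂ {s : K} (hs : s * s = 1) (h : LArrow n → L) (g : Fin n → L) :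
    ∑ i, B.symmForm.τ (colMap (B.mat₂ s) h i * g i) =
      ∑ a, B.symmForm.τ (h a * B.adjMat₂ s g a) := by
  simp_rw [colMap_mat₂, Finset.sum_mul, map_sum]
  rw [Finset.sum_comm]
  refine Finset.sum_congr rfl fun a _ => ?_
  simp_rw [add_mul, map_add, Finset.sum_add_distrib, ite_mul, zero_mul, apply_ite B.symmForm.τ,
    map_zero]
  rw [Finset.sum_ite_eq, Finset.sum_ite_eq, if_pos (Finset.mem_univ _), if_pos (Finset.mem_univ _),
    B.adjMat₂_apply hs, mul_add, map_add, mul_smul_comm, mul_smul_comm, smul_mul_assoc,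
    smul_mul_assoc, map_smul, map_smul, map_smul, map_smul]
  congr 2
  · rw [mul_assoc, mul_assoc, B.symmForm.symm]
    simp only [mul_assoc]
  · rw [mul_assoc, mul_assoc, B.symmForm.symm]
    simp only [mul_assoc]

lemma finrank_range_adjMat₂ {s : K} (hs : s ≠ 0) :
    Module.finrank K (LinearMap.range (B.adjMat₂ s)) =
      Module.finrank K (LinearMap.range (colMap (B.mat₁ (-s)))) := by
  let C : (Fin n → L) ≃ₗ[K] (Fin n → L) := LinearEquiv.piCongrRight fun i =>
    LinearEquiv.smulOfNeZero K L ((-1 : K) ^ (i : ℕ)) (pow_ne_zero _ (by simp))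
  let D : (LArrow n → L) ≃ₗ[K] (LArrow n → L) :=
    (LinearEquiv.funCongrLeft K L (barEquiv n)).trans (LinearEquiv.piCongrRight fun a =>
      LinearEquiv.smulOfNeZero K L (s * sg K a * (-1) ^ (a.src : ℕ))
        (mul_ne_zero (mul_ne_zero hs (sg_ne_zero _)) (pow_ne_zero _ (by simp))))
  have h : B.adjMat₂ s = D.toLinearMap ∘ₗ colMap (B.mat₁ (-s)) ∘ₗ C.toLinearMap := rfl
  rw [h, LinearMap.range_comp, LinearMap.range_comp_of_range_eq_top _ C.range]
  exact LinearEquiv.finrank_map_eq D _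

lemma finrank_range_mat₂ {s : K} (hs : s * s = 1) :
    Module.finrank K (LinearMap.range (colMap (B.mat₂ s))) =
      Module.finrank K (LinearMap.range (colMap (B.mat₁ (-s)))) := by
  have := B.module_finite
  rw [B.symmForm.finrank_range_eq_of_adjoint _ _ (B.adjoint_mat₂ hs), finrank_range_adjMat₂]
  rintro rfl
  simp at hs

/-- The outer factors already have total length 2n - 1, so any part of x of positive length gives 0.
Only the coefficient of the vertex i counts. -/
lemma path_mul_mul_path (j i : Fin n) {d : ℕ} (hd : d < 2 * n) (x : L) :
    B.path j d i * x * B.path i (2 * n - 1 - d) j =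
      (if Valid n j i d then B.coef i 0 i x else 0) • B.path j (2 * n - 1) j := by
  by_cases hv : Valid n j i d
  · rw [if_pos hv]
    have hv' := (valid_dual hd).2 hv
    have h : LinearMap.mulRight K (B.path i (2 * n - 1 - d) j) ∘ₗ
        LinearMap.mulLeft K (B.path j d i) =
          LinearMap.toSpanSingleton K L (B.path j (2 * n - 1) j) ∘ₗ B.coef i 0 i := by
      refine B.hom_ext fun i' e j' h => ?_
      rw [LinearMap.comp_apply, LinearMap.comp_apply, LinearMap.mulLeft_apply,
        LinearMap.mulRight_apply, LinearMap.toSpanSingleton_apply, B.coef_path h]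
      by_cases hi : i = i'
      · subst hi
        rw [B.path_mul_path hv h]
        by_cases hj : j' = i
        · subst hj
          by_cases he : e = 0
          · subst he
            rw [if_pos ⟨rfl, rfl, rfl⟩, one_smul, add_zero, B.path_mul_path hv hv',
              show d + (2 * n - 1 - d) = 2 * n - 1 by omega]
          · rw [if_neg (by tauto), zero_smul]
            by_cases hw : Valid n j j' (d + e)
            · rw [B.path_mul_path hw hv', B.path_of_not_valid]
              intro h1
              have := lt_two_mul_of_valid h1
              omega
            · rw [B.path_of_not_valid hw, zero_mul]
        · rw [B.path_mul_path_of_ne _ _ hj, if_neg (by tauto), zero_smul]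
      · rw [B.path_mul_path_of_ne _ _ hi, zero_mul, if_neg (by tauto), zero_smul]
    exact LinearMap.congr_fun h x
  · rw [if_neg hv, B.path_of_not_valid hv, zero_mul, zero_mul, zero_smul]

/-- The entries of the matrix of the third differential. -/
def casimirCoef (s : K) (n : ℕ) (j i : Fin n) : K :=
  ∑ d ∈ Finset.range (2 * n), if Valid n j i d then (-s) ^ d else 0

lemma colMap_mat₃ (s : K) (g : Fin n → L) (j : Fin n) : colMap (B.mat₃ s) g j =
    (∑ i : Fin n, (-1) ^ (i : ℕ) * (casimirCoef s n j i * B.coef i 0 i (g i))) •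
      B.path j (2 * n - 1) j := by
  rw [colMap_apply, Finset.sum_smul]
  refine Finset.sum_congr rfl fun i _ => ?_
  rw [mat₃, map_smul, LinearMap.smul_apply, map_sum, LinearMap.sum_apply, mul_smul, casimirCoef,
    Finset.sum_mul, Finset.sum_smul]
  congr 1
  refine Finset.sum_congr rfl fun d hd => ?_
  rw [map_smul, LinearMap.smul_apply, envAct_tm, B.path_mul_mul_path _ _ (Finset.mem_range.1 hd),
    smul_smul]
  congr 1
  split_ifs <;> simp

lemma casimirCoef_neg_one (j i : Fin n) : casimirCoef (-1 : K) n j i = (mult n i j : ℕ) := by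
  rw [casimirCoef, ← card_valid i j, Finset.card_filter, Nat.cast_sum]
  refine Finset.sum_congr rfl fun d _ => ?_
  rw [neg_neg, one_pow]
  by_cases h : Valid n i j d
  · rw [if_pos (valid_symm h), if_pos h, Nat.cast_one]
  · rw [if_neg (mt valid_symm h), if_neg h, Nat.cast_zero]

/-- The reflection d ↦ 2n - 1 - d preserves the admissible lengths and reverses parity, so the
alternating sum equals its own negative. -/
lemma casimirCoef_one (h2 : (2 : K) ≠ 0) (j i : Fin n) : casimirCoef (1 : K) n j i = 0 := by
  have h : casimirCoef (1 : K) n j i = -casimirCoef (1 : K) n j i := by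
    conv_lhs => rw [casimirCoef, ← Finset.sum_range_reflect]
    rw [casimirCoef, ← Finset.sum_neg_distrib]
    refine Finset.sum_congr rfl fun d hd => ?_
    have hd' := Finset.mem_range.1 hd
    have hv : Valid n j i (2 * n - 1 - d) ↔ Valid n j i d :=
      ⟨fun h => (valid_dual hd').1 (valid_symm h), fun h => valid_symm ((valid_dual hd').2 h)⟩
    rw [if_congr hv rfl rfl]
    split_ifs
    · rcases Nat.even_or_odd d with he | ho
      · have : Odd (2 * n - 1 - d) := by
          obtain ⟨e, rfl⟩ := he
          exact ⟨n - 1 - e, by omega⟩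
        rw [this.neg_one_pow, he.neg_one_pow]
      · have : Even (2 * n - 1 - d) := by
          obtain ⟨e, rfl⟩ := ho
          exact ⟨n - 1 - e, by omega⟩
        rw [this.neg_one_pow, ho.neg_one_pow, neg_neg]
    · rw [neg_zero]
  refine (mul_eq_zero.1 ?_).resolve_left h2
  linear_combination h

lemma finrank_range_mat₃_one (h2 : (2 : K) ≠ 0) :
    Module.finrank K (LinearMap.range (colMap (B.mat₃ 1))) = 0 := by
  have h : colMap (B.mat₃ 1) = 0 := by
    refine LinearMap.ext fun g => funext fun j => ?_
    rw [colMap_mat₃]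
    simp [casimirCoef_one h2]
  rw [h, LinearMap.range_zero, finrank_bot]

/-- The columns of multiples of vertices. -/
def vtxCol : (Fin n → K) →ₗ[K] (Fin n → L) :=
  LinearMap.pi fun i => (LinearMap.toSpanSingleton K L (B.vtx i)) ∘ₗ LinearMap.proj i

lemma vtxCol_apply (y : Fin n → K) (i : Fin n) : B.vtxCol y i = y i • B.vtx i := rfl

/-- On columns of vertices the third differential is C up to the signs (-1) ^ i, and (2 - A) C = 2
inverts it when 2 ≠ 0. -/
lemma eq_zero_of_mat₃ (h2 : (2 : K) ≠ 0) {x : Fin n → K}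
    (hx : colMap (B.mat₃ (-1)) (B.vtxCol x) = 0) : x = 0 := by
  have h (j : Fin n) : ∑ i : Fin n, (-1 : K) ^ (i : ℕ) * ((mult n i j : ℕ) * x i) = 0 := by
    have h1 := congrArg (B.coef j (2 * n - 1) j) (congrFun hx j)
    rw [colMap_mat₃, map_smul, B.coef_path_self (valid_last j), smul_eq_mul, mul_one, Pi.zero_apply,
      map_zero] at h1
    rw [← h1]
    refine Finset.sum_congr rfl fun i _ => ?_
    rw [casimirCoef_neg_one, vtxCol_apply, map_smul, vtx, B.coef_path_self (valid_self i),
      smul_eq_mul, mul_one]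
  refine funext fun j => ?_
  have h3 (i : Fin n) : ∑ a : LArrow n with a.src = j, ((mult n i a.tgt : ℕ) : K) +
      (if i = j then 2 else 0) = 2 * (mult n i j : ℕ) := by
    have := congrArg (Nat.cast : ℕ → K) (sum_mult_tgt i j)
    push_cast at this
    exact this
  -- Apply 2 - A to the system: the sums at j and at the neighbours of j all vanish, and what is
  -- left is ± 2 x_j = 0.
  have h4 : ∑ i : Fin n, (-1 : K) ^ (i : ℕ) * ((∑ a : LArrow n with a.src = j,
      ((mult n i a.tgt : ℕ) : K) + (if i = j then 2 else 0)) * x i) = 0 := by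
    simp_rw [h3]
    refine Eq.trans (b := 2 * ∑ i : Fin n, (-1 : K) ^ (i : ℕ) * ((mult n i j : ℕ) * x i)) ?_
      (by rw [h j, mul_zero])
    rw [Finset.mul_sum]
    exact Finset.sum_congr rfl fun i _ => by ring
  simp_rw [add_mul, mul_add, Finset.sum_add_distrib, Finset.sum_mul, Finset.mul_sum] at h4
  rw [Finset.sum_comm, Finset.sum_congr rfl fun a _ => h a.tgt, Finset.sum_const_zero, zero_add]
    at h4
  simp only [ite_mul, zero_mul, mul_ite, mul_zero] at h4
  rw [Finset.sum_ite_eq', if_pos (Finset.mem_univ _)] at h4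
  have h5 := (mul_eq_zero.1 h4).resolve_left (pow_ne_zero _ (by simp))
  exact (mul_eq_zero.1 h5).resolve_left h2

/-- The image lies in the columns of longest paths, of dimension n, and already the columns of
vertices have an image of dimension n. -/
lemma finrank_range_mat₃_neg_one (h2 : (2 : K) ≠ 0) :
    Module.finrank K (LinearMap.range (colMap (B.mat₃ (-1)))) = n := by
  have := B.module_finite
  refine le_antisymm ?_ ?_
  · have h : LinearMap.range (colMap (B.mat₃ (-1))) ≤ LinearMap.range B.socCol := by
      rintro _ ⟨g, rfl⟩
      exact ⟨_, (funext fun j => B.colMap_mat₃ (-1) g j).symm⟩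
    refine (Submodule.finrank_mono h).trans ((LinearMap.finrank_range_le _).trans ?_)
    rw [Module.finrank_fintype_fun_eq_card, Fintype.card_fin]
  · have h : Function.Injective (colMap (B.mat₃ (-1)) ∘ₗ B.vtxCol) :=
      (injective_iff_map_eq_zero _).2 fun x hx => B.eq_zero_of_mat₃ h2 hx
    have h' := LinearMap.finrank_range_of_inj h
    rw [Module.finrank_fintype_fun_eq_card, Fintype.card_fin] at h'
    exact h'.symm.le.trans (Submodule.finrank_mono (LinearMap.range_comp_le_range _ _))

/-! ### Hochschild homology and cohomology -/

/-- The rank of a differential of the Hochschild cochains. -/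
def cochainRank (s : K) (m : ℕ) : ℕ :=
  Module.finrank K (LinearMap.range (precompSelf K L (B.resD s m)))

lemma cochainRank_zero (s : K) :
    B.cochainRank s 0 = Module.finrank K (LinearMap.range (colMap (B.mat₁ s))) := by
  rw [← map_idemCols_eq_range B.vtxIdem_mul_self _ (B.mat₁_mul_vtxIdem s)]
  exact finrank_range_precompSelf B.arrIdem_mul_self B.vtxIdem_mul_self (B.mat₁ s)
    (B.mat₁_mul_vtxIdem s) (B.arrIdem_mul_mat₁ s) _ rfl

lemma cochainRank_one (s : K) :
    B.cochainRank s 1 = Module.finrank K (LinearMap.range (colMap (B.mat₂ s))) := by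
  rw [← map_idemCols_eq_range B.arrIdem_mul_self _ (B.mat₂_mul_arrIdem s)]
  exact finrank_range_precompSelf B.vtxIdem_mul_self B.arrIdem_mul_self (B.mat₂ s)
    (B.mat₂_mul_arrIdem s) (B.vtxIdem_mul_mat₂ s) _ rfl

lemma cochainRank_two (s : K) :
    B.cochainRank s 2 = Module.finrank K (LinearMap.range (colMap (B.mat₃ s))) := by
  rw [← map_idemCols_eq_range B.vtxIdem_mul_self _ (B.mat₃_mul_vtxIdem s)]
  exact finrank_range_precompSelf B.vtxIdem_mul_self B.vtxIdem_mul_self (B.mat₃ s)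
    (B.mat₃_mul_vtxIdem s) (B.vtxIdem_mul_mat₃ s) _ rfl

lemma cochainRank_add_three (s : K) (m : ℕ) : B.cochainRank s (m + 3) = B.cochainRank (-s) m := rfl

lemma finrank_resX_hom_vtx :
    Module.finrank K (B.resX 0 ⟶ envSelf K L) = Module.finrank K (idemCols B.vtxIdem) :=
  finrank_hom_envSelf B.vtxIdem_mul_self

lemma finrank_resX_hom_arr :
    Module.finrank K (B.resX 1 ⟶ envSelf K L) = Module.finrank K (idemCols B.arrIdem) :=
  finrank_hom_envSelf B.arrIdem_mul_self

lemma cochainRank_zero_one (B : PathBasis K n L) : B.cochainRank 1 0 + 2 * n =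
    Module.finrank K (B.resX 0 ⟶ envSelf K L) := by
  rw [cochainRank_zero, finrank_range_mat₁_one, finrank_resX_hom_vtx]

/-- Let h be the dimension of Hom(P₀, L); that of Hom(P₁, L) is 2h - 2n. The ranks of the three
differentials are h - 2n, h - n, 0 for s = 1 and h - n, h - 2n, n for s = -1. In each of the six
positive degrees of a period, the dimension minus the two adjacent ranks is n. -/
lemma finrank_resX_hom (h2 : (2 : K) ≠ 0) (m : ℕ) : ∀ s : K, s = 1 ∨ s = -1 →
    Module.finrank K (B.resX (m + 1) ⟶ envSelf K L) =
      n + B.cochainRank s m + B.cochainRank s (m + 1) := by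
  have h1 := B.finrank_range_mat₁_one
  have h1' := B.finrank_range_mat₁_neg_one h2
  have h3 := B.finrank_range_mat₃_one h2
  have h3' := B.finrank_range_mat₃_neg_one h2
  have h2 := B.finrank_range_mat₂ (s := 1) (one_mul 1)
  have h2' := B.finrank_range_mat₂ (s := -1) (by ring)
  have h0 := B.finrank_idemCols_add
  rw [neg_neg] at h2'
  induction m using Nat.strong_induction_on with
  | _ m ih =>
    match m with
    | 0 =>
      rintro s (rfl | rfl)
      all_goals
        rw [cochainRank_zero, cochainRank_one, finrank_resX_hom_arr]
        omega
    | 1 =>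
      rintro s (rfl | rfl)
      all_goals
        rw [cochainRank_one, cochainRank_two,
          show Module.finrank K (B.resX (1 + 1) ⟶ envSelf K L) = _ from B.finrank_resX_hom_vtx]
        omega
    | 2 =>
      rintro s (rfl | rfl)
      all_goals
        rw [cochainRank_two, show 2 + 1 = 0 + 3 from rfl, cochainRank_add_three, cochainRank_zero,
          show Module.finrank K (B.resX (0 + 3) ⟶ envSelf K L) = _ from B.finrank_resX_hom_vtx]
      · omega
      · rw [neg_neg]
        omega
    | m + 3 =>
      rintro s hs
      -- A shift by three flips the sign, so the induction has to treat both signs together.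
      exact ih m (by omega) (-s) (by rcases hs with rfl | rfl <;> simp)

theorem finrank_HHcoh_zero (B : PathBasis K n L) : Module.finrank K (HHcoh K L 0) = 2 * n := by
  have : Module.Finite K (B.resolution.X 0 ⟶ envSelf K L) := B.finite_resX_hom 0
  have h := _root_.finrank_HHcoh_zero B.resolution
  have h' := B.cochainRank_zero_one
  change _ + B.cochainRank 1 0 = Module.finrank K (B.resX 0 ⟶ envSelf K L) at h
  omega

theorem finrank_HHcoh_succ (B : PathBasis K n L) (h2 : (2 : K) ≠ 0) (i : ℕ) :
    Module.finrank K (HHcoh K L (i + 1)) = n := by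
  have : Module.Finite K (B.resolution.X (i + 1) ⟶ envSelf K L) := B.finite_resX_hom (i + 1)
  have h := _root_.finrank_HHcoh_succ B.resolution i
  have h' := B.finrank_resX_hom h2 i 1 (Or.inl rfl)
  change _ + B.cochainRank 1 i + B.cochainRank 1 (i + 1) =
    Module.finrank K (B.resX (i + 1) ⟶ envSelf K L) at h
  omega

/-- Finiteness is inherited from Hom(P, L), which is the dual of this space. -/
lemma finite_envTensor_resX (B : PathBasis K n L) (i : ℕ) :
    Module.Finite K ((envTensor K L).obj (B.resX i)) := by
  have := B.module_finite
  have := B.finite_resX_hom i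
  have h : Module.Finite K (Module.Dual K ((envTensor K L).obj (B.resX i))) :=
    Module.Finite.equiv (B.symmForm.dualEquiv (B.resX i))
  exact (Module.finite_dual_iff K).1 h

theorem finrank_HHhom_zero (B : PathBasis K n L) : Module.finrank K (HHhom K L 0) = 2 * n := by
  have := B.module_finite
  have : Module.Finite K ((envTensor K L).obj (B.resolution.X 0)) := B.finite_envTensor_resX 0
  have h := _root_.finrank_HHhom_zero B.resolution
  rw [B.symmForm.finrank_range_envTensor_map, B.symmForm.finrank_envTensor_obj] at h
  have h' := B.cochainRank_zero_one
  change _ + B.cochainRank 1 0 = Module.finrank K (B.resX 0 ⟶ envSelf K L) at h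
  omega

theorem finrank_HHhom_succ (B : PathBasis K n L) (h2 : (2 : K) ≠ 0) (i : ℕ) :
    Module.finrank K (HHhom K L (i + 1)) = n := by
  have := B.module_finite
  have : Module.Finite K ((envTensor K L).obj (B.resolution.X (i + 1))) :=
    B.finite_envTensor_resX (i + 1)
  have h := _root_.finrank_HHhom_succ B.resolution i
  rw [B.symmForm.finrank_range_envTensor_map, B.symmForm.finrank_range_envTensor_map,
    B.symmForm.finrank_envTensor_obj] at h
  have h' := B.finrank_resX_hom h2 i 1 (Or.inl rfl)
  change _ + B.cochainRank 1 (i + 1) + B.cochainRank 1 i =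
    Module.finrank K (B.resX (i + 1) ⟶ envSelf K L) at h
  omega

end PathBasis

theorem theorem4p4 (K : Type u) [Field K] [IsAlgClosed K] (hK : ringChar K ≠ 2)
    (n : ℕ) [NeZero n] :
    (Module.finrank K (HHcoh K (PL K n) 0) = 2 * n ∧
      Module.finrank K (HHhom K (PL K n) 0) = 2 * n) ∧
    ∀ i : ℕ, 0 < i →
      Module.finrank K (HHcoh K (PL K n) i) = n ∧
      Module.finrank K (HHhom K (PL K n) i) = n := by
  have h2 : (2 : K) ≠ 0 := Ring.two_ne_zero hK
  have B := PL.pathBasis K n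
  refine ⟨⟨B.finrank_HHcoh_zero, B.finrank_HHhom_zero⟩, fun i hi => ?_⟩
  obtain ⟨i, rfl⟩ := Nat.exists_eq_succ_of_ne_zero hi.ne'
  exact ⟨B.finrank_HHcoh_succ h2 i, B.finrank_HHhom_succ h2 i⟩
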